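/- Let $(M,g)$ be a complete (connected) Riemannian manifold of dimension $n\ge 2$, let $\phi:M\to\mathbb R$ be smooth, and let $\Omega\subset M$ be a connected proper domain with smooth boundary $\Sigma=\partial\Omega$ (an embedded hypersurface with $\Omega$ locally on one side), with outward unit normal $\nu$. Integrals over $\Omega$ are with respect to $e^{-\phi}d\mathrm{vol}_g$, and integrals over $\Sigma$ with respect to $e^{-\phi}d\mathrm{area}_g$. Write $\nabla$ and $\nabla^2$ for the gradient and Hessian of $g$, and $D$ and $\Delta_\Sigma$ for the gradient and Laplacian of the induced metric on $\Sigma$. Put $u_\nu=\langle\nabla u,\nu\rangle$, $\Delta_\phi u=\Delta u-\langle\nabla\phi,\nabla u\rangle$, $\Delta_{\Sigma,\phi}u=\Delta_\Sigma u-\langle D\phi,Du\rangle$, $\mathrm{Ric}_\phi=\mathrm{Ric}_g+\nabla^2\phi$, $A_\Sigma(X,Y)=\langle\nabla_X\nu,Y\rangle$, $H=\operatorname{tr}A_\Sigma$ and $H_\phi=H-\langle\nabla\phi,\nu\rangle$. Let $h$ and $f$ be functions smooth on $\overline\Omega$. Call them a *suitable pair* if * $|h|\,(f^2+|\nabla f|^2+|\nabla^2f|^2+(\Delta_\phi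 f)^2)$ and $|\nabla h|\,(f^2+|\nabla f|^2)$ are integrable on $\Omega$, * $|h|\,|f_\nu|\,|Df|$ is integrable on $\Sigma$, and * the four integrands on the right-hand side of the formula below are integrable. If $\overline\Omega$ is compact, every pair of functions smooth on $\overline\Omega$ is suitable. For every suitable pair, \begin{align*} \int_\Omega h\left((\Delta_\phi f+f)^2-|\nabla^2f|^2\right) ={}&\int_\Sigma h\left(2f_\nu\,\Delta_{\Sigma,\phi}f+H_\phi f_\nu^2+A_\Sigma(Df,Df)+2f_\nu f\right)\\ &+\int_\Sigma h_\nu\left(|Df|^2-f^2\right)\\ &+\int_\Omega\left((\nabla^2h)(\nabla f,\nabla f)-\Delta_\phi h\,|\nabla f|^2-2h|\nabla f|^2+h\,\mathrm{Ric}_\phi(\nabla f,\nabla f)\right)\\ &+\int_\Omega(\Delta_\phi h+h)f^2 . \end{align*} -/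

import Mathlib

open Set Filter MeasureTheory Manifold Bundle
open scoped Topology ContDiff ENNReal

noncomputable section

/-! ### Linear algebra on a Euclidean vector space -/

/-- The trace `∑ᵢ B(bᵢ, bᵢ)` of a bilinear form, `b` being an orthonormal basis. -/
def bilinTrace {V : Type*} [NormedAddCommGroup V] [InnerProductSpace ℝ V] [FiniteDimensional ℝ V]
    (B : V → V → ℝ) : ℝ :=
  ∑ i, B (stdOrthonormalBasis ℝ V i) (stdOrthonormalBasis ℝ V i)

/-- The squared norm `∑ᵢⱼ B(bᵢ, bⱼ)²` of a bilinear form, `b` being an orthonormal basis. -/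
def bilinNormSq {V : Type*} [NormedAddCommGroup V] [InnerProductSpace ℝ V]
    [FiniteDimensional ℝ V] (B : V → V → ℝ) : ℝ :=
  ∑ i, ∑ j, B (stdOrthonormalBasis ℝ V i) (stdOrthonormalBasis ℝ V j) ^ 2

section Riemannian

variable {k : ℕ} {X : Type*} [TopologicalSpace X] [ChartedSpace (EuclideanSpace ℝ (Fin k)) X]

instance tangentSpace_finiteDimensional (p : X) : FiniteDimensional ℝ (TangentSpace (𝓡 k) p) :=
  inferInstanceAs (FiniteDimensional ℝ (EuclideanSpace ℝ (Fin k)))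

variable [RiemannianBundle (fun x : X ↦ TangentSpace (𝓡 k) x)]

/-! ### The metric, the volume and the Levi-Civita connection in a chart -/

/-- The coordinate field `∂ᵢ` of the chart `e`, at the point with coordinates `y`. -/
def coordField (e : OpenPartialHomeomorph X (EuclideanSpace ℝ (Fin k)))
    (y : EuclideanSpace ℝ (Fin k)) (i : Fin k) : TangentSpace (𝓡 k) (e.symm y) :=
  mfderiv (𝓡 k) (𝓡 k) e.symm y (EuclideanSpace.single i (1 : ℝ))

/-- The matrix `(gᵢⱼ)` of the metric in the chart `e`, at the point with coordinates `y`. -/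
def gram (e : OpenPartialHomeomorph X (EuclideanSpace ℝ (Fin k)))
    (y : EuclideanSpace ℝ (Fin k)) : Matrix (Fin k) (Fin k) ℝ :=
  Matrix.of fun i j ↦ inner ℝ (coordField e y i) (coordField e y j)

/-- The partial derivative `∂ᵢ F` at `y` of a function of the coordinates. -/
def pderivAt (i : Fin k) (F : EuclideanSpace ℝ (Fin k) → ℝ) (y : EuclideanSpace ℝ (Fin k)) : ℝ :=
  fderiv ℝ F y (EuclideanSpace.single i (1 : ℝ))

/-- The Christoffel symbols
`Γˡᵢⱼ = ½ ∑ₐ gˡᵃ (∂ᵢ gⱼₐ + ∂ⱼ gᵢₐ - ∂ₐ gᵢⱼ)` of the metric in the chart `e`. -/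
def christoffel (e : OpenPartialHomeomorph X (EuclideanSpace ℝ (Fin k))) (l i j : Fin k)
    (y : EuclideanSpace ℝ (Fin k)) : ℝ :=
  (1 / 2) * ∑ a, (gram e y)⁻¹ l a *
    (pderivAt i (fun z ↦ gram e z j a) y + pderivAt j (fun z ↦ gram e z i a) y
      - pderivAt a (fun z ↦ gram e z i j) y)

/-- The measure `√(det g) dy` of the domain of the chart `e`, as a measure on `X`. -/
def chartVolume [MeasurableSpace X] (e : OpenPartialHomeomorph X (EuclideanSpace ℝ (Fin k))) :
    Measure X :=
  ((volume.restrict e.target).withDensity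
    fun y ↦ ENNReal.ofReal (Real.sqrt (gram e y).det)).map e.symm

/-- The Riemannian volume measure. The measures `√(det g) dy` of two charts agree on the
intersection of their domains; their supremum is the measure obtained by gluing them. -/
def riemannianVolume (X : Type*) [TopologicalSpace X] [ChartedSpace (EuclideanSpace ℝ (Fin k)) X]
    [RiemannianBundle (fun x : X ↦ TangentSpace (𝓡 k) x)] [MeasurableSpace X] : Measure X :=
  ⨆ e ∈ atlas (EuclideanSpace ℝ (Fin k)) X, chartVolume e

/-- The weighted measure `e^{-ψ} dvol`. -/
def weightedVolume [MeasurableSpace X] (ψ : X → ℝ) : Measure X :=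
  (riemannianVolume (k := k) X).withDensity fun x ↦ ENNReal.ofReal (Real.exp (-ψ x))

/-- The coordinates of a tangent vector at `q` in the chart `e`. -/
def coords (e : OpenPartialHomeomorph X (EuclideanSpace ℝ (Fin k))) (q : X)
    (v : TangentSpace (𝓡 k) q) : EuclideanSpace ℝ (Fin k) :=
  mfderiv (𝓡 k) (𝓡 k) e q v

/-- The derivative `D_ξ V`, for the Levi-Civita connection of `X`, of a vector field `V` along a map
`c : Y → X`, in the direction of a tangent vector `ξ` of `Y` at `s`: in the coordinates of the chart
of `X` at `c s`, it is `∑ₗ (ξ(Vˡ) + ∑ᵢⱼ Γˡᵢⱼ (dc ξ)ⁱ Vʲ) ∂ₗ`. -/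
def covDerivAlong {r : ℕ} {Y : Type*} [TopologicalSpace Y]
    [ChartedSpace (EuclideanSpace ℝ (Fin r)) Y] (c : Y → X)
    (V : ∀ t : Y, TangentSpace (𝓡 k) (c t)) (s : Y) (ξ : TangentSpace (𝓡 r) s) :
    TangentSpace (𝓡 k) (c s) :=
  let e := chartAt (EuclideanSpace ℝ (Fin k)) (c s)
  ∑ l, (mvfderiv (𝓡 r) (fun t ↦ coords e (c t) (V t) l) s ξ
      + ∑ i, ∑ j, christoffel e l i j (e (c s))
          * coords e (c s) (mfderiv (𝓡 r) (𝓡 k) c s ξ) i * coords e (c s) (V s) j)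
    • (mfderiv (𝓡 k) (𝓡 k) e (c s)).inverse (EuclideanSpace.single l (1 : ℝ))

/-! ### Gradient, Hessian, Laplacian and Ricci tensor, and their weighted versions -/

/-- The gradient `∇u`: `⟨∇u, v⟩ = du(v)`. -/
def grad (u : X → ℝ) (p : X) : TangentSpace (𝓡 k) p :=
  haveI := FiniteDimensional.complete ℝ (TangentSpace (𝓡 k) p)
  (InnerProductSpace.toDual ℝ (TangentSpace (𝓡 k) p)).symm (mvfderiv (𝓡 k) u p)

/-- The Hessian `(∇²u)(v, w) = ⟨∇_v ∇u, w⟩`. -/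
def hess (u : X → ℝ) (p : X) (v w : TangentSpace (𝓡 k) p) : ℝ :=
  inner ℝ (covDerivAlong (fun q : X ↦ q) (fun q ↦ grad u q) p v) w

/-- The weighted Laplacian `Δ_ψ u = Δu - ⟨∇ψ, ∇u⟩`, with `Δu` the trace of the Hessian. -/
def weightedLaplacian (ψ u : X → ℝ) (p : X) : ℝ :=
  bilinTrace (hess (k := k) u p) - inner ℝ (grad (k := k) ψ p) (grad u p)

/-- The components `Rⱼᵢ = ∑ₗ (∂ₗ Γˡⱼᵢ - ∂ⱼ Γˡₗᵢ) + ∑ₗₘ (Γˡₗₘ Γᵐⱼᵢ - Γˡⱼₘ Γᵐₗᵢ)` of the Ricci tensor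
in the chart `e`. -/
def ricciCoord (e : OpenPartialHomeomorph X (EuclideanSpace ℝ (Fin k))) (j i : Fin k)
    (y : EuclideanSpace ℝ (Fin k)) : ℝ :=
  (∑ l, (pderivAt l (christoffel e l j i) y - pderivAt j (christoffel e l l i) y))
    + ∑ l, ∑ m, (christoffel e l l m y * christoffel e m j i y
      - christoffel e l j m y * christoffel e m l i y)

/-- The Ricci tensor. -/
def ricci (p : X) (v w : TangentSpace (𝓡 k) p) : ℝ :=
  let e := chartAt (EuclideanSpace ℝ (Fin k)) p
  ∑ j, ∑ i, ricciCoord e j i (e p) * coords e p v j * coords e p w i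

/-- The Bakry-Émery Ricci tensor `Ric_ψ = Ric + ∇²ψ`. -/
def weightedRicci (ψ : X → ℝ) (p : X) (v w : TangentSpace (𝓡 k) p) : ℝ :=
  ricci p v w + hess ψ p v w

end Riemannian

/-! ### Domains with smooth boundary -/

section Boundary

variable {m : ℕ}
  {M : Type*} [TopologicalSpace M] [ChartedSpace (EuclideanSpace ℝ (Fin (m + 1))) M]
  [RiemannianBundle (fun x : M ↦ TangentSpace (𝓡 (m + 1)) x)]
  {S : Type*} [TopologicalSpace S] [ChartedSpace (EuclideanSpace ℝ (Fin m)) S]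
  [RiemannianBundle (fun s : S ↦ TangentSpace (𝓡 m) s)]

/-- `Ω` is a connected proper domain, lying locally on one side of its boundary, and `ι` identifies
the Riemannian manifold `S` with this boundary, which is a smooth embedded hypersurface carrying
the induced metric. -/
structure IsDomainWithBoundary (Ω : Set M) (ι : S → M) : Prop where
  isOpen : IsOpen Ω
  isConnected : IsConnected Ω
  ne_univ : Ω ≠ univ
  interior_closure : interior (closure Ω) = Ω
  embedding : IsSmoothEmbedding (𝓡 m) (𝓡 (m + 1)) ∞ ι
  range_eq : range ι = frontier Ω
  isometric : ∀ (s : S) (v w : TangentSpace (𝓡 m) s),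
    (inner ℝ (mfderiv (𝓡 m) (𝓡 (m + 1)) ι s v : TangentSpace (𝓡 (m + 1)) (ι s))
      (mfderiv (𝓡 m) (𝓡 (m + 1)) ι s w) : ℝ) = inner ℝ v w

/-- `ν` is the outward unit normal field of `Ω` along its boundary: `-ν` points into `Ω`. -/
structure IsOutwardUnitNormal (Ω : Set M) (ι : S → M)
    (ν : ∀ s : S, TangentSpace (𝓡 (m + 1)) (ι s)) : Prop where
  norm_eq : ∀ s, ‖ν s‖ = 1
  orthogonal : ∀ (s : S) (v : TangentSpace (𝓡 m) s),
    (inner ℝ (ν s) (mfderiv (𝓡 m) (𝓡 (m + 1)) ι s v) : ℝ) = 0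
  outward : ∀ s : S, ∀ᶠ t in 𝓝[>] (0 : ℝ),
    (chartAt (EuclideanSpace ℝ (Fin (m + 1))) (ι s)).symm
      (chartAt (EuclideanSpace ℝ (Fin (m + 1))) (ι s) (ι s)
        - t • coords (chartAt (EuclideanSpace ℝ (Fin (m + 1))) (ι s)) (ι s) (ν s)) ∈ Ω

/-- The normal derivative `u_ν = ⟨∇u, ν⟩`. -/
def normalDeriv (ι : S → M) (ν : ∀ s : S, TangentSpace (𝓡 (m + 1)) (ι s)) (u : M → ℝ) (s : S) : ℝ :=
  inner ℝ (grad u (ι s)) (ν s)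

/-- The second fundamental form `A(v, w) = ⟨D_v ν, w⟩` of the boundary. -/
def secondFundamentalForm (ι : S → M) (ν : ∀ s : S, TangentSpace (𝓡 (m + 1)) (ι s)) (s : S)
    (v w : TangentSpace (𝓡 m) s) : ℝ :=
  inner ℝ (covDerivAlong ι ν s v) (mfderiv (𝓡 m) (𝓡 (m + 1)) ι s w)

/-- The weighted mean curvature `H_φ = H - ⟨∇φ, ν⟩`, with `H` the trace of the second fundamental
form, which is the divergence of `ν`. -/
def weightedMeanCurvature (ι : S → M) (ν : ∀ s : S, TangentSpace (𝓡 (m + 1)) (ι s)) (φ : M → ℝ)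
    (s : S) : ℝ :=
  bilinTrace (secondFundamentalForm ι ν s) - normalDeriv ι ν φ s

/-- A function is smooth on the closed set `K` if near each point of `K` it is smooth in an ambient
neighbourhood. -/
def SmoothOnClosed (K : Set M) (u : M → ℝ) : Prop :=
  ∀ x ∈ K, ContMDiffAt (𝓡 (m + 1)) 𝓘(ℝ, ℝ) ∞ u x

/-- The condition at infinity on `f` and `h`: `f` is of Sobolev class `W²` with respect to `h`
(with `Δ_φ f` counted too), and the integrals in the integral formula converge absolutely. -/
structure IsSuitablePair [MeasurableSpace M] [MeasurableSpace S] (φ : M → ℝ) (Ω : Set M) (ι : S → M)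
    (ν : ∀ s : S, TangentSpace (𝓡 (m + 1)) (ι s)) (h f : M → ℝ) : Prop where
  sobolev : IntegrableOn (fun x ↦ |h x| * (f x ^ 2 + ‖grad (k := m + 1) f x‖ ^ 2
      + bilinNormSq (hess (k := m + 1) f x) + weightedLaplacian (k := m + 1) φ f x ^ 2))
    Ω (weightedVolume (k := m + 1) φ)
  sobolev_grad : IntegrableOn (fun x ↦ ‖grad (k := m + 1) h x‖
      * (f x ^ 2 + ‖grad (k := m + 1) f x‖ ^ 2)) Ω (weightedVolume (k := m + 1) φ)
  bulk_grad : IntegrableOn (fun x ↦ hess (k := m + 1) h x (grad f x) (grad f x)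
      - weightedLaplacian (k := m + 1) φ h x * ‖grad (k := m + 1) f x‖ ^ 2
      - 2 * h x * ‖grad (k := m + 1) f x‖ ^ 2
      + h x * weightedRicci (k := m + 1) φ x (grad f x) (grad f x))
    Ω (weightedVolume (k := m + 1) φ)
  bulk : IntegrableOn (fun x ↦ (weightedLaplacian (k := m + 1) φ h x + h x) * f x ^ 2)
    Ω (weightedVolume (k := m + 1) φ)
  boundary : Integrable (fun s ↦ h (ι s)
      * (2 * normalDeriv ι ν f s * weightedLaplacian (k := m) (φ ∘ ι) (f ∘ ι) s
        + weightedMeanCurvature ι ν φ s * normalDeriv ι ν f s ^ 2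
        + secondFundamentalForm ι ν s (grad (f ∘ ι) s) (grad (f ∘ ι) s)
        + 2 * normalDeriv ι ν f s * f (ι s)))
    (weightedVolume (k := m) (φ ∘ ι))
  boundary_normal : Integrable (fun s ↦ normalDeriv ι ν h s
      * (‖grad (k := m) (f ∘ ι) s‖ ^ 2 - f (ι s) ^ 2)) (weightedVolume (k := m) (φ ∘ ι))
  boundary_grad : Integrable (fun s ↦ |h (ι s)| * |normalDeriv ι ν f s|
      * ‖grad (k := m) (f ∘ ι) s‖) (weightedVolume (k := m) (φ ∘ ι))

end Boundary

end

open Set Filter MeasureTheory Manifold Bundle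
open scoped Topology ContDiff ENNReal

noncomputable section

set_option maxSynthPendingDepth 3
set_option linter.unusedSectionVars false

/-! ### Riemannian metrics on open subsets of a vector space -/

section LocalMetric

attribute [-instance] Bundle.instNormedAddCommGroupOfRiemannianBundleOfIsTopologicalAddGroupOfContinuousConstSMulReal
  Bundle.instInnerProductSpaceReal

variable {E : Type*} [NormedAddCommGroup E] [NormedSpace ℝ E]

/-! The formula is the divergence theorem for the vector field W = h(Δ_φ f)∇f − ½h∇|∇f|² − ⟨∇f,∇h⟩∇f
+ |∇f|²∇h + 2hf∇f − f²∇h. It is a sum of six fields u∇v, whose factors are listed in `reillyLeft`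
and `reillyRight`; the weighted divergence of u∇v is uΔ_φ v + ⟨∇u,∇v⟩, the `greenIntegrand`. The
Bochner formula for Δ_φ|∇f|² cancels the third derivatives of f and brings in Ric_φ. What remains of
div_φ W is the left integrand minus the two bulk integrands on the right (`bochner_formula`,
`sum_greenIntegrand_reilly`).

On Σ, the Gauss formula splits ∇²f into the intrinsic Hessian, f_ν A and the entries involving ν.
The terms with ∇²f(ν,ν) cancel, and ∇²f(Df,ν) is the derivative of f_ν along Df minus A(Df,Df).
Hence ⟨W,ν⟩ is the sum of the two boundary integrands minus the weighted divergence on Σ of h f_ν Df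
(`weightedLaplacian_eq_add`, `mvfderiv_normalDeriv`, `sum_mul_normalDeriv_reilly`). That divergence
integrates to zero, up to a cutoff, because Σ has no boundary.

Green's formula for compactly supported u is derived from coordinates
(`integral_greenIntegrand_eq`). A partition of unity reduces it to charts, where Ω is absent,
everything, or the half space {ρ < 0}, with ρ the last coordinate. The identity ∂ᵥ log √det g = tr
Γ(·,v) turns the coordinate divergence into the weighted one. On the slice, area and volume
densities differ by the factor |∇ρ| (`det_gram_eq`). Near Σ the normal is ∇ρ/|∇ρ|, so all boundary
quantities are computed with gradients and Hessians of functions on M.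

Without compactness, W is multiplied by cutoffs χⱼ → 1 with compact support and |∇χⱼ| ≤ 5/(j+1).
They exist because M is complete: closed balls are compact by Hopf and Rinow, and truncated distance
functions can be smoothed with control of the gradient (`exists_cutoff`). The errors are at most a
constant over j+1 times densities that suitability makes integrable, so dominated convergence gives
the formula (`integral_reilly_eq`). When the closure of Ω is compact, suitability follows from
continuity of all integrands. -/

/-- `K(v, w, z) = ½ (T(v, w, z) + T(w, v, z) - T(z, v, w))`: applied to the derivative of a metric,
this gives the Christoffel symbols of the first kind. -/
def koszulForm (T : E →L[ℝ] E →L[ℝ] E →L[ℝ] ℝ) : E →L[ℝ] E →L[ℝ] E →L[ℝ] ℝ :=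
  (1 / 2 : ℝ) • (T + T.flip - ((ContinuousLinearMap.flipₗᵢ ℝ E E ℝ).toContinuousLinearEquiv :
    (E →L[ℝ] E →L[ℝ] ℝ) →L[ℝ] (E →L[ℝ] E →L[ℝ] ℝ)).comp T.flip)

theorem koszulForm_apply (T : E →L[ℝ] E →L[ℝ] E →L[ℝ] ℝ) (v w z : E) :
    koszulForm T v w z = (1 / 2) * (T v w z + T w v z - T z v w) := by
  simp [koszulForm]

/-- `koszulForm` as a continuous linear map. -/
def koszulFormCLM : (E →L[ℝ] E →L[ℝ] E →L[ℝ] ℝ) →L[ℝ] (E →L[ℝ] E →L[ℝ] E →L[ℝ] ℝ) :=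
  let fl : (E →L[ℝ] E →L[ℝ] E →L[ℝ] ℝ) →L[ℝ] (E →L[ℝ] E →L[ℝ] E →L[ℝ] ℝ) :=
    ((ContinuousLinearMap.flipₗᵢ ℝ E E (E →L[ℝ] ℝ)).toContinuousLinearEquiv :
      (E →L[ℝ] E →L[ℝ] E →L[ℝ] ℝ) →L[ℝ] (E →L[ℝ] E →L[ℝ] E →L[ℝ] ℝ))
  (1 / 2 : ℝ) • (ContinuousLinearMap.id ℝ _ + fl
    - ((ContinuousLinearMap.compL ℝ E (E →L[ℝ] E →L[ℝ] ℝ) (E →L[ℝ] E →L[ℝ] ℝ))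
        ((ContinuousLinearMap.flipₗᵢ ℝ E E ℝ).toContinuousLinearEquiv :
          (E →L[ℝ] E →L[ℝ] ℝ) →L[ℝ] (E →L[ℝ] E →L[ℝ] ℝ))).comp fl)

theorem koszulFormCLM_apply (T : E →L[ℝ] E →L[ℝ] E →L[ℝ] ℝ) :
    koszulFormCLM T = koszulForm T := by
  ext v w z
  simp [koszulForm, koszulFormCLM]

/-- The Christoffel symbols of the metric `G`, as a vector-valued bilinear form. -/
def localChristoffel (G : E → E →L[ℝ] E →L[ℝ] ℝ) (y : E) : E →L[ℝ] E →L[ℝ] E :=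
  (ContinuousLinearMap.compL ℝ E (E →L[ℝ] ℝ) E (G y).inverse).comp (koszulForm (fderiv ℝ G y))

theorem localChristoffel_apply (G : E → E →L[ℝ] E →L[ℝ] ℝ) (y v w : E) :
    localChristoffel G y v w = (G y).inverse (koszulForm (fderiv ℝ G y) v w) := rfl

/-- The gradient of `u` for the metric `G`. -/
def localGrad (G : E → E →L[ℝ] E →L[ℝ] ℝ) (u : E → ℝ) (y : E) : E :=
  (G y).inverse (fderiv ℝ u y)

/-- The Hessian of `u` for the metric `G`. -/
def localHess (G : E → E →L[ℝ] E →L[ℝ] ℝ) (u : E → ℝ) (y v w : E) : ℝ :=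
  fderiv ℝ (fderiv ℝ u) y v w - koszulForm (fderiv ℝ G y) v w (localGrad G u y)

/-- The covariant derivative of the vector field `Y` for the connection `Γ`. -/
def covDerivOp (Γ : E → E →L[ℝ] E →L[ℝ] E) (Y : E → E) (y : E) : E →L[ℝ] E :=
  fderiv ℝ Y y + (Γ y).flip (Y y)

theorem covDerivOp_apply (Γ : E → E →L[ℝ] E →L[ℝ] E) (Y : E → E) (y v : E) :
    covDerivOp Γ Y y v = fderiv ℝ Y y v + Γ y v (Y y) := rfl

/-- `G` is a Riemannian metric on the open set `U`. -/
structure IsLocalMetric (G : E → E →L[ℝ] E →L[ℝ] ℝ) (U : Set E) : Prop where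
  isOpen : IsOpen U
  smooth : ContDiffOn ℝ ∞ G U
  symm : ∀ y ∈ U, ∀ v w, G y v w = G y w v
  pos : ∀ y ∈ U, ∀ v, v ≠ 0 → 0 < G y v v

namespace IsLocalMetric

variable [FiniteDimensional ℝ E] {G : E → E →L[ℝ] E →L[ℝ] ℝ} {U : Set E}

/-- Positivity makes `G y` injective, and a finite-dimensional space and its dual have the same
dimension. -/
theorem isInvertible (hG : IsLocalMetric G U) {y : E} (hy : y ∈ U) : (G y).IsInvertible := by
  have hinj : Function.Injective (G y : E →ₗ[ℝ] (E →L[ℝ] ℝ)) := by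
    rw [← LinearMap.ker_eq_bot, LinearMap.ker_eq_bot']
    intro v hv
    by_contra hne
    have h1 := hG.pos y hy v hne
    have h2 : G y v = 0 := hv
    rw [h2] at h1
    simp at h1
  have hdim : Module.finrank ℝ E = Module.finrank ℝ (E →L[ℝ] ℝ) := by
    rw [← (LinearMap.toContinuousLinearMap (𝕜 := ℝ) (E := E) (F' := ℝ)).finrank_eq]
    exact (Subspace.dual_finrank_eq (K := ℝ) (V := E)).symm
  exact ⟨(LinearEquiv.ofInjectiveOfFinrankEq (G y : E →ₗ[ℝ] (E →L[ℝ] ℝ)) hinj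
    hdim).toContinuousLinearEquiv, by ext v w; rfl⟩

theorem contDiffAt (hG : IsLocalMetric G U) {y : E} (hy : y ∈ U) : ContDiffAt ℝ ∞ G y :=
  hG.smooth.contDiffAt (hG.isOpen.mem_nhds hy)

theorem contDiffAt_inverse (hG : IsLocalMetric G U) {y : E} (hy : y ∈ U) :
    ContDiffAt ℝ ∞ (fun z ↦ (G z).inverse) y :=
  ContDiffAt.comp y (hG.isInvertible hy).contDiffAt_map_inverse (hG.contDiffAt hy)

theorem contDiffAt_localChristoffel (hG : IsLocalMetric G U) {y : E} (hy : y ∈ U) :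
    ContDiffAt ℝ ∞ (localChristoffel G) y := by
  have h1 : ContDiffAt ℝ ∞ (fun z ↦ koszulForm (fderiv ℝ G z)) y := by
    simp only [← koszulFormCLM_apply]
    exact koszulFormCLM.contDiff.contDiffAt.comp y
      ((hG.contDiffAt hy).fderiv_right (m := ∞) (by simp))
  have h2 : ContDiffAt ℝ ∞ (fun z ↦ ContinuousLinearMap.compL ℝ E (E →L[ℝ] ℝ) E (G z).inverse) y :=
    (ContinuousLinearMap.compL ℝ E (E →L[ℝ] ℝ) E).contDiff.contDiffAt.comp y
      (hG.contDiffAt_inverse hy)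
  exact h2.clm_comp h1

theorem contDiffAt_localGrad (hG : IsLocalMetric G U) {y : E} (hy : y ∈ U) {u : E → ℝ} {n : ℕ}
    (hu : ContDiffAt ℝ (n + 1 : ℕ) u y) : ContDiffAt ℝ n (localGrad G u) y :=
  ((hG.contDiffAt_inverse hy).of_le (by exact_mod_cast le_top)).clm_apply
    (hu.fderiv_right (m := n) (by norm_cast))

theorem apply_localGrad (hG : IsLocalMetric G U) {y : E} (hy : y ∈ U) (u : E → ℝ) (w : E) :
    G y (localGrad G u y) w = fderiv ℝ u y w := by
  rw [localGrad, (hG.isInvertible hy).self_apply_inverse]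

theorem apply_localChristoffel (hG : IsLocalMetric G U) {y : E} (hy : y ∈ U) (v w z : E) :
    G y (localChristoffel G y v w) z = koszulForm (fderiv ℝ G y) v w z := by
  rw [localChristoffel_apply, (hG.isInvertible hy).self_apply_inverse]

theorem ext_apply (hG : IsLocalMetric G U) {y : E} (hy : y ∈ U) {v w : E}
    (h : ∀ z, G y v z = G y w z) : v = w :=
  (hG.isInvertible hy).injective (ContinuousLinearMap.ext h)

/-- The symmetry of `G` is differentiated; since `U` is open, it holds in a neighbourhood of `y`. -/
theorem fderiv_symm (hG : IsLocalMetric G U) {y : E} (hy : y ∈ U) (v w z : E) :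
    fderiv ℝ G y v w z = fderiv ℝ G y v z w := by
  have hd : HasFDerivAt G (fderiv ℝ G y) y :=
    ((hG.contDiffAt hy).differentiableAt (by simp)).hasFDerivAt
  have h1 := (hd.clm_apply (hasFDerivAt_const w y)).clm_apply (hasFDerivAt_const z y)
  have h2 := (hd.clm_apply (hasFDerivAt_const z y)).clm_apply (hasFDerivAt_const w y)
  have h3 : (fun x ↦ G x w z) =ᶠ[𝓝 y] fun x ↦ G x z w := by
    filter_upwards [hG.isOpen.mem_nhds hy] with x hx using hG.symm x hx w z
  have h4 := (h1.congr_of_eventuallyEq h3.symm).unique h2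
  have := DFunLike.congr_fun h4 v
  simpa using this

theorem koszulForm_symm (hG : IsLocalMetric G U) {y : E} (hy : y ∈ U) (v w z : E) :
    koszulForm (fderiv ℝ G y) v w z = koszulForm (fderiv ℝ G y) w v z := by
  rw [koszulForm_apply, koszulForm_apply, hG.fderiv_symm hy z v w]
  ring

/-- This is torsion-freeness, one of the two properties that characterize the Levi-Civita
connection. -/
theorem localChristoffel_symm (hG : IsLocalMetric G U) {y : E} (hy : y ∈ U) (v w : E) :
    localChristoffel G y v w = localChristoffel G y w v :=
  hG.ext_apply hy fun z ↦ by
    rw [hG.apply_localChristoffel hy, hG.apply_localChristoffel hy, hG.koszulForm_symm hy]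

theorem localHess_symm (hG : IsLocalMetric G U) {y : E} (hy : y ∈ U) {u : E → ℝ}
    (hu : ContDiffAt ℝ 2 u y) (v w : E) : localHess G u y v w = localHess G u y w v := by
  rw [localHess, localHess, hG.koszulForm_symm hy,
    (hu.isSymmSndFDerivAt (by simp)).eq v w]

/-- `G(∇_v ∇u, w)` is the Hessian of `u`. -/
theorem apply_covDerivOp_localGrad (hG : IsLocalMetric G U) {y : E} (hy : y ∈ U) {u : E → ℝ}
    (hu : ContDiffAt ℝ 2 u y) (v w : E) :
    G y (covDerivOp (localChristoffel G) (localGrad G u) y v) w = localHess G u y v w := by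
  have hd : HasFDerivAt G (fderiv ℝ G y) y :=
    ((hG.contDiffAt hy).differentiableAt (by simp)).hasFDerivAt
  have hY : HasFDerivAt (localGrad G u) (fderiv ℝ (localGrad G u) y) y :=
    ((hG.contDiffAt_localGrad (n := 1) hy hu).differentiableAt (by simp)).hasFDerivAt
  have hdu : HasFDerivAt (fderiv ℝ u) (fderiv ℝ (fderiv ℝ u) y) y :=
    ((hu.fderiv_right (m := 1) (by norm_num)).differentiableAt (by simp)).hasFDerivAt
  have h1 := (hd.clm_apply hY).clm_apply (hasFDerivAt_const w y)
  have h2 := hdu.clm_apply (hasFDerivAt_const w y)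
  have h3 : (fun x ↦ G x (localGrad G u x) w) =ᶠ[𝓝 y] fun x ↦ fderiv ℝ u x w := by
    filter_upwards [hG.isOpen.mem_nhds hy] with x hx using hG.apply_localGrad hx u w
  have h4 := DFunLike.congr_fun ((h1.congr_of_eventuallyEq h3.symm).unique h2) v
  simp only [add_apply, ContinuousLinearMap.comp_apply,
    ContinuousLinearMap.flip_apply, zero_apply, map_zero, zero_add] at h4
  rw [covDerivOp_apply, map_add, add_apply, hG.apply_localChristoffel hy,
    localHess, ← h4]
  -- The relation `h4` is the derivative of G(∇u, w) = du(w) along v. With Y = ∇u, the identity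
  -- K(v,Y,w) + K(v,w,Y) = DG(v)(Y,w) matches it with the claim.
  simp only [koszulForm_apply]
  rw [hG.fderiv_symm hy v w, hG.fderiv_symm hy w v, hG.fderiv_symm hy _ v w]
  rw [hG.fderiv_symm hy (localGrad G u y) w v]
  ring

end IsLocalMetric

/-- An isometric immersion `j` identifies the Hessian of `a ∘ j` with that of `a` at the points
where the gradient of `a` is tangent to the image. -/
theorem localHess_comp_isometric [FiniteDimensional ℝ E] {E' : Type*} [NormedAddCommGroup E']
    [NormedSpace ℝ E'] [FiniteDimensional ℝ E']
    {G : E → E →L[ℝ] E →L[ℝ] ℝ} {U : Set E} (hG : IsLocalMetric G U)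
    {G' : E' → E' →L[ℝ] E' →L[ℝ] ℝ} {U' : Set E'} (hG' : IsLocalMetric G' U')
    {j : E' → E} {u : E'} (hu : u ∈ U') (hju : j u ∈ U) (hj : ContDiffAt ℝ 2 j u)
    (hiso : ∀ᶠ z in 𝓝 u, ∀ v w, G' z v w = G (j z) (fderiv ℝ j z v) (fderiv ℝ j z w))
    {a : E → ℝ} (ha : ContDiffAt ℝ 2 a (j u))
    (htan : localGrad G a (j u) = fderiv ℝ j u (localGrad G' (a ∘ j) u)) (v w : E') :
    localHess G a (j u) (fderiv ℝ j u v) (fderiv ℝ j u w) = localHess G' (a ∘ j) u v w := by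
  have hjd : HasFDerivAt j (fderiv ℝ j u) u := (hj.differentiableAt (by simp)).hasFDerivAt
  have hjd2 : HasFDerivAt (fderiv ℝ j) (fderiv ℝ (fderiv ℝ j) u) u :=
    ((hj.fderiv_right (m := 1) (by norm_num)).differentiableAt (by simp)).hasFDerivAt
  have hjs : ∀ v w, fderiv ℝ (fderiv ℝ j) u v w = fderiv ℝ (fderiv ℝ j) u w v :=
    fun v w ↦ (hj.isSymmSndFDerivAt (by simp)).eq v w
  have had2 : HasFDerivAt (fderiv ℝ a) (fderiv ℝ (fderiv ℝ a) (j u)) (j u) :=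
    ((ha.fderiv_right (m := 1) (by norm_num)).differentiableAt (by simp)).hasFDerivAt
  have hd : HasFDerivAt G (fderiv ℝ G (j u)) (j u) :=
    ((hG.contDiffAt hju).differentiableAt (by simp)).hasFDerivAt
  have hd' : HasFDerivAt G' (fderiv ℝ G' u) u :=
    ((hG'.contDiffAt hu).differentiableAt (by simp)).hasFDerivAt
  -- The derivative of the pulled-back metric has two terms with the second derivative of `j`,
  -- besides the pullback of DG.
  have key : ∀ v w z, fderiv ℝ G' u v w z =
      fderiv ℝ G (j u) (fderiv ℝ j u v) (fderiv ℝ j u w) (fderiv ℝ j u z)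
      + G (j u) (fderiv ℝ (fderiv ℝ j) u v w) (fderiv ℝ j u z)
      + G (j u) (fderiv ℝ j u w) (fderiv ℝ (fderiv ℝ j) u v z) := by
    intro v w z
    have h1 := (hd'.clm_apply (hasFDerivAt_const w u)).clm_apply (hasFDerivAt_const z u)
    have hGj : HasFDerivAt (fun x ↦ G (j x)) ((fderiv ℝ G (j u)).comp (fderiv ℝ j u)) u :=
      hd.comp u hjd
    have h2 := (hGj.clm_apply (hjd2.clm_apply (hasFDerivAt_const w u))).clm_apply
      (hjd2.clm_apply (hasFDerivAt_const z u))
    have h3 : (fun x ↦ G' x w z) =ᶠ[𝓝 u]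
        fun x ↦ G (j x) (fderiv ℝ j x w) (fderiv ℝ j x z) := by
      filter_upwards [hiso] with x hx using hx w z
    have h4 := DFunLike.congr_fun ((h1.congr_of_eventuallyEq h3.symm).unique h2) v
    simp at h4
    linarith
  have h5 : fderiv ℝ (fderiv ℝ (a ∘ j)) u v w =
      fderiv ℝ (fderiv ℝ a) (j u) (fderiv ℝ j u v) (fderiv ℝ j u w)
      + fderiv ℝ a (j u) (fderiv ℝ (fderiv ℝ j) u v w) := by
    have h6 := (had2.comp u hjd).clm_comp hjd2
    have h7 : fderiv ℝ (a ∘ j) =ᶠ[𝓝 u] fun x ↦ ((fderiv ℝ a ∘ j) x).comp (fderiv ℝ j x) := by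
      have e1 : ∀ᶠ x in 𝓝 u, DifferentiableAt ℝ j x :=
        (hj.eventually (by simp)).mono fun x hx ↦ hx.differentiableAt (by simp)
      have e2 : ∀ᶠ x in 𝓝 u, DifferentiableAt ℝ a (j x) :=
        hj.continuousAt.eventually
          ((ha.eventually (by simp)).mono fun x hx ↦ hx.differentiableAt (by simp))
      filter_upwards [e1, e2] with x hx1 hx2
      exact fderiv_comp x hx2 hx1
    rw [h7.fderiv_eq, h6.fderiv]
    simp [add_comm]
  -- Since the gradient of `a` is dj(Y), the second-order term of `h5` is G(D²j(v,w), dj Y). The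
  -- Koszul form of `G'` produces the same term, by `key` and the symmetry of D²j, and the two
  -- cancel.
  rw [localHess, localHess, h5, ← hG.apply_localGrad hju, htan, koszulForm_apply, koszulForm_apply]
  set Y := localGrad G' (a ∘ j) u
  rw [key v w Y, key w v Y, key Y v w, hjs w v, hjs w Y, hjs v Y,
    hG.symm _ hju (fderiv ℝ (fderiv ℝ j) u Y v), hG.symm _ hju (fderiv ℝ (fderiv ℝ j) u v w)]
  ring

end LocalMetric

/-! ### Traces, the Bochner identity and the derivative of the volume density -/

section LocalTrace

attribute [-instance] Bundle.instNormedAddCommGroupOfRiemannianBundleOfIsTopologicalAddGroupOfContinuousConstSMulReal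
  Bundle.instInnerProductSpaceReal

variable {E : Type*} [NormedAddCommGroup E] [NormedSpace ℝ E]

/-- The trace of an endomorphism, as a continuous linear form. -/
def traceCLM (E : Type*) [NormedAddCommGroup E] [NormedSpace ℝ E] [FiniteDimensional ℝ E] :
    (E →L[ℝ] E) →L[ℝ] ℝ :=
  LinearMap.toContinuousLinearMap
    ((LinearMap.trace ℝ E).comp (ContinuousLinearMap.coeLM ℝ))

theorem traceCLM_apply [FiniteDimensional ℝ E] (A : E →L[ℝ] E) :
    traceCLM E A = LinearMap.trace ℝ E (A : E →ₗ[ℝ] E) := rfl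

theorem traceCLM_comp_comm [FiniteDimensional ℝ E] (A B : E →L[ℝ] E) :
    traceCLM E (A.comp B) = traceCLM E (B.comp A) :=
  LinearMap.trace_mul_comm ℝ (A : E →ₗ[ℝ] E) (B : E →ₗ[ℝ] E)

/-- The endomorphism `v ↦ R(v, Y)Z`, `R` being the curvature of the connection `Γ`. -/
def curvatureOp (Γ : E → E →L[ℝ] E →L[ℝ] E) (y Y Z : E) : E →L[ℝ] E :=
  ((fderiv ℝ Γ y).flip Y).flip Z - (fderiv ℝ Γ y Y).flip Z + (Γ y).flip (Γ y Y Z)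
    - (Γ y Y).comp ((Γ y).flip Z)

theorem curvatureOp_apply (Γ : E → E →L[ℝ] E →L[ℝ] E) (y Y Z v : E) :
    curvatureOp Γ y Y Z v = fderiv ℝ Γ y v Y Z - fderiv ℝ Γ y Y v Z + Γ y v (Γ y Y Z)
      - Γ y Y (Γ y v Z) := rfl

theorem hasFDerivAt_covDerivOp {Γ : E → E →L[ℝ] E →L[ℝ] E} {Y : E → E} {y : E}
    (hΓ : DifferentiableAt ℝ Γ y) (hY : ContDiffAt ℝ 2 Y y) :
    ∃ D : E →L[ℝ] E →L[ℝ] E, HasFDerivAt (covDerivOp Γ Y) D y ∧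
      ∀ u v, D u v = fderiv ℝ (fderiv ℝ Y) y u v + fderiv ℝ Γ y u v (Y y)
        + Γ y v (fderiv ℝ Y y u) := by
  have h1 : HasFDerivAt (fderiv ℝ Y) (fderiv ℝ (fderiv ℝ Y) y) y :=
    ((hY.fderiv_right (m := 1) (by norm_num)).differentiableAt (by simp)).hasFDerivAt
  have hY1 : HasFDerivAt Y (fderiv ℝ Y y) y := (hY.differentiableAt (by simp)).hasFDerivAt
  let fl : (E →L[ℝ] E →L[ℝ] E) →L[ℝ] (E →L[ℝ] E →L[ℝ] E) :=
    ((ContinuousLinearMap.flipₗᵢ ℝ E E E).toContinuousLinearEquiv :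
      (E →L[ℝ] E →L[ℝ] E) →L[ℝ] (E →L[ℝ] E →L[ℝ] E))
  have h2 : HasFDerivAt (fun z ↦ fl (Γ z)) (fl.comp (fderiv ℝ Γ y)) y :=
    fl.hasFDerivAt.comp y hΓ.hasFDerivAt
  have h3 := h1.add (h2.clm_apply hY1)
  refine ⟨_, h3, fun u v ↦ ?_⟩
  simp [fl]
  abel

/-- The Bochner identity for a torsion-free connection:
`div(∇_Y Y) = tr((∇Y)²) + Y(div Y) + Ric(Y, Y)`. -/
theorem trace_covDerivOp_self [FiniteDimensional ℝ E] {Γ : E → E →L[ℝ] E →L[ℝ] E} {Y : E → E}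
    {y : E} (hΓ : DifferentiableAt ℝ Γ y) (hs : ∀ v w, Γ y v w = Γ y w v)
    (hY : ContDiffAt ℝ 2 Y y) :
    traceCLM E (covDerivOp Γ (fun z ↦ covDerivOp Γ Y z (Y z)) y) =
      traceCLM E ((covDerivOp Γ Y y).comp (covDerivOp Γ Y y))
      + fderiv ℝ (fun z ↦ traceCLM E (covDerivOp Γ Y z)) y (Y y)
      + traceCLM E (curvatureOp Γ y (Y y) (Y y)) := by
  obtain ⟨D, hD, hD'⟩ := hasFDerivAt_covDerivOp hΓ hY
  have hY1 : HasFDerivAt Y (fderiv ℝ Y y) y := (hY.differentiableAt (by simp)).hasFDerivAt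
  have hYs : ∀ v w, fderiv ℝ (fderiv ℝ Y) y v w = fderiv ℝ (fderiv ℝ Y) y w v :=
    fun v w ↦ (hY.isSymmSndFDerivAt (by simp)).eq v w
  have h1 : HasFDerivAt (fun z ↦ traceCLM E (covDerivOp Γ Y z)) ((traceCLM E).comp D) y :=
    (traceCLM E).hasFDerivAt.comp y hD
  have h2 := hD.clm_apply hY1
  set ΓY : E →L[ℝ] E := (Γ y).flip (Y y) with hΓY
  -- The Ricci identity in coordinates: exchanging the order of the two derivatives of `Y` produces
  -- the curvature. What remains is a commutator of `ΓY` with the derivative of `Y`, and it has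
  -- trace zero.
  have h3 : covDerivOp Γ (fun z ↦ covDerivOp Γ Y z (Y z)) y =
      (covDerivOp Γ Y y).comp (covDerivOp Γ Y y) + D (Y y) + curvatureOp Γ y (Y y) (Y y)
      + (ΓY.comp (fderiv ℝ Y y) - (fderiv ℝ Y y).comp ΓY) := by
    ext v
    rw [covDerivOp_apply, h2.fderiv]
    simp only [add_apply, sub_apply, ContinuousLinearMap.comp_apply,
      ContinuousLinearMap.flip_apply, covDerivOp_apply, hD', curvatureOp_apply, hΓY, map_add]
    rw [hYs v (Y y), hs (fderiv ℝ Y y v) (Y y), hs (Γ y v (Y y)) (Y y)]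
    abel
  rw [h3, h1.fderiv, map_add, map_add, map_add, map_sub, traceCLM_comp_comm ΓY, sub_self, add_zero]
  rfl

variable {k : ℕ}

/-- The standard basis vector `eᵢ`. -/
abbrev stdVec (i : Fin k) : EuclideanSpace ℝ (Fin k) := EuclideanSpace.single i (1 : ℝ)

theorem sum_smul_stdVec (v : EuclideanSpace ℝ (Fin k)) : ∑ i, v i • stdVec i = v := by
  ext j
  simp [Pi.single_apply]

theorem traceCLM_eq_sum (A : EuclideanSpace ℝ (Fin k) →L[ℝ] EuclideanSpace ℝ (Fin k)) :
    traceCLM _ A = ∑ i, A (stdVec i) i := by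
  rw [traceCLM_apply, LinearMap.trace_eq_matrix_trace ℝ (EuclideanSpace.basisFun (Fin k) ℝ).toBasis,
    Matrix.trace]
  simp [LinearMap.toMatrix_apply]

/-- The Gram matrix of a bilinear form on `ℝᵏ`. -/
def gramMatrix (B : EuclideanSpace ℝ (Fin k) →L[ℝ] EuclideanSpace ℝ (Fin k) →L[ℝ] ℝ) :
    Matrix (Fin k) (Fin k) ℝ := Matrix.of fun i j ↦ B (stdVec i) (stdVec j)

theorem bilin_eq_sum (B : EuclideanSpace ℝ (Fin k) →L[ℝ] EuclideanSpace ℝ (Fin k) →L[ℝ] ℝ)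
    (v w : EuclideanSpace ℝ (Fin k)) : B v w = ∑ i, ∑ j, v i * w j * gramMatrix B i j := by
  conv_lhs => rw [← sum_smul_stdVec v, ← sum_smul_stdVec w]
  simp only [map_sum, map_smul, FunLike.coe_sum, Finset.sum_apply, FunLike.coe_smul,
    Pi.smul_apply, smul_eq_mul, gramMatrix, Matrix.of_apply, Finset.mul_sum, mul_assoc]
  rw [Finset.sum_comm]
  exact Finset.sum_congr rfl fun i _ ↦ Finset.sum_congr rfl fun j _ ↦ by ring

theorem gramMatrix_mulVec (B : EuclideanSpace ℝ (Fin k) →L[ℝ] EuclideanSpace ℝ (Fin k) →L[ℝ] ℝ)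
    (hB : ∀ v w, B v w = B w v) (v : EuclideanSpace ℝ (Fin k)) (j : Fin k) :
    ∑ l, gramMatrix B j l * v l = B v (stdVec j) := by
  rw [hB]
  conv_rhs => rw [← sum_smul_stdVec v]
  simp [gramMatrix, mul_comm]

theorem gramMatrix_posDef
    {B : EuclideanSpace ℝ (Fin k) →L[ℝ] EuclideanSpace ℝ (Fin k) →L[ℝ] ℝ}
    (hB : ∀ v w, B v w = B w v) (hp : ∀ v, v ≠ 0 → 0 < B v v) : (gramMatrix B).PosDef := by
  refine Matrix.PosDef.of_dotProduct_mulVec_pos ?_ fun x hx ↦ ?_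
  · ext i j
    simp [gramMatrix, hB]
  · have h := hp (WithLp.toLp 2 x) (by simpa using hx)
    rw [bilin_eq_sum] at h
    simpa [dotProduct, Matrix.mulVec, Finset.mul_sum, mul_assoc, mul_comm, mul_left_comm] using h

theorem gramMatrix_inv_mul_self
    {B : EuclideanSpace ℝ (Fin k) →L[ℝ] EuclideanSpace ℝ (Fin k) →L[ℝ] ℝ}
    (hB : ∀ v w, B v w = B w v) (hp : ∀ v, v ≠ 0 → 0 < B v v) :
    (gramMatrix B)⁻¹ * gramMatrix B = 1 :=
  Matrix.nonsing_inv_mul _ (gramMatrix_posDef hB hp).det_pos.ne'.isUnit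

theorem apply_eq_sum_gramMatrix_inv
    {B : EuclideanSpace ℝ (Fin k) →L[ℝ] EuclideanSpace ℝ (Fin k) →L[ℝ] ℝ}
    (hB : ∀ v w, B v w = B w v) (hp : ∀ v, v ≠ 0 → 0 < B v v) (v : EuclideanSpace ℝ (Fin k))
    (i : Fin k) : v i = ∑ j, (gramMatrix B)⁻¹ i j * B v (stdVec j) := by
  simp only [← gramMatrix_mulVec B hB v, Finset.mul_sum]
  rw [Finset.sum_comm]
  have h := gramMatrix_inv_mul_self hB hp
  have h2 : ∀ l, ∑ j, (gramMatrix B)⁻¹ i j * (gramMatrix B j l * v l)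
      = (1 : Matrix (Fin k) (Fin k) ℝ) i l * v l := by
    intro l
    rw [← h, Matrix.mul_apply, Finset.sum_mul]
    simp [mul_assoc]
  simp [h2, Matrix.one_apply]

theorem traceCLM_eq_sum_gramMatrix_inv
    {B : EuclideanSpace ℝ (Fin k) →L[ℝ] EuclideanSpace ℝ (Fin k) →L[ℝ] ℝ}
    (hB : ∀ v w, B v w = B w v) (hp : ∀ v, v ≠ 0 → 0 < B v v)
    (A : EuclideanSpace ℝ (Fin k) →L[ℝ] EuclideanSpace ℝ (Fin k)) :
    traceCLM _ A = ∑ i, ∑ j, (gramMatrix B)⁻¹ i j * B (A (stdVec i)) (stdVec j) := by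
  rw [traceCLM_eq_sum]
  exact Finset.sum_congr rfl fun i _ ↦ apply_eq_sum_gramMatrix_inv hB hp _ i

theorem gramMatrix_inv_symm
    {B : EuclideanSpace ℝ (Fin k) →L[ℝ] EuclideanSpace ℝ (Fin k) →L[ℝ] ℝ}
    (hB : ∀ v w, B v w = B w v) (i j : Fin k) : (gramMatrix B)⁻¹ i j = (gramMatrix B)⁻¹ j i := by
  have h : (gramMatrix B).transpose = gramMatrix B := by
    ext i j
    simp [gramMatrix, hB]
  rw [← Matrix.transpose_apply (gramMatrix B)⁻¹, Matrix.transpose_nonsing_inv, h]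

/-- Jacobi's formula. -/
theorem hasFDerivAt_det {A : E → Matrix (Fin k) (Fin k) ℝ} {D : Fin k → Fin k → E →L[ℝ] ℝ} {y : E}
    (hA : ∀ i j, HasFDerivAt (fun z ↦ A z i j) (D i j) y) :
    HasFDerivAt (fun z ↦ (A z).det) (∑ i, ∑ j, (A y).adjugate j i • D i j) y := by
  -- The determinant is multilinear in the rows, so its derivative replaces one row at a time.
  let f : ContinuousMultilinearMap ℝ (fun _ : Fin k ↦ Fin k → ℝ) ℝ :=
    { (Matrix.detRowAlternating (R := ℝ) (n := Fin k)).toMultilinearMap with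
      cont := by
        show Continuous fun M : Fin k → Fin k → ℝ ↦ Matrix.det (Matrix.of M)
        exact Continuous.matrix_det continuous_id }
  have hA' : HasFDerivAt (fun z ↦ (A z : Fin k → Fin k → ℝ))
      (ContinuousLinearMap.pi fun i ↦ ContinuousLinearMap.pi fun j ↦ D i j) y :=
    hasFDerivAt_pi.2 fun i ↦ hasFDerivAt_pi.2 fun j ↦ hA i j
  have h := (f.hasFDerivAt (A y)).comp y hA'
  refine h.congr_fderiv ?_
  ext v
  refine (f.linearDeriv_apply (A y) _).trans ?_
  simp only [FunLike.coe_sum, Finset.sum_apply, FunLike.coe_smul, Pi.smul_apply, smul_eq_mul]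
  refine Finset.sum_congr rfl fun i _ ↦ ?_
  show ((A y).updateRow i (fun j ↦ D i j v)).det = _
  -- A determinant with one row replaced is an entry of Cramer's vector, whose coefficients are
  -- those of the adjugate.
  rw [← Matrix.transpose_transpose (A y), ← Matrix.cramer_transpose_apply,
    Matrix.cramer_eq_adjugate_mulVec, Matrix.mulVec, dotProduct]
  simp [← Matrix.adjugate_transpose]

/-- This is ∂ᵥ log √det g = tr Γ(·, v). Jacobi's formula gives half the trace of g⁻¹ ∂ᵥg. In the
trace of the Koszul form the other two terms cancel, because g⁻¹ and the derivative of the metric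
are symmetric. The identity is what makes the weighted volume compatible with the covariant
divergence. -/
theorem IsLocalMetric.hasFDerivAt_sqrt_det
    {G : EuclideanSpace ℝ (Fin k) → EuclideanSpace ℝ (Fin k) →L[ℝ] EuclideanSpace ℝ (Fin k) →L[ℝ] ℝ}
    {U : Set (EuclideanSpace ℝ (Fin k))} (hG : IsLocalMetric G U) {y : EuclideanSpace ℝ (Fin k)}
    (hy : y ∈ U) :
    HasFDerivAt (fun z ↦ √(gramMatrix (G z)).det)
      (√(gramMatrix (G y)).det •
        (traceCLM (EuclideanSpace ℝ (Fin k))).comp (localChristoffel G y).flip) y := by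
  have hd : HasFDerivAt G (fderiv ℝ G y) y :=
    ((hG.contDiffAt hy).differentiableAt (by simp)).hasFDerivAt
  have h1 : ∀ i j, HasFDerivAt (fun z ↦ gramMatrix (G z) i j)
      (((fderiv ℝ G y).flip (stdVec i)).flip (stdVec j)) y := by
    intro i j
    have := (hd.clm_apply (hasFDerivAt_const (stdVec i) y)).clm_apply
      (hasFDerivAt_const (stdVec j) y)
    refine this.congr_fderiv ?_
    ext v
    simp
  have hpos : 0 < (gramMatrix (G y)).det := (gramMatrix_posDef (hG.symm y hy) (hG.pos y hy)).det_pos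
  have h2 := (hasFDerivAt_det h1).sqrt hpos.ne'
  refine h2.congr_fderiv ?_
  ext v
  set g := gramMatrix (G y) with hg
  have hadj : ∀ i j, g.adjugate i j = g.det * g⁻¹ i j := by
    intro i j
    rw [Matrix.inv_def, Matrix.smul_apply, Ring.inverse_eq_inv', smul_eq_mul,
      mul_inv_cancel_left₀ hpos.ne']
  have hsqrt : √g.det ≠ 0 := (Real.sqrt_pos.2 hpos).ne'
  simp only [FunLike.coe_smul, Pi.smul_apply, FunLike.coe_sum, Finset.sum_apply,
    ContinuousLinearMap.comp_apply, smul_eq_mul, ContinuousLinearMap.flip_apply, hadj]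
  rw [traceCLM_eq_sum_gramMatrix_inv (hG.symm y hy) (hG.pos y hy)]
  simp only [ContinuousLinearMap.flip_apply, hG.apply_localChristoffel hy, koszulForm_apply, ← hg]
  set T := fderiv ℝ G y
  have e1 : ∑ i, ∑ j, g⁻¹ i j * (1 / 2 * (T (stdVec i) v (stdVec j) + T v (stdVec i) (stdVec j)
      - T (stdVec j) (stdVec i) v)) = 1 / 2 * ∑ i, ∑ j, g⁻¹ j i * T v (stdVec i) (stdVec j) := by
    have e2 : ∑ i, ∑ j, g⁻¹ i j * T (stdVec i) v (stdVec j)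
        = ∑ i, ∑ j, g⁻¹ i j * T (stdVec j) (stdVec i) v := by
      rw [Finset.sum_comm]
      refine Finset.sum_congr rfl fun i _ ↦ Finset.sum_congr rfl fun j _ ↦ ?_
      rw [gramMatrix_inv_symm (hG.symm y hy) j i, hG.fderiv_symm hy _ v]
    calc _ = 1 / 2 * (∑ i, ∑ j, g⁻¹ i j * T (stdVec i) v (stdVec j)
          + ∑ i, ∑ j, g⁻¹ i j * T v (stdVec i) (stdVec j)
          - ∑ i, ∑ j, g⁻¹ i j * T (stdVec j) (stdVec i) v) := by
          simp only [Finset.mul_sum, ← Finset.sum_add_distrib, ← Finset.sum_sub_distrib]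
          refine Finset.sum_congr rfl fun i _ ↦ Finset.sum_congr rfl fun j _ ↦ by ring
      _ = _ := by
          rw [e2, add_sub_cancel_left]
          congr 1
          refine Finset.sum_congr rfl fun i _ ↦ Finset.sum_congr rfl fun j _ ↦ ?_
          rw [hg, gramMatrix_inv_symm (hG.symm y hy) i j]
  rw [e1]
  simp only [mul_assoc, ← Finset.mul_sum]
  field_simp
  rw [Real.sq_sqrt hpos.le]

end LocalTrace

/-! ### The metric, the gradient, the Hessian and the Ricci tensor in a chart -/

section Charts

variable {k : ℕ} {X : Type*} [TopologicalSpace X] [ChartedSpace (EuclideanSpace ℝ (Fin k)) X]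

/-- `e` is a diffeomorphism from an open subset of `X` to an open subset of `ℝᵏ`. -/
structure IsSmoothChart (e : OpenPartialHomeomorph X (EuclideanSpace ℝ (Fin k))) : Prop where
  contMDiffOn : ContMDiffOn (𝓡 k) (𝓡 k) ∞ e e.source
  contMDiffOn_symm : ContMDiffOn (𝓡 k) (𝓡 k) ∞ e.symm e.target

/-- The tangent vector with coordinates `v` in the chart `e`, at the point with coordinates `y`. -/
def chartVec (e : OpenPartialHomeomorph X (EuclideanSpace ℝ (Fin k)))
    (y v : EuclideanSpace ℝ (Fin k)) : TangentSpace (𝓡 k) (e.symm y) :=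
  mfderiv (𝓡 k) (𝓡 k) e.symm y v

variable {e : OpenPartialHomeomorph X (EuclideanSpace ℝ (Fin k))}

theorem isSmoothChart_of_mem_maximalAtlas [IsManifold (𝓡 k) ∞ X]
    (he : e ∈ IsManifold.maximalAtlas (𝓡 k) ∞ X) : IsSmoothChart e :=
  ⟨contMDiffOn_of_mem_maximalAtlas he, contMDiffOn_symm_of_mem_maximalAtlas he⟩

theorem isSmoothChart_chartAt [IsManifold (𝓡 k) ∞ X] (p : X) :
    IsSmoothChart (chartAt (EuclideanSpace ℝ (Fin k)) p) :=
  isSmoothChart_of_mem_maximalAtlas (IsManifold.chart_mem_maximalAtlas p)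

namespace IsSmoothChart

theorem mdifferentiable (he : IsSmoothChart e) : e.MDifferentiable (𝓡 k) (𝓡 k) :=
  ⟨he.contMDiffOn.mdifferentiableOn (by simp), he.contMDiffOn_symm.mdifferentiableOn (by simp)⟩

theorem contMDiffAt (he : IsSmoothChart e) {q : X} (hq : q ∈ e.source) :
    ContMDiffAt (𝓡 k) (𝓡 k) ∞ e q :=
  he.contMDiffOn.contMDiffAt (e.open_source.mem_nhds hq)

theorem contMDiffAt_symm (he : IsSmoothChart e) {y : EuclideanSpace ℝ (Fin k)}
    (hy : y ∈ e.target) : ContMDiffAt (𝓡 k) (𝓡 k) ∞ e.symm y :=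
  he.contMDiffOn_symm.contMDiffAt (e.open_target.mem_nhds hy)

theorem coords_chartVec (he : IsSmoothChart e) {y : EuclideanSpace ℝ (Fin k)} (hy : y ∈ e.target)
    (v : EuclideanSpace ℝ (Fin k)) : coords e (e.symm y) (chartVec e y v) = v :=
  DFunLike.congr_fun (he.mdifferentiable.comp_symm_deriv hy) v

theorem chartVec_coords (he : IsSmoothChart e) {y : EuclideanSpace ℝ (Fin k)} (hy : y ∈ e.target)
    (v : TangentSpace (𝓡 k) (e.symm y)) : chartVec e y (coords e (e.symm y) v) = v := by
  have h := he.mdifferentiable.symm_comp_deriv (e.map_target hy)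
  rw [e.right_inv hy] at h
  exact DFunLike.congr_fun h v

theorem isInvertible_mfderiv (he : IsSmoothChart e) {q : X} (hq : q ∈ e.source) :
    (mfderiv (𝓡 k) (𝓡 k) e q).IsInvertible :=
  ⟨he.mdifferentiable.mfderiv hq, rfl⟩

theorem coords_injective (he : IsSmoothChart e) {q : X} (hq : q ∈ e.source) :
    Function.Injective (coords e q) := he.mdifferentiable.mfderiv_injective hq

theorem coords_inverse (he : IsSmoothChart e) {q : X} (hq : q ∈ e.source)
    (v : EuclideanSpace ℝ (Fin k)) :
    coords e q ((mfderiv (𝓡 k) (𝓡 k) e q).inverse v) = v :=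
  (he.isInvertible_mfderiv hq).self_apply_inverse v

theorem exists_coords_eq (he : IsSmoothChart e) {q : X} (hq : q ∈ e.source)
    (v : EuclideanSpace ℝ (Fin k)) : ∃ w : TangentSpace (𝓡 k) q, coords e q w = v :=
  ⟨_, he.coords_inverse hq v⟩

end IsSmoothChart

theorem coords_add (q : X) (v w : TangentSpace (𝓡 k) q) :
    coords e q (v + w) = coords e q v + coords e q w :=
  map_add (mfderiv (𝓡 k) (𝓡 k) e q) v w

theorem coords_smul (q : X) (c : ℝ) (v : TangentSpace (𝓡 k) q) :
    coords e q (c • v) = c • coords e q v :=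
  map_smul (mfderiv (𝓡 k) (𝓡 k) e q) c v

theorem coords_sum {ι : Type*} (s : Finset ι) (q : X) (v : ι → TangentSpace (𝓡 k) q) :
    coords e q (∑ i ∈ s, v i) = ∑ i ∈ s, coords e q (v i) :=
  map_sum (mfderiv (𝓡 k) (𝓡 k) e q) v s

theorem contDiffAt_comp_symm (he : IsSmoothChart e) {n : ℕ∞} {u : X → ℝ}
    {y : EuclideanSpace ℝ (Fin k)} (hy : y ∈ e.target)
    (hu : ContMDiffAt (𝓡 k) 𝓘(ℝ, ℝ) n u (e.symm y)) : ContDiffAt ℝ n (u ∘ e.symm) y :=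
  contMDiffAt_iff_contDiffAt.1
    (ContMDiffAt.comp y hu ((he.contMDiffAt_symm hy).of_le (by exact_mod_cast le_top)))

theorem contMDiffAt_of_comp_symm (he : IsSmoothChart e) {n : ℕ∞} {u : X → ℝ}
    {q : X} (hq : q ∈ e.source) {F : EuclideanSpace ℝ (Fin k) → ℝ}
    (hF : ContDiffAt ℝ n F (e q)) (h : ∀ᶠ x in 𝓝 q, u x = F (e x)) :
    ContMDiffAt (𝓡 k) 𝓘(ℝ, ℝ) n u q :=
  (ContMDiffAt.comp q (contMDiffAt_iff_contDiffAt.2 hF)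
    ((he.contMDiffAt hq).of_le (by exact_mod_cast le_top))).congr_of_eventuallyEq h

theorem mvfderiv_eq_fderiv_comp (he : IsSmoothChart e) {q : X} (hq : q ∈ e.source)
    {F : EuclideanSpace ℝ (Fin k) → ℝ} (hF : DifferentiableAt ℝ F (e q)) {u : X → ℝ}
    (h : ∀ᶠ x in 𝓝 q, u x = F (e x)) (v : TangentSpace (𝓡 k) q) :
    mvfderiv (𝓡 k) u q v = fderiv ℝ F (e q) (coords e q v) := by
  have h1 : HasMFDerivAt (𝓡 k) 𝓘(ℝ, ℝ) (F ∘ e) q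
      ((fderiv ℝ F (e q)).comp (mfderiv (𝓡 k) (𝓡 k) e q)) :=
    HasMFDerivAt.comp q hF.hasFDerivAt.hasMFDerivAt
      (he.mdifferentiable.mdifferentiableAt hq).hasMFDerivAt
  have h2 := (h1.congr_of_eventuallyEq h).mfderiv
  show mfderiv (𝓡 k) 𝓘(ℝ, ℝ) u q v = _
  rw [h2]
  rfl

theorem mvfderiv_eq_fderiv_symm (he : IsSmoothChart e) {q : X} (hq : q ∈ e.source)
    {u : X → ℝ} (hu : ContMDiffAt (𝓡 k) 𝓘(ℝ, ℝ) 1 u q) (v : TangentSpace (𝓡 k) q) :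
    mvfderiv (𝓡 k) u q v = fderiv ℝ (u ∘ e.symm) (e q) (coords e q v) := by
  refine mvfderiv_eq_fderiv_comp he hq ?_ ?_ v
  · refine (contDiffAt_comp_symm (n := 1) he (e.map_source hq) ?_).differentiableAt (by simp)
    rwa [e.left_inv hq]
  · filter_upwards [e.open_source.mem_nhds hq] with x hx
    simp [e.left_inv hx]

variable [RiemannianBundle (fun x : X ↦ TangentSpace (𝓡 k) x)]

/-- The metric in the chart `e`. -/
def chartMetric (e : OpenPartialHomeomorph X (EuclideanSpace ℝ (Fin k)))
    (y : EuclideanSpace ℝ (Fin k)) :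
    EuclideanSpace ℝ (Fin k) →L[ℝ] EuclideanSpace ℝ (Fin k) →L[ℝ] ℝ :=
  ∑ i, ∑ j, gram e y i j • (EuclideanSpace.proj i : EuclideanSpace ℝ (Fin k) →L[ℝ] ℝ).smulRight
    (EuclideanSpace.proj j : EuclideanSpace ℝ (Fin k) →L[ℝ] ℝ)

theorem chartMetric_apply' (y v w : EuclideanSpace ℝ (Fin k)) :
    chartMetric e y v w = ∑ i, ∑ j, gram e y i j * (v i * w j) := by
  simp [chartMetric]

theorem gramMatrix_chartMetric (y : EuclideanSpace ℝ (Fin k)) :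
    gramMatrix (chartMetric e y) = gram e y := by
  ext i j
  simp [gramMatrix, chartMetric_apply']

theorem chartMetric_apply (y v w : EuclideanSpace ℝ (Fin k)) :
    chartMetric e y v w = inner ℝ (chartVec e y v) (chartVec e y w) := by
  have h : ∀ v, chartVec e y v = ∑ i, v i • coordField e y i := by
    intro v
    conv_lhs => rw [← sum_smul_stdVec v]
    exact (map_sum (mfderiv (𝓡 k) (𝓡 k) e.symm y) _ _).trans
      (Finset.sum_congr rfl fun i _ ↦ map_smul (mfderiv (𝓡 k) (𝓡 k) e.symm y) _ _)
  rw [h, h, chartMetric_apply', sum_inner]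
  refine Finset.sum_congr rfl fun i _ ↦ ?_
  rw [inner_sum]
  refine Finset.sum_congr rfl fun j _ ↦ ?_
  rw [real_inner_smul_left, real_inner_smul_right]
  simp only [gram, Matrix.of_apply]
  ring

theorem inner_eq_chartMetric (he : IsSmoothChart e) {q : X} (hq : q ∈ e.source)
    (v w : TangentSpace (𝓡 k) q) :
    inner ℝ v w = chartMetric e (e q) (coords e q v) (coords e q w) := by
  obtain ⟨y, hy, rfl⟩ : ∃ y ∈ e.target, e.symm y = q := ⟨e q, e.map_source hq, e.left_inv hq⟩
  rw [e.right_inv hy, chartMetric_apply, he.chartVec_coords hy, he.chartVec_coords hy]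

variable [IsManifold (𝓡 k) ∞ X] [IsContMDiffRiemannianBundle (𝓡 k) ∞ (EuclideanSpace ℝ (Fin k))
  (fun x : X ↦ TangentSpace (𝓡 k) x)]

/-- The coordinate fields are images of constant fields under the tangent map of `e.symm`, hence
smooth sections, and the bundle metric is smooth. -/
theorem contDiffOn_gram (he : IsSmoothChart e) (i j : Fin k) :
    ContDiffOn ℝ ∞ (fun y ↦ gram e y i j) e.target := by
  have h : ∀ i, ContMDiffOn (𝓡 k) ((𝓡 k).prod 𝓘(ℝ, EuclideanSpace ℝ (Fin k))) ∞
      (fun y ↦ (⟨e.symm y, coordField e y i⟩ : TotalSpace (EuclideanSpace ℝ (Fin k))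
        (fun x : X ↦ TangentSpace (𝓡 k) x))) e.target := by
    intro i
    have h1 := he.contMDiffOn_symm.contMDiffOn_tangentMapWithin (m := ∞) (by simp)
      e.open_target.uniqueMDiffOn
    have h2 : ContMDiffOn (𝓡 k) ((𝓡 k).prod 𝓘(ℝ, EuclideanSpace ℝ (Fin k))) ∞
        (fun y ↦ (⟨y, stdVec i⟩ : TotalSpace (EuclideanSpace ℝ (Fin k))
          (fun x : EuclideanSpace ℝ (Fin k) ↦ TangentSpace (𝓡 k) x))) e.target :=
      contMDiffOn_vectorSpace_iff_contDiffOn.2 contDiffOn_const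
    refine (h1.comp h2 fun y hy ↦ hy).congr fun y hy ↦ ?_
    simp only [Function.comp, tangentMapWithin, coordField]
    rw [mfderivWithin_of_isOpen e.open_target hy]
  exact contMDiffOn_iff_contDiffOn.1 ((h i).inner_bundle (h j))

theorem isLocalMetric_chartMetric (he : IsSmoothChart e) :
    IsLocalMetric (chartMetric e) e.target where
  isOpen := e.open_target
  smooth := ContDiffOn.sum fun i _ ↦ ContDiffOn.sum fun j _ ↦
    (contDiffOn_gram he i j).smul contDiffOn_const
  symm y _ v w := by rw [chartMetric_apply, chartMetric_apply, real_inner_comm]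
  pos y hy v hv := by
    rw [chartMetric_apply]
    refine real_inner_self_pos.2 fun h ↦ hv ?_
    rw [← he.coords_chartVec hy v, h]
    exact map_zero (mfderiv (𝓡 k) (𝓡 k) e _)

theorem inner_grad_left (u : X → ℝ) (q : X) (v : TangentSpace (𝓡 k) q) :
    inner ℝ (grad u q) v = mvfderiv (𝓡 k) u q v := by
  have := FiniteDimensional.complete ℝ (TangentSpace (𝓡 k) q)
  exact InnerProductSpace.toDual_symm_apply

theorem coords_grad (he : IsSmoothChart e) {q : X} (hq : q ∈ e.source)
    {u : X → ℝ} (hu : ContMDiffAt (𝓡 k) 𝓘(ℝ, ℝ) 1 u q) :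
    coords e q (grad u q) = localGrad (chartMetric e) (u ∘ e.symm) (e q) := by
  refine (isLocalMetric_chartMetric he).ext_apply (e.map_source hq) fun z ↦ ?_
  obtain ⟨w, rfl⟩ := he.exists_coords_eq hq z
  rw [← inner_eq_chartMetric he hq, inner_grad_left, mvfderiv_eq_fderiv_symm he hq hu,
    (isLocalMetric_chartMetric he).apply_localGrad (e.map_source hq)]

/-- Links the index definition, where the inverse Gram matrix raises an index, to the
coordinate-free symbols used in the local computations. -/
theorem christoffel_eq (he : IsSmoothChart e) {y : EuclideanSpace ℝ (Fin k)} (hy : y ∈ e.target)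
    (l i j : Fin k) :
    christoffel e l i j y = localChristoffel (chartMetric e) y (stdVec i) (stdVec j) l := by
  have hG := isLocalMetric_chartMetric he
  have hd : HasFDerivAt (chartMetric e) (fderiv ℝ (chartMetric e) y) y :=
    ((hG.contDiffAt hy).differentiableAt (by simp)).hasFDerivAt
  have hp : ∀ a b c, pderivAt a (fun z ↦ gram e z b c) y
      = fderiv ℝ (chartMetric e) y (stdVec a) (stdVec b) (stdVec c) := by
    intro a b c
    have h := (hd.clm_apply (hasFDerivAt_const (stdVec b) y)).clm_apply
      (hasFDerivAt_const (stdVec c) y)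
    have h2 : (fun z ↦ gram e z b c) = fun z ↦ chartMetric e z (stdVec b) (stdVec c) := by
      ext z
      rw [← gramMatrix_chartMetric]
      rfl
    rw [pderivAt, h2, h.fderiv]
    simp
  rw [apply_eq_sum_gramMatrix_inv (hG.symm y hy) (hG.pos y hy), christoffel, Finset.mul_sum,
    gramMatrix_chartMetric]
  refine Finset.sum_congr rfl fun a _ ↦ ?_
  rw [hp, hp, hp, hG.apply_localChristoffel hy, koszulForm_apply]
  ring

theorem sum_christoffel (he : IsSmoothChart e) {y : EuclideanSpace ℝ (Fin k)} (hy : y ∈ e.target)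
    (v w : EuclideanSpace ℝ (Fin k)) (l : Fin k) :
    ∑ i, ∑ j, christoffel e l i j y * v i * w j = localChristoffel (chartMetric e) y v w l := by
  conv_rhs => rw [← sum_smul_stdVec v, ← sum_smul_stdVec w]
  simp only [map_sum, map_smul, FunLike.coe_sum, Finset.sum_apply, FunLike.coe_smul,
    Pi.smul_apply, christoffel_eq he hy, WithLp.ofLp_sum, WithLp.ofLp_smul, smul_eq_mul,
    Finset.mul_sum]
  rw [Finset.sum_comm]
  exact Finset.sum_congr rfl fun i _ ↦ Finset.sum_congr rfl fun j _ ↦ by ring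

/-- The covariant derivative along a map, of a field that extends to a neighbourhood of the image,
is given in a chart by the covariant derivative of the extension. -/
theorem coords_covDerivAlong {r : ℕ} {Y : Type*} [TopologicalSpace Y]
    [ChartedSpace (EuclideanSpace ℝ (Fin r)) Y] {c : Y → X}
    {V : ∀ t : Y, TangentSpace (𝓡 k) (c t)} {s : Y}
    (hc : MDifferentiableAt (𝓡 r) (𝓡 k) c s)
    (he : e = chartAt (EuclideanSpace ℝ (Fin k)) (c s))
    {W : EuclideanSpace ℝ (Fin k) → EuclideanSpace ℝ (Fin k)}
    (hW : DifferentiableAt ℝ W (e (c s))) (h : ∀ᶠ t in 𝓝 s, coords e (c t) (V t) = W (e (c t)))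
    (ξ : TangentSpace (𝓡 r) s) :
    coords e (c s) (covDerivAlong c V s ξ) =
      covDerivOp (localChristoffel (chartMetric e)) W (e (c s))
        (coords e (c s) (mfderiv (𝓡 r) (𝓡 k) c s ξ)) := by
  subst he
  set e := chartAt (EuclideanSpace ℝ (Fin k)) (c s) with he_def
  have hs : c s ∈ e.source := mem_chart_source _ _
  have he : IsSmoothChart e := isSmoothChart_chartAt _
  have hd : ∀ l, mvfderiv (𝓡 r) (fun t ↦ coords e (c t) (V t) l) s ξ
      = fderiv ℝ W (e (c s)) (coords e (c s) (mfderiv (𝓡 r) (𝓡 k) c s ξ)) l := by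
    intro l
    have h0 : HasFDerivAt (fun y ↦ W y l)
        ((EuclideanSpace.proj l : EuclideanSpace ℝ (Fin k) →L[ℝ] ℝ).comp
          (fderiv ℝ W (e (c s)))) (e (c s)) :=
      (EuclideanSpace.proj l : EuclideanSpace ℝ (Fin k) →L[ℝ] ℝ).hasFDerivAt.comp _ hW.hasFDerivAt
    have h1 := HasMFDerivAt.comp s
      (HasMFDerivAt.comp (c s) h0.hasMFDerivAt
        (he.mdifferentiable.mdifferentiableAt hs).hasMFDerivAt) hc.hasMFDerivAt
    have h3 : (fun t ↦ coords e (c t) (V t) l) =ᶠ[𝓝 s] ((fun y ↦ W y l) ∘ e) ∘ c :=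
      h.mono fun t ht ↦ congrArg (fun z : EuclideanSpace ℝ (Fin k) ↦ z l) ht
    have h2 := (h1.congr_of_eventuallyEq h3).mfderiv
    show mfderiv (𝓡 r) 𝓘(ℝ, ℝ) (fun t ↦ coords e (c t) (V t) l) s ξ = _
    rw [h2]
    rfl
  rw [covDerivAlong]
  simp only [← he_def]
  rw [coords_sum]
  simp only [coords_smul, hd, sum_christoffel he (e.map_source hs)]
  rw [h.self_of_nhds, covDerivOp_apply, ← sum_smul_stdVec (_ + _)]
  exact Finset.sum_congr rfl fun l _ ↦ congrArg₂ (· • ·) rfl (he.coords_inverse hs _)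

end Charts

/-! ### Gradient, Hessian and Laplacian as intrinsic objects -/

section LinearAlgebra

variable {V : Type*} [NormedAddCommGroup V] [InnerProductSpace ℝ V] [FiniteDimensional ℝ V]

theorem bilinTrace_inner (A : V →ₗ[ℝ] V) :
    bilinTrace (fun v w ↦ inner ℝ (A v) w) = LinearMap.trace ℝ V A := by
  rw [LinearMap.trace_eq_sum_inner A (stdOrthonormalBasis ℝ V), bilinTrace]
  exact Finset.sum_congr rfl fun i _ ↦ real_inner_comm _ _

/-- By Parseval the double sum is ∑ᵢ |A bᵢ|², and self-adjointness turns it into the trace of A². In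
this form |∇²u|² appears in the Bochner identity. -/
theorem bilinNormSq_inner (A : V →ₗ[ℝ] V)
    (hA : ∀ v w, (inner ℝ (A v) w : ℝ) = inner ℝ (A w) v) :
    bilinNormSq (fun v w ↦ inner ℝ (A v) w) = LinearMap.trace ℝ V (A ∘ₗ A) := by
  rw [← bilinTrace_inner, bilinNormSq, bilinTrace]
  refine Finset.sum_congr rfl fun i _ ↦ ?_
  rw [LinearMap.comp_apply, hA (A _), real_inner_self_eq_norm_sq,
    ← (stdOrthonormalBasis ℝ V).sum_sq_norm_inner_left]
  refine Finset.sum_congr rfl fun j _ ↦ ?_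
  rw [Real.norm_eq_abs, sq_abs]

end LinearAlgebra

theorem two_le_infty : (2 : ℕ∞ω) ≤ (∞ : ℕ∞ω) := ENat.LEInfty.out

/-! ### Locality of gradient and Hessian, and compatibility of the connection with the metric -/

section LocalMetricCompatibility

attribute [-instance] Bundle.instNormedAddCommGroupOfRiemannianBundleOfIsTopologicalAddGroupOfContinuousConstSMulReal
  Bundle.instInnerProductSpaceReal

variable {E : Type*} [NormedAddCommGroup E] [NormedSpace ℝ E]

theorem localGrad_congr {G : E → E →L[ℝ] E →L[ℝ] ℝ} {a b : E → ℝ} {y : E}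
    (h : a =ᶠ[𝓝 y] b) : localGrad G a =ᶠ[𝓝 y] localGrad G b := by
  filter_upwards [h.fderiv (𝕜 := ℝ)] with z hz
  rw [localGrad, localGrad, hz]

theorem localHess_congr {G : E → E →L[ℝ] E →L[ℝ] ℝ} {a b : E → ℝ} {y : E}
    (h : a =ᶠ[𝓝 y] b) (v w : E) : localHess G a y v w = localHess G b y v w := by
  have h1 : fderiv ℝ a =ᶠ[𝓝 y] fderiv ℝ b := h.fderiv
  have h2 : fderiv ℝ (fderiv ℝ a) y = fderiv ℝ (fderiv ℝ b) y := h1.fderiv_eq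
  rw [localHess, localHess, h2,
    (localGrad_congr h).eq_of_nhds]

theorem covDerivOp_congr {Γ : E → E →L[ℝ] E →L[ℝ] E} {Y Z : E → E} {y : E}
    (h : Y =ᶠ[𝓝 y] Z) : covDerivOp Γ Y y = covDerivOp Γ Z y := by
  rw [covDerivOp, covDerivOp, h.fderiv_eq, h.eq_of_nhds]

theorem covDerivOp_const_smul (Γ : E → E →L[ℝ] E →L[ℝ] E) (c : ℝ) {Y : E → E} {y : E}
    (hY : DifferentiableAt ℝ Y y) :
    covDerivOp Γ (fun z ↦ c • Y z) y = c • covDerivOp Γ Y y := by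
  ext v
  simp [covDerivOp, fderiv_fun_const_smul hY]

/-- Metric compatibility: the two Koszul terms, one from each covariant derivative, add up to the
derivative of `G`. -/
theorem IsLocalMetric.fderiv_apply_localGrad [FiniteDimensional ℝ E]
    {G : E → E →L[ℝ] E →L[ℝ] ℝ} {U : Set E} (hG : IsLocalMetric G U) {y : E} (hy : y ∈ U)
    {a b : E → ℝ} (ha : ContDiffAt ℝ 2 a y) (hb : ContDiffAt ℝ 2 b y) (v : E) :
    fderiv ℝ (fun z ↦ G z (localGrad G a z) (localGrad G b z)) y v =
      localHess G a y v (localGrad G b y) + localHess G b y v (localGrad G a y) := by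
  have hd : HasFDerivAt G (fderiv ℝ G y) y :=
    ((hG.contDiffAt hy).differentiableAt (by simp)).hasFDerivAt
  have hYa : HasFDerivAt (localGrad G a) (fderiv ℝ (localGrad G a) y) y :=
    ((hG.contDiffAt_localGrad (n := 1) hy ha).differentiableAt (by simp)).hasFDerivAt
  have hYb : HasFDerivAt (localGrad G b) (fderiv ℝ (localGrad G b) y) y :=
    ((hG.contDiffAt_localGrad (n := 1) hy hb).differentiableAt (by simp)).hasFDerivAt
  rw [((hd.clm_apply hYa).clm_apply hYb).fderiv, ← hG.apply_covDerivOp_localGrad hy ha,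
    ← hG.apply_covDerivOp_localGrad hy hb]
  simp only [covDerivOp_apply, map_add, add_apply, hG.apply_localChristoffel hy, koszulForm_apply,
    ContinuousLinearMap.comp_apply, ContinuousLinearMap.flip_apply]
  rw [hG.fderiv_symm hy v (localGrad G b y) (localGrad G a y),
    hG.symm y hy (localGrad G a y) (fderiv ℝ (localGrad G b) y v)]
  ring

end LocalMetricCompatibility

/-! ### Chart independence of the Hessian and derivatives of ⟨∇a, ∇b⟩ -/

section Calculus

variable {k : ℕ} {X : Type*} [TopologicalSpace X] [ChartedSpace (EuclideanSpace ℝ (Fin k)) X]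
  [IsManifold (𝓡 k) ∞ X]
  [RiemannianBundle (fun x : X ↦ TangentSpace (𝓡 k) x)]
  [IsContMDiffRiemannianBundle (𝓡 k) ∞ (EuclideanSpace ℝ (Fin k))
    (fun x : X ↦ TangentSpace (𝓡 k) x)]
  {e : OpenPartialHomeomorph X (EuclideanSpace ℝ (Fin k))}

theorem contDiffAt_comp_symm_of_mem (he : IsSmoothChart e) {n : ℕ∞} {u : X → ℝ} {p : X}
    (hp : p ∈ e.source) (hu : ContMDiffAt (𝓡 k) 𝓘(ℝ, ℝ) n u p) :
    ContDiffAt ℝ n (u ∘ e.symm) (e p) :=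
  contDiffAt_comp_symm he (e.map_source hp) (by rwa [e.left_inv hp])

theorem eventually_contMDiffAt {n : ℕ} {u : X → ℝ} {p : X}
    (hu : ContMDiffAt (𝓡 k) 𝓘(ℝ, ℝ) n u p) :
    ∀ᶠ q in 𝓝 p, ContMDiffAt (𝓡 k) 𝓘(ℝ, ℝ) n u q :=
  (contMDiffAt_iff_contMDiffAt_nhds (by simp)).1 hu

/-- The definition of `hess` refers to the preferred chart at `p`, so this case comes first;
`hess_eq_localHess` removes the restriction. -/
theorem hess_eq_localHess_chartAt {u : X → ℝ} {p : X} (hu : ContMDiffAt (𝓡 k) 𝓘(ℝ, ℝ) 2 u p)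
    (he : e = chartAt (EuclideanSpace ℝ (Fin k)) p) (v w : TangentSpace (𝓡 k) p) :
    hess u p v w = localHess (chartMetric e) (u ∘ e.symm) (e p) (coords e p v) (coords e p w) := by
  have hs : IsSmoothChart e := he ▸ isSmoothChart_chartAt p
  have hp : p ∈ e.source := he ▸ mem_chart_source _ p
  have hG := isLocalMetric_chartMetric hs
  have hu' : ContDiffAt ℝ 2 (u ∘ e.symm) (e p) := contDiffAt_comp_symm_of_mem (n := 2) hs hp hu
  have h1 : ∀ᶠ t in 𝓝 p, coords e t (grad u t)
      = localGrad (chartMetric e) (u ∘ e.symm) (e t) := by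
    filter_upwards [e.open_source.mem_nhds hp, eventually_contMDiffAt (n := 2) hu] with t ht hut
    exact coords_grad hs ht (hut.of_le (by norm_num))
  have h2 := coords_covDerivAlong (c := fun q : X ↦ q) (V := fun q ↦ grad u q) mdifferentiableAt_id
    he ((hG.contDiffAt_localGrad (n := 1) (e.map_source hp) hu').differentiableAt (by simp)) h1 v
  rw [hess, inner_eq_chartMetric hs hp, h2,
    show mfderiv (𝓡 k) (𝓡 k) (fun q : X ↦ q) p v = v from by
      rw [show (fun q : X ↦ q) = id from rfl, mfderiv_id]; rfl,
    hG.apply_covDerivOp_localGrad (e.map_source hp) hu']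

variable {r : ℕ} {Y : Type*} [TopologicalSpace Y] [ChartedSpace (EuclideanSpace ℝ (Fin r)) Y]
  [IsManifold (𝓡 r) ∞ Y]
  [RiemannianBundle (fun x : Y ↦ TangentSpace (𝓡 r) x)]
  [IsContMDiffRiemannianBundle (𝓡 r) ∞ (EuclideanSpace ℝ (Fin r))
    (fun x : Y ↦ TangentSpace (𝓡 r) x)]
  {e' : OpenPartialHomeomorph Y (EuclideanSpace ℝ (Fin r))}

/-- The coordinate expression of a map is differentiable, with derivative the coordinate expression
of its differential. -/
theorem fderiv_coord_expr (he : IsSmoothChart e) (he' : IsSmoothChart e') {c : Y → X}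
    {s : Y} (hc : MDifferentiableAt (𝓡 r) (𝓡 k) c s) (hs : s ∈ e'.source) (hcs : c s ∈ e.source)
    (v : TangentSpace (𝓡 r) s) :
    fderiv ℝ (e ∘ c ∘ e'.symm) (e' s) (coords e' s v)
      = coords e (c s) (mfderiv (𝓡 r) (𝓡 k) c s v) := by
  obtain ⟨y, hy, rfl⟩ : ∃ y ∈ e'.target, e'.symm y = s := ⟨e' s, e'.map_source hs, e'.left_inv hs⟩
  rw [e'.right_inv hy]
  have h := HasMFDerivAt.comp y (HasMFDerivAt.comp (e'.symm y)
    (he.mdifferentiable.mdifferentiableAt hcs).hasMFDerivAt hc.hasMFDerivAt)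
    (he'.mdifferentiable.mdifferentiableAt_symm hy).hasMFDerivAt
  have h2 := h.mfderiv
  rw [mfderiv_eq_fderiv] at h2
  have h3 := DFunLike.congr_fun h2 (coords e' (e'.symm y) v)
  refine h3.trans ?_
  show coords e (c (e'.symm y)) (mfderiv (𝓡 r) (𝓡 k) c (e'.symm y)
    (chartVec e' y (coords e' (e'.symm y) v))) = _
  rw [he'.chartVec_coords hy]

/-- The charts are arbitrary because the result serves two purposes: with `c` the identity it gives
chart independence of the Hessian, and with `c` the inclusion of the boundary it gives the Gauss
formula. -/
theorem localHess_comp_of_isometric (he : IsSmoothChart e) (he' : IsSmoothChart e') {c : Y → X}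
    (hc : ContMDiff (𝓡 r) (𝓡 k) ∞ c)
    (hiso : ∀ (s : Y) (v w : TangentSpace (𝓡 r) s),
      (inner ℝ (mfderiv (𝓡 r) (𝓡 k) c s v : TangentSpace (𝓡 k) (c s))
        (mfderiv (𝓡 r) (𝓡 k) c s w) : ℝ) = inner ℝ v w)
    {s : Y} (hs : s ∈ e'.source) (hcs : c s ∈ e.source) {a : X → ℝ}
    (ha : ContMDiffAt (𝓡 k) 𝓘(ℝ, ℝ) 2 a (c s))
    (htan : grad a (c s) = mfderiv (𝓡 r) (𝓡 k) c s (grad (a ∘ c) s))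
    (v w : TangentSpace (𝓡 r) s) :
    localHess (chartMetric e) (a ∘ e.symm) (e (c s))
        (coords e (c s) (mfderiv (𝓡 r) (𝓡 k) c s v))
        (coords e (c s) (mfderiv (𝓡 r) (𝓡 k) c s w))
      = localHess (chartMetric e') ((a ∘ c) ∘ e'.symm) (e' s) (coords e' s v) (coords e' s w) := by
  set j : EuclideanSpace ℝ (Fin r) → EuclideanSpace ℝ (Fin k) := e ∘ c ∘ e'.symm with hj
  have hju : j (e' s) = e (c s) := by simp [hj, e'.left_inv hs]
  have hcd : ∀ t, MDifferentiableAt (𝓡 r) (𝓡 k) c t := fun t ↦ hc.mdifferentiableAt (by simp)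
  have hnear : ∀ᶠ z in 𝓝 (e' s), z ∈ e'.target ∧ c (e'.symm z) ∈ e.source := by
    refine Filter.Eventually.and (e'.open_target.mem_nhds (e'.map_source hs)) ?_
    have h1 : ContinuousAt (c ∘ e'.symm) (e' s) :=
      ContinuousAt.comp hc.continuous.continuousAt (e'.continuousAt_symm (e'.map_source hs))
    exact h1.eventually (e.open_source.mem_nhds (by simpa [e'.left_inv hs] using hcs))
  have hjc : ContDiffAt ℝ 2 j (e' s) := by
    refine contMDiffAt_iff_contDiffAt.1 (ContMDiffAt.comp (e' s) ((he.contMDiffAt ?_).of_le two_le_infty) (ContMDiffAt.comp (e' s) (hc.contMDiffAt.of_le two_le_infty) ((he'.contMDiffAt_symm (e'.map_source hs)).of_le two_le_infty)))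
    simpa [e'.left_inv hs] using hcs
  have hiso' : ∀ᶠ z in 𝓝 (e' s), ∀ v w, chartMetric e' z v w
      = chartMetric e (j z) (fderiv ℝ j z v) (fderiv ℝ j z w) := by
    filter_upwards [hnear] with z hz v w
    have hz1 := e'.map_target hz.1
    obtain ⟨v, rfl⟩ := he'.exists_coords_eq hz1 v
    obtain ⟨w, rfl⟩ := he'.exists_coords_eq hz1 w
    have h1 := fderiv_coord_expr he he' (hcd _) hz1 hz.2 v
    have h2 := fderiv_coord_expr he he' (hcd _) hz1 hz.2 w
    rw [e'.right_inv hz.1] at h1 h2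
    rw [h1, h2]
    have h3 := inner_eq_chartMetric he' hz1 v w
    rw [e'.right_inv hz.1] at h3
    rw [← h3, ← hiso]
    exact inner_eq_chartMetric he hz.2 _ _
  have hac : ContMDiffAt (𝓡 r) 𝓘(ℝ, ℝ) 2 (a ∘ c) s :=
    ContMDiffAt.comp s ha (hc.contMDiffAt.of_le two_le_infty)
  have hcongr : (a ∘ e.symm) ∘ j =ᶠ[𝓝 (e' s)] (a ∘ c) ∘ e'.symm := by
    filter_upwards [hnear] with z hz
    simp [hj, e.left_inv hz.2]
  have h := localHess_comp_isometric (isLocalMetric_chartMetric he) (isLocalMetric_chartMetric he')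
    (e'.map_source hs) (hju ▸ e.map_source hcs) hjc hiso' (a := a ∘ e.symm)
    (by rw [hju]; exact contDiffAt_comp_symm_of_mem (n := 2) he hcs ha)
    (by
      rw [(localGrad_congr hcongr).eq_of_nhds,
        ← coords_grad he' hs (hac.of_le (by norm_num)), fderiv_coord_expr he he' (hcd s) hs hcs,
        ← htan, coords_grad he hcs (ha.of_le (by norm_num)), hju])
    (coords e' s v) (coords e' s w)
  rw [fderiv_coord_expr he he' (hcd s) hs hcs, fderiv_coord_expr he he' (hcd s) hs hcs, hju,
    localHess_congr hcongr] at h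
  exact h

/-- A change of chart is an isometry between the two coordinate metrics, and for the identity map
the tangency condition on the gradient is automatic. -/
theorem hess_eq_localHess (he : IsSmoothChart e) {u : X → ℝ} {p : X} (hp : p ∈ e.source)
    (hu : ContMDiffAt (𝓡 k) 𝓘(ℝ, ℝ) 2 u p) (v w : TangentSpace (𝓡 k) p) :
    hess u p v w = localHess (chartMetric e) (u ∘ e.symm) (e p) (coords e p v) (coords e p w) := by
  rw [hess_eq_localHess_chartAt hu rfl]
  have hid : ∀ (q : X) (v : TangentSpace (𝓡 k) q), mfderiv (𝓡 k) (𝓡 k) (fun q : X ↦ q) q v = v := by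
    intro q v
    rw [show (fun q : X ↦ q) = id from rfl, mfderiv_id]
    rfl
  have h := localHess_comp_of_isometric (c := fun q : X ↦ q) (s := p) (isSmoothChart_chartAt p) he
    contMDiff_id (fun q v w ↦ by rw [hid, hid]) hp (mem_chart_source _ p) hu
    (by rw [hid]; rfl) v w
  rw [hid, hid] at h
  exact h

theorem hess_comp_of_isometric {c : Y → X} (hc : ContMDiff (𝓡 r) (𝓡 k) ∞ c)
    (hiso : ∀ (s : Y) (v w : TangentSpace (𝓡 r) s),
      (inner ℝ (mfderiv (𝓡 r) (𝓡 k) c s v : TangentSpace (𝓡 k) (c s))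
        (mfderiv (𝓡 r) (𝓡 k) c s w) : ℝ) = inner ℝ v w)
    {s : Y} {a : X → ℝ} (ha : ContMDiffAt (𝓡 k) 𝓘(ℝ, ℝ) 2 a (c s))
    (htan : grad a (c s) = mfderiv (𝓡 r) (𝓡 k) c s (grad (a ∘ c) s))
    (v w : TangentSpace (𝓡 r) s) :
    hess a (c s) (mfderiv (𝓡 r) (𝓡 k) c s v) (mfderiv (𝓡 r) (𝓡 k) c s w)
      = hess (a ∘ c) s v w := by
  rw [hess_eq_localHess_chartAt ha rfl, hess_eq_localHess_chartAt
    (ContMDiffAt.comp s ha (hc.contMDiffAt.of_le two_le_infty)) rfl]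
  exact localHess_comp_of_isometric (isSmoothChart_chartAt _) (isSmoothChart_chartAt _) hc hiso
    (mem_chart_source _ _) (mem_chart_source _ _) ha htan v w

/-- The coordinate expression of `v ↦ ∇_v ∇u`. -/
def nablaGrad (e : OpenPartialHomeomorph X (EuclideanSpace ℝ (Fin k))) (u : X → ℝ)
    (y : EuclideanSpace ℝ (Fin k)) : EuclideanSpace ℝ (Fin k) →L[ℝ] EuclideanSpace ℝ (Fin k) :=
  covDerivOp (localChristoffel (chartMetric e)) (localGrad (chartMetric e) (u ∘ e.symm)) y

theorem hess_eq_nablaGrad (he : IsSmoothChart e) {u : X → ℝ} {p : X} (hp : p ∈ e.source)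
    (hu : ContMDiffAt (𝓡 k) 𝓘(ℝ, ℝ) 2 u p) (v w : TangentSpace (𝓡 k) p) :
    hess u p v w = chartMetric e (e p) (nablaGrad e u (e p) (coords e p v)) (coords e p w) := by
  rw [hess_eq_localHess he hp hu, nablaGrad,
    (isLocalMetric_chartMetric he).apply_covDerivOp_localGrad (e.map_source hp)
      (contDiffAt_comp_symm_of_mem (n := 2) he hp hu)]

theorem hess_symm {u : X → ℝ} {p : X} (hu : ContMDiffAt (𝓡 k) 𝓘(ℝ, ℝ) 2 u p)
    (v w : TangentSpace (𝓡 k) p) : hess u p v w = hess u p w v := by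
  have he := isSmoothChart_chartAt (k := k) p
  have hp := mem_chart_source (EuclideanSpace ℝ (Fin k)) p
  rw [hess_eq_localHess he hp hu, hess_eq_localHess he hp hu,
    (isLocalMetric_chartMetric he).localHess_symm (OpenPartialHomeomorph.map_source _ hp)
      (contDiffAt_comp_symm_of_mem (n := 2) he hp hu)]

theorem hess_add_left {u : X → ℝ} {p : X}
    (hu : ContMDiffAt (𝓡 k) 𝓘(ℝ, ℝ) 2 u p) (v v' w : TangentSpace (𝓡 k) p) :
    hess u p (v + v') w = hess u p v w + hess u p v' w := by
  have he := isSmoothChart_chartAt (k := k) p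
  have hp := mem_chart_source (EuclideanSpace ℝ (Fin k)) p
  simp only [hess_eq_nablaGrad he hp hu, coords_add, map_add, add_apply]

theorem hess_smul_left {u : X → ℝ} {p : X} (hu : ContMDiffAt (𝓡 k) 𝓘(ℝ, ℝ) 2 u p) (c : ℝ)
    (v w : TangentSpace (𝓡 k) p) : hess u p (c • v) w = c * hess u p v w := by
  have he := isSmoothChart_chartAt (k := k) p
  have hp := mem_chart_source (EuclideanSpace ℝ (Fin k)) p
  simp only [hess_eq_nablaGrad he hp hu, coords_smul, map_smul, FunLike.coe_smul, Pi.smul_apply,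
    smul_eq_mul]

theorem inner_grad_eq (he : IsSmoothChart e) {a b : X → ℝ} {q : X} (hq : q ∈ e.source)
    (ha : ContMDiffAt (𝓡 k) 𝓘(ℝ, ℝ) 1 a q) (hb : ContMDiffAt (𝓡 k) 𝓘(ℝ, ℝ) 1 b q) :
    inner ℝ (grad (k := k) a q) (grad b q)
      = chartMetric e (e q) (localGrad (chartMetric e) (a ∘ e.symm) (e q))
        (localGrad (chartMetric e) (b ∘ e.symm) (e q)) := by
  rw [inner_eq_chartMetric he hq, coords_grad he hq ha, coords_grad he hq hb]

theorem contDiffAt_chartMetric_localGrad (he : IsSmoothChart e) {a b : X → ℝ} {n : ℕ} {p : X}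
    (hp : p ∈ e.source) (ha : ContMDiffAt (𝓡 k) 𝓘(ℝ, ℝ) (n + 1 : ℕ) a p)
    (hb : ContMDiffAt (𝓡 k) 𝓘(ℝ, ℝ) (n + 1 : ℕ) b p) :
    ContDiffAt ℝ n (fun y ↦ chartMetric e y (localGrad (chartMetric e) (a ∘ e.symm) y)
        (localGrad (chartMetric e) (b ∘ e.symm) y)) (e p) := by
  have hG := isLocalMetric_chartMetric he
  have hp' := e.map_source hp
  exact ((((hG.contDiffAt hp').of_le (by exact_mod_cast le_top)).clm_apply
    (hG.contDiffAt_localGrad hp' (contDiffAt_comp_symm_of_mem (n := (n + 1 : ℕ)) he hp ha))).clm_apply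
    (hG.contDiffAt_localGrad hp' (contDiffAt_comp_symm_of_mem (n := (n + 1 : ℕ)) he hp hb)))

theorem eventually_inner_grad_eq (he : IsSmoothChart e) {a b : X → ℝ} {p : X}
    (hp : p ∈ e.source) (ha : ContMDiffAt (𝓡 k) 𝓘(ℝ, ℝ) 1 a p)
    (hb : ContMDiffAt (𝓡 k) 𝓘(ℝ, ℝ) 1 b p) :
    ∀ᶠ q in 𝓝 p, inner ℝ (grad (k := k) a q) (grad b q)
      = chartMetric e (e q) (localGrad (chartMetric e) (a ∘ e.symm) (e q))
        (localGrad (chartMetric e) (b ∘ e.symm) (e q)) := by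
  filter_upwards [e.open_source.mem_nhds hp, eventually_contMDiffAt (n := 1) ha,
    eventually_contMDiffAt (n := 1) hb] with q hq hqa hqb using inner_grad_eq he hq hqa hqb

theorem contMDiffAt_inner_grad {a b : X → ℝ} {n : ℕ} {p : X}
    (ha : ContMDiffAt (𝓡 k) 𝓘(ℝ, ℝ) (n + 1 : ℕ) a p)
    (hb : ContMDiffAt (𝓡 k) 𝓘(ℝ, ℝ) (n + 1 : ℕ) b p) :
    ContMDiffAt (𝓡 k) 𝓘(ℝ, ℝ) n (fun q ↦ inner ℝ (grad (k := k) a q) (grad b q)) p := by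
  have he := isSmoothChart_chartAt (k := k) p
  have hp := mem_chart_source (EuclideanSpace ℝ (Fin k)) p
  have h1 : (1 : ℕ∞ω) ≤ (n + 1 : ℕ) := by norm_cast; omega
  exact contMDiffAt_of_comp_symm (n := n) he hp (contDiffAt_chartMetric_localGrad he hp ha hb)
    (eventually_inner_grad_eq he hp (ha.of_le h1) (hb.of_le h1))

theorem mvfderiv_inner_grad {a b : X → ℝ} {p : X} (ha : ContMDiffAt (𝓡 k) 𝓘(ℝ, ℝ) 2 a p)
    (hb : ContMDiffAt (𝓡 k) 𝓘(ℝ, ℝ) 2 b p) (v : TangentSpace (𝓡 k) p) :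
    mvfderiv (𝓡 k) (fun q ↦ inner ℝ (grad (k := k) a q) (grad b q) : X → ℝ) p v
      = hess a p v (grad b p) + hess b p v (grad a p) := by
  have he := isSmoothChart_chartAt (k := k) p
  have hp := mem_chart_source (EuclideanSpace ℝ (Fin k)) p
  have h1 : (1 : ℕ∞ω) ≤ 2 := by norm_num
  rw [mvfderiv_eq_fderiv_comp he hp
    ((contDiffAt_chartMetric_localGrad (n := 1) he hp ha hb).differentiableAt (by simp))
    (eventually_inner_grad_eq he hp (ha.of_le h1) (hb.of_le h1)),
    (isLocalMetric_chartMetric he).fderiv_apply_localGrad (OpenPartialHomeomorph.map_source _ hp)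
      (contDiffAt_comp_symm_of_mem (n := 2) he hp ha)
      (contDiffAt_comp_symm_of_mem (n := 2) he hp hb),
    hess_eq_localHess he hp ha, hess_eq_localHess he hp hb, coords_grad he hp (ha.of_le h1),
    coords_grad he hp (hb.of_le h1)]

end Calculus

/-! ### The Laplacian and the Bochner formula -/

section Laplacian

variable {k : ℕ} {X : Type*} [TopologicalSpace X] [ChartedSpace (EuclideanSpace ℝ (Fin k)) X]
  [IsManifold (𝓡 k) ∞ X]
  [RiemannianBundle (fun x : X ↦ TangentSpace (𝓡 k) x)]
  [IsContMDiffRiemannianBundle (𝓡 k) ∞ (EuclideanSpace ℝ (Fin k))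
    (fun x : X ↦ TangentSpace (𝓡 k) x)]
  {e : OpenPartialHomeomorph X (EuclideanSpace ℝ (Fin k))}

/-- The endomorphism of the tangent space at `q` with expression `A` in the chart `e`. -/
theorem exists_endomorphism_coords (he : IsSmoothChart e) {q : X} (hq : q ∈ e.source)
    (A : EuclideanSpace ℝ (Fin k) →L[ℝ] EuclideanSpace ℝ (Fin k)) :
    ∃ A' : TangentSpace (𝓡 k) q →ₗ[ℝ] TangentSpace (𝓡 k) q,
      (∀ v, coords e q (A' v) = A (coords e q v))
      ∧ LinearMap.trace ℝ _ A' = traceCLM _ A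
      ∧ LinearMap.trace ℝ _ (A' ∘ₗ A') = traceCLM _ (A.comp A) := by
  let φ : EuclideanSpace ℝ (Fin k) ≃ₗ[ℝ] TangentSpace (𝓡 k) q :=
    (he.mdifferentiable.mfderiv hq).toLinearEquiv.symm
  have hφ : ∀ v, coords e q (φ v) = v := fun v ↦
    (he.mdifferentiable.mfderiv hq).toLinearEquiv.apply_symm_apply v
  have hφ' : ∀ v, φ.symm v = coords e q v := fun v ↦ rfl
  refine ⟨φ.conj (A : EuclideanSpace ℝ (Fin k) →ₗ[ℝ] EuclideanSpace ℝ (Fin k)), fun v ↦ ?_, ?_, ?_⟩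
  · rw [LinearEquiv.conj_apply_apply, hφ, hφ']
    rfl
  · rw [LinearMap.trace_conj', traceCLM_apply]
  · rw [← LinearEquiv.conj_comp, LinearMap.trace_conj', traceCLM_apply]
    rfl

theorem bilinTrace_hess (he : IsSmoothChart e) {u : X → ℝ} {q : X} (hq : q ∈ e.source)
    (hu : ContMDiffAt (𝓡 k) 𝓘(ℝ, ℝ) 2 u q) :
    bilinTrace (hess (k := k) u q) = traceCLM _ (nablaGrad e u (e q)) := by
  obtain ⟨A, hA, hA1, -⟩ := exists_endomorphism_coords he hq (nablaGrad e u (e q))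
  rw [← hA1, ← bilinTrace_inner]
  congr 1
  ext v w
  rw [hess_eq_nablaGrad he hq hu, inner_eq_chartMetric he hq, hA]

theorem bilinNormSq_hess (he : IsSmoothChart e) {u : X → ℝ} {q : X} (hq : q ∈ e.source)
    (hu : ContMDiffAt (𝓡 k) 𝓘(ℝ, ℝ) 2 u q) :
    bilinNormSq (hess (k := k) u q)
      = traceCLM _ ((nablaGrad e u (e q)).comp (nablaGrad e u (e q))) := by
  obtain ⟨A, hA, -, hA1⟩ := exists_endomorphism_coords he hq (nablaGrad e u (e q))
  have h : ∀ v w, hess u q v w = inner ℝ (A v) w := fun v w ↦ by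
    rw [hess_eq_nablaGrad he hq hu, inner_eq_chartMetric he hq, hA]
  rw [← hA1, ← bilinNormSq_inner A fun v w ↦ by rw [← h, ← h, hess_symm hu]]
  congr 1
  ext v w
  exact h v w

theorem contDiffAt_nablaGrad (he : IsSmoothChart e) {u : X → ℝ} {n : ℕ} {q : X} (hq : q ∈ e.source)
    (hu : ContMDiffAt (𝓡 k) 𝓘(ℝ, ℝ) (n + 2 : ℕ) u q) : ContDiffAt ℝ n (nablaGrad e u) (e q) := by
  have hG := isLocalMetric_chartMetric he
  have hq' := e.map_source hq
  have h1 : ContDiffAt ℝ (n + 1 : ℕ) (localGrad (chartMetric e) (u ∘ e.symm)) (e q) :=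
    hG.contDiffAt_localGrad hq' (contDiffAt_comp_symm_of_mem (n := (n + 2 : ℕ)) he hq hu)
  have h2 : ContDiffAt ℝ n (localChristoffel (chartMetric e)) (e q) :=
    (hG.contDiffAt_localChristoffel hq').of_le (by exact_mod_cast le_top)
  have h3 : ContDiffAt ℝ n (fun y ↦ (localChristoffel (chartMetric e) y).flip) (e q) :=
    (ContinuousLinearMap.flipₗᵢ ℝ (EuclideanSpace ℝ (Fin k)) (EuclideanSpace ℝ (Fin k))
      (EuclideanSpace ℝ (Fin k))).toContinuousLinearEquiv.contDiff.contDiffAt.comp (e q) h2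
  exact (h1.fderiv_right (m := n) (by norm_cast)).add
    (h3.clm_apply (h1.of_le (by norm_cast; omega)))

theorem contMDiffAt_bilinTrace_hess {u : X → ℝ} {n : ℕ} {p : X}
    (hu : ContMDiffAt (𝓡 k) 𝓘(ℝ, ℝ) (n + 2 : ℕ) u p) :
    ContMDiffAt (𝓡 k) 𝓘(ℝ, ℝ) n (fun q ↦ bilinTrace (hess (k := k) u q)) p := by
  have he := isSmoothChart_chartAt (k := k) p
  have hp := mem_chart_source (EuclideanSpace ℝ (Fin k)) p
  have hu2 : ContMDiffAt (𝓡 k) 𝓘(ℝ, ℝ) (2 : ℕ) u p := hu.of_le (by norm_cast; omega)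
  refine contMDiffAt_of_comp_symm (n := n) he hp
    ((traceCLM _).contDiff.contDiffAt.comp _ (contDiffAt_nablaGrad he hp hu)) ?_
  filter_upwards [OpenPartialHomeomorph.open_source _ |>.mem_nhds hp, eventually_contMDiffAt hu2]
    with q hq hqu using bilinTrace_hess he hq hqu

theorem contMDiffAt_bilinNormSq_hess {u : X → ℝ} {n : ℕ} {p : X}
    (hu : ContMDiffAt (𝓡 k) 𝓘(ℝ, ℝ) (n + 2 : ℕ) u p) :
    ContMDiffAt (𝓡 k) 𝓘(ℝ, ℝ) n (fun q ↦ bilinNormSq (hess (k := k) u q)) p := by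
  have he := isSmoothChart_chartAt (k := k) p
  have hp := mem_chart_source (EuclideanSpace ℝ (Fin k)) p
  have hu2 : ContMDiffAt (𝓡 k) 𝓘(ℝ, ℝ) (2 : ℕ) u p := hu.of_le (by norm_cast; omega)
  refine contMDiffAt_of_comp_symm (n := n) he hp
    ((traceCLM _).contDiff.contDiffAt.comp _ ((contDiffAt_nablaGrad he hp hu).clm_comp
      (contDiffAt_nablaGrad he hp hu))) ?_
  filter_upwards [OpenPartialHomeomorph.open_source _ |>.mem_nhds hp, eventually_contMDiffAt hu2]
    with q hq hqu using bilinNormSq_hess he hq hqu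

theorem contMDiffAt_weightedLaplacian {ψ u : X → ℝ} {n : ℕ} {p : X}
    (hψ : ContMDiffAt (𝓡 k) 𝓘(ℝ, ℝ) (n + 1 : ℕ) ψ p)
    (hu : ContMDiffAt (𝓡 k) 𝓘(ℝ, ℝ) (n + 2 : ℕ) u p) :
    ContMDiffAt (𝓡 k) 𝓘(ℝ, ℝ) n (weightedLaplacian (k := k) ψ u) p :=
  (contMDiffAt_bilinTrace_hess hu).sub
    (contMDiffAt_inner_grad hψ (hu.of_le (by norm_cast; omega)))

/-- Only the preferred chart at `p` is treated. This is enough, since the Bochner formula is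
verified at each point in the chart by which `ricci` is defined there. -/
theorem ricci_eq_trace {p : X} (he : e = chartAt (EuclideanSpace ℝ (Fin k)) p)
    (v w : TangentSpace (𝓡 k) p) :
    ricci p v w = traceCLM _ (curvatureOp (localChristoffel (chartMetric e)) (e p)
      (coords e p v) (coords e p w)) := by
  have hs : IsSmoothChart e := he ▸ isSmoothChart_chartAt p
  have hp : p ∈ e.source := he ▸ mem_chart_source _ p
  have hG := isLocalMetric_chartMetric hs
  have hy := e.map_source hp
  set y := e p with hy_def
  set Γ := localChristoffel (chartMetric e) with hΓ_def
  have hΓ : HasFDerivAt Γ (fderiv ℝ Γ y) y :=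
    ((hG.contDiffAt_localChristoffel hy).differentiableAt (by simp)).hasFDerivAt
  have hpd : ∀ a l i j, pderivAt a (christoffel e l i j) y
      = fderiv ℝ Γ y (stdVec a) (stdVec i) (stdVec j) l := by
    intro a l i j
    have h1 := (hΓ.clm_apply (hasFDerivAt_const (stdVec i) y)).clm_apply
      (hasFDerivAt_const (stdVec j) y)
    have h2 := (EuclideanSpace.proj l : EuclideanSpace ℝ (Fin k) →L[ℝ] ℝ).hasFDerivAt.comp y h1
    have h3 : christoffel e l i j =ᶠ[𝓝 y] fun z ↦ Γ z (stdVec i) (stdVec j) l := by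
      filter_upwards [e.open_target.mem_nhds hy] with z hz using christoffel_eq hs hz l i j
    rw [pderivAt, h3.fderiv_eq]
    refine (congrArg (fun L : EuclideanSpace ℝ (Fin k) →L[ℝ] ℝ ↦ L (stdVec a)) h2.fderiv).trans ?_
    simp
  have hexp : ∀ (B : EuclideanSpace ℝ (Fin k) →L[ℝ] EuclideanSpace ℝ (Fin k)) (z) (l),
      B z l = ∑ m, B (stdVec m) l * z m := by
    intro B z l
    conv_lhs => rw [← sum_smul_stdVec z]
    simp [mul_comm]
  have hR : ∀ j i, ricciCoord e j i y = traceCLM _ (curvatureOp Γ y (stdVec j) (stdVec i)) := by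
    intro j i
    rw [ricciCoord, traceCLM_eq_sum, ← Finset.sum_add_distrib]
    refine Finset.sum_congr rfl fun l _ ↦ ?_
    rw [curvatureOp_apply, hpd, hpd]
    simp only [christoffel_eq hs hy, ← hΓ_def, PiLp.add_apply, PiLp.sub_apply]
    rw [hexp (Γ y (stdVec l)) (Γ y (stdVec j) (stdVec i)) l,
      hexp (Γ y (stdVec j)) (Γ y (stdVec l) (stdVec i)) l, Finset.sum_sub_distrib]
    ring
  have hlin : ∀ v w, traceCLM _ (curvatureOp Γ y v w)
      = ∑ j, ∑ i, traceCLM _ (curvatureOp Γ y (stdVec j) (stdVec i)) * v j * w i := by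
    intro v w
    simp only [traceCLM_eq_sum, Finset.sum_mul]
    have h1 : ∀ j, ∑ i, ∑ l, curvatureOp Γ y (stdVec j) (stdVec i) (stdVec l) l * v j * w i
        = ∑ l, ∑ i, curvatureOp Γ y (stdVec j) (stdVec i) (stdVec l) l * v j * w i :=
      fun j ↦ Finset.sum_comm
    simp only [h1]
    rw [Finset.sum_comm]
    refine Finset.sum_congr rfl fun l _ ↦ ?_
    have hv := sum_smul_stdVec v
    have hw := sum_smul_stdVec w
    conv_lhs => rw [← hv, ← hw]
    have h2 : ∀ (w : EuclideanSpace ℝ (Fin k)) (s : Finset (Fin k)) (a : Fin k → ℝ),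
        curvatureOp Γ y (∑ j ∈ s, a j • stdVec j) w (stdVec l)
          = ∑ j ∈ s, a j • curvatureOp Γ y (stdVec j) w (stdVec l) := by
      intro w s a
      simp only [curvatureOp_apply, map_sum, map_smul, FunLike.coe_sum, Finset.sum_apply,
        FunLike.coe_smul, Pi.smul_apply, smul_sub, smul_add, Finset.sum_sub_distrib,
        Finset.sum_add_distrib]
    have h3 : ∀ (v : EuclideanSpace ℝ (Fin k)) (s : Finset (Fin k)) (a : Fin k → ℝ),
        curvatureOp Γ y v (∑ j ∈ s, a j • stdVec j) (stdVec l)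
          = ∑ j ∈ s, a j • curvatureOp Γ y v (stdVec j) (stdVec l) := by
      intro w s a
      simp only [curvatureOp_apply, map_sum, map_smul, smul_sub, smul_add,
        Finset.sum_sub_distrib, Finset.sum_add_distrib]
    simp only [h2, h3, WithLp.ofLp_sum, WithLp.ofLp_smul, Finset.sum_apply, Pi.smul_apply,
      smul_eq_mul, Finset.mul_sum]
    exact Finset.sum_congr rfl fun j _ ↦ Finset.sum_congr rfl fun i _ ↦ by ring
  rw [hlin, ricci]
  simp only [← he, ← hy_def, hR]

/-- The Bochner formula
`½ Δ_ψ |∇u|² = |∇²u|² + ⟨∇Δ_ψ u, ∇u⟩ + Ric_ψ(∇u, ∇u)`. -/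
theorem bochner_formula {ψ u : X → ℝ} {p : X} (hψ : ContMDiffAt (𝓡 k) 𝓘(ℝ, ℝ) 2 ψ p)
    (hu : ContMDiffAt (𝓡 k) 𝓘(ℝ, ℝ) 3 u p) :
    weightedLaplacian (k := k) ψ (fun q ↦ inner ℝ (grad (k := k) u q) (grad u q)) p
      = 2 * (bilinNormSq (hess (k := k) u p)
        + mvfderiv (𝓡 k) (weightedLaplacian (k := k) ψ u) p (grad (k := k) u p)
        + weightedRicci (k := k) ψ p (grad (k := k) u p) (grad (k := k) u p)) := by
  set e := chartAt (EuclideanSpace ℝ (Fin k)) p with he_def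
  have he : IsSmoothChart e := isSmoothChart_chartAt p
  have hp : p ∈ e.source := mem_chart_source _ p
  have hG := isLocalMetric_chartMetric he
  have hy := e.map_source hp
  set Γ := localChristoffel (chartMetric e) with hΓ_def
  set Y := localGrad (chartMetric e) (u ∘ e.symm) with hY_def
  have hu2 : ContMDiffAt (𝓡 k) 𝓘(ℝ, ℝ) 2 u p := hu.of_le (by norm_num)
  have hu1 : ContMDiffAt (𝓡 k) 𝓘(ℝ, ℝ) 1 u p := hu.of_le (by norm_num)
  have hψ1 : ContMDiffAt (𝓡 k) 𝓘(ℝ, ℝ) 1 ψ p := hψ.of_le (by norm_num)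
  set N : X → ℝ := fun q ↦ inner ℝ (grad (k := k) u q) (grad u q) with hN_def
  have hN : ContMDiffAt (𝓡 k) 𝓘(ℝ, ℝ) 2 N p := contMDiffAt_inner_grad (n := 2) hu hu
  have hYc : ContDiffAt ℝ 2 Y (e p) :=
    hG.contDiffAt_localGrad (n := 2) hy (contDiffAt_comp_symm_of_mem (n := 3) he hp hu)
  -- the gradient of `|∇u|²` is `2 ∇_{∇u} ∇u`
  have hgradN : localGrad (chartMetric e) (N ∘ e.symm)
      =ᶠ[𝓝 (e p)] fun z ↦ (2 : ℝ) • (covDerivOp Γ Y z (Y z)) := by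
    have h1 : ∀ᶠ z in 𝓝 (e p), ContMDiffAt (𝓡 k) 𝓘(ℝ, ℝ) 3 u (e.symm z) := by
      have h2 := e.continuousAt_symm hy
      rw [ContinuousAt, e.left_inv hp] at h2
      exact h2.eventually (eventually_contMDiffAt (n := 3) hu)
    filter_upwards [e.open_target.mem_nhds hy, h1] with z hz huz
    have hzs := e.map_target hz
    have hu2z : ContMDiffAt (𝓡 k) 𝓘(ℝ, ℝ) 2 u (e.symm z) := huz.of_le (by norm_num)
    have hNz : ContMDiffAt (𝓡 k) 𝓘(ℝ, ℝ) 1 N (e.symm z) :=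
      contMDiffAt_inner_grad (n := 1) hu2z hu2z
    refine hG.ext_apply hz fun w ↦ ?_
    obtain ⟨w, rfl⟩ := he.exists_coords_eq hzs w
    have h2 := mvfderiv_eq_fderiv_symm he hzs hNz w
    rw [e.right_inv hz] at h2
    rw [hG.apply_localGrad hz, ← h2, hN_def, mvfderiv_inner_grad hu2z hu2z, hess_symm hu2z,
      hess_eq_nablaGrad he hzs hu2z, coords_grad he hzs (huz.of_le (by norm_num)), e.right_inv hz,
      map_smul, FunLike.coe_smul, Pi.smul_apply, smul_eq_mul, two_mul]
    rfl
  have hAd : DifferentiableAt ℝ (fun z ↦ covDerivOp Γ Y z (Y z)) (e p) := by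
    obtain ⟨D, hD, -⟩ := hasFDerivAt_covDerivOp
      ((hG.contDiffAt_localChristoffel hy).differentiableAt (by simp)) hYc
    exact (hD.clm_apply (hYc.differentiableAt (by simp)).hasFDerivAt).differentiableAt
  have hΔN : bilinTrace (hess (k := k) N p)
      = 2 * traceCLM _ (covDerivOp Γ (fun z ↦ covDerivOp Γ Y z (Y z)) (e p)) := by
    rw [bilinTrace_hess he hp hN, nablaGrad, covDerivOp_congr hgradN, covDerivOp_const_smul _ _ hAd,
      map_smul, smul_eq_mul]
  have hΔu : ∀ᶠ q in 𝓝 p, bilinTrace (hess (k := k) u q) = traceCLM _ (covDerivOp Γ Y (e q)) := by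
    filter_upwards [e.open_source.mem_nhds hp, eventually_contMDiffAt (n := 2) hu2] with q hq hqu
      using bilinTrace_hess he hq hqu
  have hdΔ : mvfderiv (𝓡 k) (fun q ↦ bilinTrace (hess (k := k) u q)) p (grad u p)
      = fderiv ℝ (fun z ↦ traceCLM _ (covDerivOp Γ Y z)) (e p) (Y (e p)) := by
    rw [mvfderiv_eq_fderiv_comp he hp (((traceCLM _).contDiff.contDiffAt.comp _
      (contDiffAt_nablaGrad (n := 1) he hp hu)).differentiableAt (by simp)) hΔu,
      coords_grad he hp hu1]
    rfl
  have hmd : ∀ {F : X → ℝ}, ContMDiffAt (𝓡 k) 𝓘(ℝ, ℝ) 1 F p → MDifferentiableAt (𝓡 k) 𝓘(ℝ, ℝ) F p :=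
    fun hF ↦ hF.mdifferentiableAt (by simp)
  -- The drift in Δ_ψ u contributes two Hessians: ∇²ψ(∇u,∇u) completes Ric to Ric_ψ, and ∇²u(∇u,∇ψ)
  -- cancels the drift of Δ_ψ|∇u|².
  have hdΔψ : mvfderiv (𝓡 k) (weightedLaplacian (k := k) ψ u) p (grad (k := k) u p)
      = mvfderiv (𝓡 k) (fun q ↦ bilinTrace (hess (k := k) u q)) p (grad u p)
        - (hess ψ p (grad (k := k) u p) (grad u p) + hess u p (grad u p) (grad (k := k) ψ p)) := by
    rw [← mvfderiv_inner_grad hψ hu2 (grad (k := k) u p)]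
    have h := mvfderiv_sub (hmd (contMDiffAt_bilinTrace_hess (n := 1) hu))
      (hmd (contMDiffAt_inner_grad (n := 1) hψ hu2))
    exact DFunLike.congr_fun h _
  have hmain := trace_covDerivOp_self ((hG.contDiffAt_localChristoffel hy).differentiableAt
    (by simp)) (hG.localChristoffel_symm hy) hYc
  rw [hdΔψ, hdΔ, weightedLaplacian, hΔN, hmain, bilinNormSq_hess he hp hu2, weightedRicci,
    ricci_eq_trace he_def, coords_grad he hp hu1, real_inner_comm, inner_grad_left, hN_def,
    mvfderiv_inner_grad hu2 hu2, hess_symm hu2 (grad (k := k) ψ p)]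
  simp only [nablaGrad]
  ring

end Laplacian

/-! ### The volume measure in a chart -/

section Volume

variable {k : ℕ} {X : Type*} [TopologicalSpace X] [ChartedSpace (EuclideanSpace ℝ (Fin k)) X]
  [IsManifold (𝓡 k) ∞ X]
  [RiemannianBundle (fun x : X ↦ TangentSpace (𝓡 k) x)]
  [IsContMDiffRiemannianBundle (𝓡 k) ∞ (EuclideanSpace ℝ (Fin k))
    (fun x : X ↦ TangentSpace (𝓡 k) x)]
  {e e' : OpenPartialHomeomorph X (EuclideanSpace ℝ (Fin k))}

theorem gramMatrix_comp (B : EuclideanSpace ℝ (Fin k) →L[ℝ] EuclideanSpace ℝ (Fin k) →L[ℝ] ℝ)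
    {B' : EuclideanSpace ℝ (Fin k) →L[ℝ] EuclideanSpace ℝ (Fin k) →L[ℝ] ℝ}
    (L : EuclideanSpace ℝ (Fin k) →L[ℝ] EuclideanSpace ℝ (Fin k))
    (h : ∀ v w, B' v w = B (L v) (L w)) :
    (gramMatrix B').det = L.det ^ 2 * (gramMatrix B).det := by
  set b := (EuclideanSpace.basisFun (Fin k) ℝ).toBasis
  have hL : L.det = (LinearMap.toMatrix b b (L : _ →ₗ[ℝ] _)).det :=
    (LinearMap.det_toMatrix b _).symm
  have hM : gramMatrix B' = (LinearMap.toMatrix b b (L : _ →ₗ[ℝ] _)).transpose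
      * gramMatrix B * LinearMap.toMatrix b b (L : _ →ₗ[ℝ] _) := by
    ext i j
    rw [Matrix.mul_assoc]
    simp only [Matrix.mul_apply, Matrix.transpose_apply]
    simp only [gramMatrix, Matrix.of_apply, h]
    rw [bilin_eq_sum]
    refine Finset.sum_congr rfl fun a _ ↦ ?_
    rw [Finset.mul_sum]
    refine Finset.sum_congr rfl fun c _ ↦ ?_
    simp [b, LinearMap.toMatrix_apply, gramMatrix]
    ring
  rw [hM, Matrix.det_mul, Matrix.det_mul, Matrix.det_transpose, hL]
  ring

theorem det_gram_pos (he : IsSmoothChart e) {y : EuclideanSpace ℝ (Fin k)} (hy : y ∈ e.target) :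
    0 < (gram e y).det := by
  have hG := isLocalMetric_chartMetric he
  rw [← gramMatrix_chartMetric]
  exact (gramMatrix_posDef (hG.symm y hy) (hG.pos y hy)).det_pos

/-- The transition map is an isometry of the coordinate metrics, so the Gram determinants differ by
the squared Jacobian. -/
theorem sqrt_det_gram_comp (he : IsSmoothChart e) (he' : IsSmoothChart e')
    {y : EuclideanSpace ℝ (Fin k)} (hy : y ∈ e.target) (hy' : e.symm y ∈ e'.source) :
    √(gram e y).det = |(fderiv ℝ (e' ∘ e.symm) y).det| * √(gram e' (e' (e.symm y))).det := by
  have h : ∀ v w, chartMetric e y v w = chartMetric e' (e' (e.symm y))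
      (fderiv ℝ (e' ∘ e.symm) y v) (fderiv ℝ (e' ∘ e.symm) y w) := by
    intro v w
    have hc : ∀ v, fderiv ℝ (e' ∘ e.symm) y v = coords e' (e.symm y) (chartVec e y v) := by
      intro v
      have h1 := HasMFDerivAt.comp y (he'.mdifferentiable.mdifferentiableAt hy').hasMFDerivAt
        (he.mdifferentiable.mdifferentiableAt_symm hy).hasMFDerivAt
      have h2 := h1.mfderiv
      rw [mfderiv_eq_fderiv] at h2
      exact DFunLike.congr_fun h2 v
    rw [hc, hc, ← inner_eq_chartMetric he' hy', chartMetric_apply]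
  have h2 := gramMatrix_comp _ _ h
  rw [gramMatrix_chartMetric, gramMatrix_chartMetric] at h2
  rw [h2, Real.sqrt_mul (sq_nonneg _), Real.sqrt_sq_eq_abs]

/-- The density of the weighted volume in the chart `e`. -/
def chartDensity (e : OpenPartialHomeomorph X (EuclideanSpace ℝ (Fin k))) (ψ : X → ℝ)
    (y : EuclideanSpace ℝ (Fin k)) : ℝ :=
  √(gram e y).det * Real.exp (-ψ (e.symm y))

theorem continuousOn_sqrt_det_gram (he : IsSmoothChart e) :
    ContinuousOn (fun y ↦ √(gram e y).det) e.target := by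
  intro y hy
  have h := ((isLocalMetric_chartMetric he).hasFDerivAt_sqrt_det hy).continuousAt
  simp only [gramMatrix_chartMetric] at h
  exact h.continuousWithinAt

theorem continuousOn_chartDensity (he : IsSmoothChart e) {ψ : X → ℝ} (hψ : Continuous ψ) :
    ContinuousOn (chartDensity e ψ) e.target :=
  (continuousOn_sqrt_det_gram he).mul
    (Real.continuous_exp.comp_continuousOn (hψ.comp_continuousOn e.continuousOn_symm).neg)

variable [MeasurableSpace X] [BorelSpace X]

theorem aemeasurable_symm (e : OpenPartialHomeomorph X (EuclideanSpace ℝ (Fin k)))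
    (f : EuclideanSpace ℝ (Fin k) → ℝ≥0∞) :
    AEMeasurable e.symm ((volume.restrict e.target).withDensity f) :=
  (e.continuousOn_symm.aemeasurable e.open_target.measurableSet).mono_ac
    (withDensity_absolutelyContinuous _ _)

theorem measurableSet_target_inter (e : OpenPartialHomeomorph X (EuclideanSpace ℝ (Fin k)))
    {B : Set X} (hB : MeasurableSet B) : MeasurableSet (e.target ∩ e.symm ⁻¹' B) := by
  have h : e.target ∩ e.symm ⁻¹' B = Subtype.val '' ((fun y : e.target ↦ e.symm y) ⁻¹' B) := by
    ext y
    simp [and_comm]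
  rw [h]
  exact e.open_target.measurableSet.subtype_image
    ((continuousOn_iff_continuous_domRestrict.1 e.continuousOn_symm).measurable hB)

theorem map_symm_apply (e : OpenPartialHomeomorph X (EuclideanSpace ℝ (Fin k)))
    (f : EuclideanSpace ℝ (Fin k) → ℝ≥0∞) {B : Set X} (hB : MeasurableSet B) :
    ((volume.restrict e.target).withDensity f).map e.symm B
      = ∫⁻ y in e.target ∩ e.symm ⁻¹' B, f y := by
  rw [Measure.map_apply_of_aemeasurable (aemeasurable_symm e f) hB, withDensity_apply',
    Measure.restrict_restrict' e.open_target.measurableSet, inter_comm]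

theorem chartVolume_apply (e : OpenPartialHomeomorph X (EuclideanSpace ℝ (Fin k))) {B : Set X}
    (hB : MeasurableSet B) : chartVolume e B
      = ∫⁻ y in e.target ∩ e.symm ⁻¹' B, ENNReal.ofReal √(gram e y).det :=
  map_symm_apply e _ hB

/-- Change of variables along the transition map: its Jacobian is absorbed by the ratio of the
densities. -/
theorem chartVolume_apply_eq (he : IsSmoothChart e) (he' : IsSmoothChart e') {B : Set X}
    (hB : MeasurableSet B) (h : B ⊆ e.source) (h' : B ⊆ e'.source) :
    chartVolume e B = chartVolume e' B := by
  rw [chartVolume_apply e hB, chartVolume_apply e' hB]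
  have himg : e'.target ∩ e'.symm ⁻¹' B = (e' ∘ e.symm) '' (e.target ∩ e.symm ⁻¹' B) := by
    ext z
    simp only [mem_inter_iff, mem_preimage, mem_image, Function.comp]
    constructor
    · rintro ⟨hz, hzB⟩
      exact ⟨e (e'.symm z), ⟨e.map_source (h hzB), by rwa [e.left_inv (h hzB)]⟩,
        by rw [e.left_inv (h hzB), e'.right_inv hz]⟩
    · rintro ⟨y, ⟨-, hyB⟩, rfl⟩
      exact ⟨e'.map_source (h' hyB), by rwa [e'.left_inv (h' hyB)]⟩
  rw [himg, lintegral_image_eq_lintegral_abs_det_fderiv_mul volume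
    (measurableSet_target_inter e hB) (f' := fderiv ℝ (e' ∘ e.symm))]
  · refine setLIntegral_congr_fun (measurableSet_target_inter e hB) fun y hy ↦ ?_
    simp only [Function.comp]
    rw [sqrt_det_gram_comp he he' hy.1 (h' hy.2), ENNReal.ofReal_mul (abs_nonneg _)]
  · intro y hy
    have h1 : ContMDiffAt (𝓡 k) (𝓡 k) ∞ (e' ∘ e.symm) y :=
      ContMDiffAt.comp y (he'.contMDiffAt (h' hy.2)) (he.contMDiffAt_symm hy.1)
    exact ((contMDiffAt_iff_contDiffAt.1 h1).differentiableAt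
      (by simp)).hasFDerivAt.hasFDerivWithinAt
  · intro y hy z hz hyz
    have h1 := e'.injOn (h' hy.2) (h' hz.2) hyz
    exact e.symm.injOn hy.1 hz.1 h1

theorem chartVolume_compl_source (e : OpenPartialHomeomorph X (EuclideanSpace ℝ (Fin k))) :
    chartVolume e e.sourceᶜ = 0 := by
  rw [chartVolume_apply e e.open_source.measurableSet.compl,
    show e.target ∩ e.symm ⁻¹' e.sourceᶜ = ∅ from ?_]
  · simp
  · ext y
    simp only [mem_inter_iff, mem_preimage, mem_compl_iff, mem_empty_iff_false, iff_false, not_and,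
      not_not]
    exact fun hy ↦ e.map_target hy

variable [SecondCountableTopology X]

/-- The supremum is compared with an explicit gluing `μ`: countably many chart domains cover `X`,
they are made disjoint, and the chart measures are summed over the pieces. As chart measures agree
on overlaps, `μ` coincides with each of them on its chart domain, so `μ` dominates the supremum.
Conversely each piece of `μ` is part of one chart measure. -/
theorem riemannianVolume_apply_of_subset (he : IsSmoothChart e) {B : Set X} (hB : MeasurableSet B)
    (h : B ⊆ e.source) : riemannianVolume (k := k) X B = chartVolume e B := by
  rcases isEmpty_or_nonempty X with hX | hX
  · rw [Set.eq_empty_of_isEmpty B, measure_empty, measure_empty]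
  obtain ⟨s, hs, hsu⟩ := TopologicalSpace.countable_cover_nhds
    (f := fun x : X ↦ (chartAt (EuclideanSpace ℝ (Fin k)) x).source)
    fun x ↦ (chartAt _ x).open_source.mem_nhds (mem_chart_source _ x)
  have hsne : s.Nonempty := by
    by_contra hne
    rw [not_nonempty_iff_eq_empty] at hne
    simp only [hne, mem_empty_iff_false, iUnion_of_empty, iUnion_empty] at hsu
    exact empty_ne_univ hsu
  obtain ⟨c, rfl⟩ := hs.exists_eq_range hsne
  set E : ℕ → OpenPartialHomeomorph X (EuclideanSpace ℝ (Fin k)) := fun n ↦ chartAt _ (c n)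
  have hE : ∀ n, IsSmoothChart (E n) := fun n ↦ isSmoothChart_chartAt _
  set A : ℕ → Set X := disjointed fun n ↦ (E n).source
  have hAm : ∀ n, MeasurableSet (A n) :=
    fun n ↦ MeasurableSet.disjointed (fun i ↦ (E i).open_source.measurableSet) n
  have hAs : ∀ n, A n ⊆ (E n).source := fun n ↦ disjointed_subset _ n
  have hAd : Pairwise (Function.onFun Disjoint A) := disjoint_disjointed _
  have hAu : ⋃ n, A n = univ := by
    rw [iUnion_disjointed, ← hsu]
    simp [E]
  set μ : Measure X := Measure.sum fun n ↦ (chartVolume (E n)).restrict (A n) with hμ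
  have hsplit : ∀ (m : Measure X) {B : Set X}, MeasurableSet B → m B = ∑' n, m (B ∩ A n) := by
    intro m B hB
    rw [← measure_iUnion (fun i j hij ↦ (hAd hij).mono inter_subset_right inter_subset_right)
      (fun n ↦ hB.inter (hAm n)), ← inter_iUnion, hAu, inter_univ]
  have hμB : ∀ {B : Set X}, MeasurableSet B → μ B = ∑' n, chartVolume (E n) (B ∩ A n) := by
    intro B hB
    rw [hμ, Measure.sum_apply _ hB]
    exact tsum_congr fun n ↦ Measure.restrict_apply hB
  have key : ∀ {e : OpenPartialHomeomorph X (EuclideanSpace ℝ (Fin k))}, IsSmoothChart e →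
      ∀ {B : Set X}, MeasurableSet B → B ⊆ e.source → μ B = chartVolume e B := by
    intro e he B hB hBe
    rw [hμB hB, hsplit _ hB]
    exact tsum_congr fun n ↦ chartVolume_apply_eq (hE n) he (hB.inter (hAm n))
      (inter_subset_right.trans (hAs n)) (inter_subset_left.trans hBe)
  have hle : riemannianVolume (k := k) X ≤ μ := by
    refine iSup₂_le fun e' he' ↦ Measure.le_iff.2 fun B hB ↦ ?_
    have hs' : IsSmoothChart e' :=
      isSmoothChart_of_mem_maximalAtlas (IsManifold.subset_maximalAtlas he')
    -- The measure of a chart gives no mass to the complement of its domain, so only the part of `B`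
    -- inside matters.
    calc chartVolume e' B ≤ chartVolume e' (B ∩ e'.source) + chartVolume e' e'.sourceᶜ := by
          refine (measure_mono fun x hx ↦ ?_).trans (measure_union_le _ _)
          by_cases hxe : x ∈ e'.source
          · exact Or.inl ⟨hx, hxe⟩
          · exact Or.inr hxe
      _ = μ (B ∩ e'.source) := by
          rw [chartVolume_compl_source, add_zero,
            key hs' (hB.inter e'.open_source.measurableSet) inter_subset_right]
      _ ≤ μ B := measure_mono inter_subset_left
  have hge : μ ≤ riemannianVolume (k := k) X := by
    refine Measure.le_iff.2 fun B hB ↦ ?_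
    rw [hμB hB, hsplit (riemannianVolume (k := k) X) hB]
    refine ENNReal.tsum_le_tsum fun n ↦ ?_
    have h1 : chartVolume (E n) ≤ riemannianVolume (k := k) X :=
      le_iSup₂ (f := fun (e : OpenPartialHomeomorph X (EuclideanSpace ℝ (Fin k)))
        (_ : e ∈ atlas (EuclideanSpace ℝ (Fin k)) X) ↦ chartVolume e) (E n) (chart_mem_atlas _ _)
    exact h1 _
  rw [le_antisymm hle hge, key he hB h]

theorem riemannianVolume_restrict_source (he : IsSmoothChart e) :
    (riemannianVolume (k := k) X).restrict e.source = chartVolume e := by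
  refine Measure.ext fun B hB ↦ ?_
  rw [Measure.restrict_apply hB, riemannianVolume_apply_of_subset he
    (hB.inter e.open_source.measurableSet) inter_subset_right]
  refine le_antisymm (measure_mono inter_subset_left) ?_
  calc chartVolume e B ≤ chartVolume e (B ∩ e.source) + chartVolume e e.sourceᶜ := by
        refine (measure_mono fun x hx ↦ ?_).trans (measure_union_le _ _)
        by_cases hxe : x ∈ e.source
        · exact Or.inl ⟨hx, hxe⟩
        · exact Or.inr hxe
    _ = _ := by rw [chartVolume_compl_source, add_zero]

theorem weightedVolume_restrict_source (he : IsSmoothChart e) {ψ : X → ℝ} (hψ : Continuous ψ) :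
    (weightedVolume (k := k) ψ).restrict e.source = ((volume.restrict e.target).withDensity
      fun y ↦ ENNReal.ofReal (chartDensity e ψ y)).map e.symm := by
  have hρ : Measurable fun x ↦ ENNReal.ofReal (Real.exp (-ψ x)) :=
    (Real.continuous_exp.comp hψ.neg).measurable.ennreal_ofReal
  rw [weightedVolume, restrict_withDensity e.open_source.measurableSet,
    riemannianVolume_restrict_source he]
  refine Measure.ext fun B hB ↦ ?_
  have hT := measurableSet_target_inter e hB
  have hσ : AEMeasurable (fun y ↦ ENNReal.ofReal √(gram e y).det) (volume.restrict e.target) :=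
    ((continuousOn_sqrt_det_gram he).aemeasurable e.open_target.measurableSet).ennreal_ofReal
  have hρ' : AEMeasurable (fun y ↦ B.indicator (fun x ↦ ENNReal.ofReal (Real.exp (-ψ x)))
      (e.symm y)) (volume.restrict e.target) :=
    (hρ.indicator hB).comp_aemeasurable (e.continuousOn_symm.aemeasurable
        e.open_target.measurableSet)
  rw [withDensity_apply _ hB, map_symm_apply e _ hB, ← lintegral_indicator hB, chartVolume,
    lintegral_map' (hρ.indicator hB).aemeasurable (aemeasurable_symm e _),
    lintegral_withDensity_eq_lintegral_mul₀ hσ hρ', ← lintegral_indicator e.open_target.measurableSet,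
    ← lintegral_indicator hT]
  refine lintegral_congr fun y ↦ ?_
  by_cases hy : y ∈ e.target
  · by_cases hyB : e.symm y ∈ B
    · rw [indicator_of_mem hy, indicator_of_mem (show y ∈ e.target ∩ e.symm ⁻¹' B from ⟨hy, hyB⟩)]
      simp only [Pi.mul_apply]
      rw [indicator_of_mem hyB, chartDensity, ENNReal.ofReal_mul (Real.sqrt_nonneg _)]
    · rw [indicator_of_mem hy, indicator_of_notMem (fun h ↦ hyB h.2)]
      simp only [Pi.mul_apply]
      rw [indicator_of_notMem hyB, mul_zero]
  · rw [indicator_of_notMem hy, indicator_of_notMem (fun h ↦ hy h.1)]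

/-- The integral, in the chart `e`, of a function vanishing outside the domain of `e`. -/
theorem integral_weightedVolume_eq (he : IsSmoothChart e) {ψ : X → ℝ} (hψ : Continuous ψ)
    {F : X → ℝ} (hF : ∀ x ∉ e.source, F x = 0)
    (hFm : AEStronglyMeasurable F (weightedVolume (k := k) ψ)) :
    ∫ x, F x ∂(weightedVolume (k := k) ψ)
      = ∫ y in e.target, chartDensity e ψ y * F (e.symm y) := by
  rw [← setIntegral_eq_integral_of_forall_compl_eq_zero (s := e.source) hF]
  have hFm' := hFm.restrict (s := e.source)
  rw [weightedVolume_restrict_source he hψ] at hFm' ⊢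
  rw [integral_map (aemeasurable_symm e _) hFm', integral_withDensity_eq_integral_toReal_smul₀]
  · refine setIntegral_congr_fun e.open_target.measurableSet fun y _ ↦ ?_
    simp only [smul_eq_mul]
    rw [ENNReal.toReal_ofReal
      (show 0 ≤ chartDensity e ψ y from mul_nonneg (Real.sqrt_nonneg _) (Real.exp_nonneg _))]
  · exact ((continuousOn_chartDensity he hψ).aemeasurable
      e.open_target.measurableSet).ennreal_ofReal
  · exact Eventually.of_forall fun _ ↦ ENNReal.ofReal_lt_top

/-- Each point has a neighbourhood whose image lies in a compact part of a chart target, where the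
continuous density is bounded. -/
theorem isLocallyFiniteMeasure_weightedVolume {ψ : X → ℝ} (hψ : Continuous ψ) :
    IsLocallyFiniteMeasure (weightedVolume (k := k) ψ) := by
  refine ⟨fun p ↦ ?_⟩
  set e := chartAt (EuclideanSpace ℝ (Fin k)) p
  have he : IsSmoothChart e := isSmoothChart_chartAt p
  have hp : p ∈ e.source := mem_chart_source _ p
  obtain ⟨K, hK, hKn, hKt⟩ : ∃ K, IsCompact K ∧ K ∈ 𝓝 (e p) ∧ K ⊆ e.target := by
    obtain ⟨K, hKn, hKt, hK⟩ := LocallyCompactSpace.local_compact_nhds (e p) e.target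
      (e.open_target.mem_nhds (e.map_source hp))
    exact ⟨K, hK, hKn, hKt⟩
  have hO : IsOpen (e.source ∩ e ⁻¹' interior K) :=
    e.continuousOn.isOpen_inter_preimage e.open_source isOpen_interior
  refine ⟨e.source ∩ e ⁻¹' interior K, hO.mem_nhds ⟨hp, mem_interior_iff_mem_nhds.2 hKn⟩, ?_⟩
  rw [← Measure.restrict_eq_self _ (inter_subset_left : e.source ∩ e ⁻¹' interior K ⊆ e.source),
    weightedVolume_restrict_source he hψ, map_symm_apply e _ hO.measurableSet]
  refine (lintegral_mono_set (t := K) ?_).trans_lt ?_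
  · rintro y ⟨hy, -, hy2⟩
    rw [mem_preimage, e.right_inv hy] at hy2
    exact interior_subset hy2
  · have h1 : IntegrableOn (chartDensity e ψ) K :=
      ((continuousOn_chartDensity he hψ).mono hKt).integrableOn_compact hK
    exact h1.lintegral_lt_top

end Volume

/-! ### The divergence theorem in a half space -/

section HalfSpace

variable {n : ℕ}

/-- The point of `ℝⁿ⁺¹` with first coordinates `u` and last coordinate `a`. -/
def slicePoint (u : EuclideanSpace ℝ (Fin n)) (a : ℝ) : EuclideanSpace ℝ (Fin (n + 1)) :=
  WithLp.toLp 2 (Fin.snoc (α := fun _ ↦ ℝ) (fun i ↦ u i) a)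

@[simp] theorem slicePoint_last (u : EuclideanSpace ℝ (Fin n)) (a : ℝ) :
    slicePoint u a (Fin.last n) = a := by
  simp [slicePoint]

@[simp] theorem slicePoint_castSucc (u : EuclideanSpace ℝ (Fin n)) (a : ℝ) (i : Fin n) :
    slicePoint u a i.castSucc = u i := by
  simp [slicePoint]

/-- The divergence theorem is applied on a box whose upper face in the last direction is the slice
at height `a` and whose other faces lie where `F` vanishes. The box stops at the slice because `F`
is differentiable only up to there. -/
theorem integral_divergence_halfSpace
    {F : EuclideanSpace ℝ (Fin (n + 1)) → EuclideanSpace ℝ (Fin (n + 1))} {R a : ℝ}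
    (hR : ∀ y, R ≤ ‖y‖ → F y = 0)
    (hF : ∀ y : EuclideanSpace ℝ (Fin (n + 1)), y (Fin.last n) ≤ a → ContDiffAt ℝ 1 F y) :
    ∫ y in {y : EuclideanSpace ℝ (Fin (n + 1)) | y (Fin.last n) < a}, traceCLM _ (fderiv ℝ F y)
      = ∫ u : EuclideanSpace ℝ (Fin n), F (slicePoint u a) (Fin.last n) := by
  -- Half-width of the box: larger than `R`, so that `F` vanishes on the far faces, and larger than
  -- |a|, so that the slice meets the box.
  set Q : ℝ := |R| + |a| + 1 with hQ
  have hRQ : R < Q := by linarith [le_abs_self R, abs_nonneg a]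
  have haQ : -Q < a := by linarith [neg_abs_le a, abs_nonneg R]
  have haQ' : a < Q := by linarith [le_abs_self a, abs_nonneg R]
  have hQ0 : 0 < Q := by positivity
  let L := EuclideanSpace.equiv (Fin (n + 1)) ℝ
  have hL : ∀ x i, L.symm x i = x i := fun x i ↦ rfl
  have hnorm : ∀ (y : EuclideanSpace ℝ (Fin (n + 1))) i, |y i| ≤ ‖y‖ := fun y i ↦
    PiLp.norm_apply_le y i
  have hzero : ∀ (y : EuclideanSpace ℝ (Fin (n + 1))) i, Q ≤ |y i| → F y = 0 :=
    fun y i hy ↦ hR y (hRQ.le.trans (hy.trans (hnorm y i)))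
  have hdzero : ∀ (y : EuclideanSpace ℝ (Fin (n + 1))) i, Q ≤ |y i| → fderiv ℝ F y = 0 := by
    intro y i hy
    have h1 : F =ᶠ[𝓝 y] fun _ ↦ 0 := by
      filter_upwards [(isOpen_lt continuous_const continuous_norm).mem_nhds
        (show R < ‖y‖ from hRQ.trans_le (hy.trans (hnorm y i)))] with z hz
      exact hR z (le_of_lt hz)
    rw [h1.fderiv_eq]
    simp
  let lo : Fin (n + 1) → ℝ := fun _ ↦ -Q
  let hi : Fin (n + 1) → ℝ := Fin.snoc (α := fun _ ↦ ℝ) (fun _ ↦ Q) a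
  have hi_last : hi (Fin.last n) = a := by simp [hi]
  have hi_cast : ∀ i : Fin n, hi i.castSucc = Q := fun i ↦ by simp [hi]
  have hlohi : ∀ i, lo i < hi i := by
    intro i
    refine Fin.lastCases ?_ (fun i ↦ ?_) i
    · rw [hi_last]; exact haQ
    · rw [hi_cast]; show -Q < Q; linarith
  let f : (Fin (n + 1) → ℝ) → Fin (n + 1) → ℝ := fun x ↦ L (F (L.symm x))
  let f' : (Fin (n + 1) → ℝ) → (Fin (n + 1) → ℝ) →L[ℝ] Fin (n + 1) → ℝ := fun x ↦
    (L : _ →L[ℝ] _).comp ((fderiv ℝ F (L.symm x)).comp (L.symm : _ →L[ℝ] _))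
  have hle : ∀ x ∈ Icc lo hi, L.symm x (Fin.last n) ≤ a := fun x hx ↦ by
    rw [hL, ← hi_last]; exact hx.2 _
  have hfd : ∀ x, L.symm x (Fin.last n) ≤ a → HasFDerivAt f (f' x) x := by
    intro x hx
    exact L.hasFDerivAt.comp x
      (((hF _ hx).differentiableAt (by simp)).hasFDerivAt.comp x L.symm.hasFDerivAt)
  have hdiv : ∀ x, ∑ i, f' x (Pi.single i 1) i = traceCLM _ (fderiv ℝ F (L.symm x)) := by
    intro x
    rw [traceCLM_eq_sum]
    rfl
  have hint : IntegrableOn (fun x ↦ ∑ i, f' x (Pi.single i 1) i) (Icc lo hi) := by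
    refine ContinuousOn.integrableOn_compact isCompact_Icc fun x hx ↦ ?_
    simp only [hdiv]
    have h1 : ContinuousAt (fderiv ℝ F) (L.symm x) :=
      ((hF _ (hle x hx)).fderiv_right (m := 0) (by simp)).continuousAt
    exact ((traceCLM _).continuous.continuousAt.comp
      (ContinuousAt.comp (f := L.symm) (x := x) h1 L.symm.continuous.continuousAt)).continuousWithinAt
  have key := integral_divergence_of_hasFDerivAt_off_countable lo hi (fun i ↦ (hlohi i).le) f f' ∅
    countable_empty (fun x hx ↦ (hfd x (hle x hx)).continuousAt.continuousWithinAt)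
    (fun x hx ↦ hfd x (by
      rw [hL, ← hi_last]; exact (hx.1 _ (mem_univ _)).2.le)) hint
  have hpre : L.symm ⁻¹' {y : EuclideanSpace ℝ (Fin (n + 1)) | y (Fin.last n) < a}
      = {x | x (Fin.last n) < a} := rfl
  have hms : MeasurableSet {x : Fin (n + 1) → ℝ | x (Fin.last n) < a} :=
    measurableSet_lt (measurable_pi_apply _) measurable_const
  have hlhs : ∫ y in {y : EuclideanSpace ℝ (Fin (n + 1)) | y (Fin.last n) < a},
      traceCLM _ (fderiv ℝ F y) = ∫ x in Icc lo hi, ∑ i, f' x (Pi.single i 1) i := by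
    rw [← (EuclideanSpace.volume_preserving_symm_measurableEquiv_toLp
      (Fin (n + 1))).symm.setIntegral_preimage_emb (MeasurableEquiv.measurableEmbedding _)]
    simp only [hdiv]
    -- The open box is used because it is contained in the strict half space; its boundary is a null
    -- set.
    have hae : (univ.pi fun i ↦ Ioo (lo i) (hi i)) =ᵐ[volume] Icc lo hi :=
      Measure.univ_pi_Ioo_ae_eq_Icc
    rw [← setIntegral_congr_set hae]
    refine setIntegral_eq_of_subset_of_forall_sdiff_eq_zero (E := ℝ) hms ?_ ?_
    · intro x hx
      have := (hx (Fin.last n) (mem_univ _)).2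
      rwa [hi_last] at this
    · rintro x ⟨hx, hx'⟩
      rw [mem_univ_pi] at hx'
      push Not at hx'
      obtain ⟨i, hi'⟩ := hx'
      have : Q ≤ |L.symm x i| := by
        rw [hL]
        by_contra hcon
        rw [not_le, abs_lt] at hcon
        refine hi' ⟨hcon.1, ?_⟩
        revert hcon
        refine Fin.lastCases (fun _ ↦ ?_) (fun i h ↦ ?_) i
        · rw [hi_last]; exact hx
        · rw [hi_cast]; exact h.2
      show traceCLM _ (fderiv ℝ F (L.symm x)) = 0
      rw [hdzero _ i this, map_zero]
  have hface0 : ∀ (i : Fin (n + 1)) (c : ℝ) (x : Fin n → ℝ), Q ≤ |c| →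
      f (i.insertNth (α := fun _ ↦ ℝ) c x) i = 0 := by
    intro i c x hc
    have : F (L.symm (i.insertNth (α := fun _ ↦ ℝ) c x)) = 0 := by
      refine hzero _ i ?_
      rw [hL, Fin.insertNth_apply_same]
      exact hc
    simp only [f, this, map_zero, Pi.zero_apply]
  have hQabs : Q ≤ |Q| := le_abs_self Q
  have hQabs' : Q ≤ |-Q| := by rw [abs_neg]; exact hQabs
  rw [hlhs, key, Finset.sum_eq_single (Fin.last n)]
  -- In the last direction the lower face contributes nothing, and the upper one is the slice
  -- integral, extended to the whole hyperplane by vanishing.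
  · have h0 : ∀ x : Fin n → ℝ, f ((Fin.last n).insertNth (α := fun _ ↦ ℝ) (lo (Fin.last n)) x)
        (Fin.last n) = 0 := fun x ↦ hface0 _ _ _ hQabs'
    simp only [h0, integral_zero, sub_zero]
    rw [setIntegral_eq_integral_of_forall_compl_eq_zero, hi_last,
      ← (EuclideanSpace.volume_preserving_symm_measurableEquiv_toLp
        (Fin n)).symm.integral_comp (MeasurableEquiv.measurableEmbedding _)]
    · refine integral_congr_ae (Eventually.of_forall fun x ↦ ?_)
      simp only [Fin.insertNth_last']
      rfl
    · intro x hx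
      rw [mem_Icc, not_and_or, Pi.le_def, Pi.le_def] at hx
      push Not at hx
      have : ∃ i, Q ≤ |x i| := by
        rcases hx with ⟨i, hi'⟩ | ⟨i, hi'⟩
        · refine ⟨i, ?_⟩
          simp only [Function.comp, lo] at hi'
          rw [le_abs]; right; linarith
        · refine ⟨i, ?_⟩
          simp only [Function.comp, Fin.succAbove_last, hi_cast] at hi'
          rw [le_abs]; left; linarith
      obtain ⟨i, hi'⟩ := this
      have : F (L.symm ((Fin.last n).insertNth (α := fun _ ↦ ℝ) (hi (Fin.last n)) x)) = 0 := by
        refine hzero _ i.castSucc ?_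
        rw [hL, Fin.insertNth_last', Fin.snoc_castSucc]
        exact hi'
      simp only [f, this, map_zero, Pi.zero_apply]
  · intro i _ hi'
    obtain ⟨j, rfl⟩ := Fin.exists_castSucc_eq.2 hi'
    have h0 : ∀ x : Fin n → ℝ, f (j.castSucc.insertNth (α := fun _ ↦ ℝ) (lo j.castSucc) x)
        j.castSucc = 0 := fun x ↦ hface0 _ _ _ hQabs'
    have h1 : ∀ x : Fin n → ℝ, f (j.castSucc.insertNth (α := fun _ ↦ ℝ) (hi j.castSucc) x)
        j.castSucc = 0 := fun x ↦ hface0 _ _ _ (by rw [hi_cast]; exact hQabs)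
    simp only [h0, h1, integral_zero, sub_zero]
  · simp

end HalfSpace

/-! ### Green's formula in a chart -/

section Green

variable {k : ℕ} {X : Type*} [TopologicalSpace X] [ChartedSpace (EuclideanSpace ℝ (Fin k)) X]
  [IsManifold (𝓡 k) ∞ X]
  [RiemannianBundle (fun x : X ↦ TangentSpace (𝓡 k) x)]
  [IsContMDiffRiemannianBundle (𝓡 k) ∞ (EuclideanSpace ℝ (Fin k))
    (fun x : X ↦ TangentSpace (𝓡 k) x)]
  {e : OpenPartialHomeomorph X (EuclideanSpace ℝ (Fin k))} {ψ u v : X → ℝ}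

theorem traceCLM_smulRight (l : EuclideanSpace ℝ (Fin k) →L[ℝ] ℝ) (w : EuclideanSpace ℝ (Fin k)) :
    traceCLM _ (l.smulRight w) = l w := by
  rw [traceCLM_eq_sum]
  conv_rhs => rw [← sum_smul_stdVec w, map_sum]
  refine Finset.sum_congr rfl fun i _ ↦ ?_
  simp [mul_comm]

/-- The integrand `u Δ_ψ v + ⟨∇u, ∇v⟩` of Green's formula. -/
def greenIntegrand (ψ u v : X → ℝ) (p : X) : ℝ :=
  u p * weightedLaplacian (k := k) ψ v p + inner ℝ (grad (k := k) u p) (grad v p)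

/-- The coordinate expression of the vector density `u ∇v`. -/
def greenField (e : OpenPartialHomeomorph X (EuclideanSpace ℝ (Fin k))) (ψ u v : X → ℝ)
    (y : EuclideanSpace ℝ (Fin k)) : EuclideanSpace ℝ (Fin k) :=
  (chartDensity e ψ y * u (e.symm y)) • localGrad (chartMetric e) (v ∘ e.symm) y

theorem contDiffAt_sqrt_det_gram (he : IsSmoothChart e) {y : EuclideanSpace ℝ (Fin k)}
    (hy : y ∈ e.target) : ContDiffAt ℝ 1 (fun z ↦ √(gram e z).det) y := by
  have h1 : ContDiffAt ℝ 1 (fun z ↦ (gram e z).det) y := by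
    simp only [Matrix.det_apply]
    refine ContDiffAt.sum fun σ _ ↦ ContDiffAt.const_smul _ (contDiffAt_prod fun i _ ↦ ?_)
    exact ((contDiffOn_gram he _ _).contDiffAt (e.open_target.mem_nhds hy)).of_le (by simp)
  exact h1.sqrt (det_gram_pos he hy).ne'

theorem contDiffAt_chartDensity (he : IsSmoothChart e) {y : EuclideanSpace ℝ (Fin k)}
    (hy : y ∈ e.target) (hψ : ContMDiff (𝓡 k) 𝓘(ℝ, ℝ) ∞ ψ) : ContDiffAt ℝ 1 (chartDensity e ψ) y :=
  (contDiffAt_sqrt_det_gram he hy).mul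
    (contDiffAt_comp_symm (n := 1) he hy (hψ.contMDiffAt.of_le (by simp))).neg.exp

theorem contDiffAt_greenField (he : IsSmoothChart e) (hψ : ContMDiff (𝓡 k) 𝓘(ℝ, ℝ) ∞ ψ) {p : X}
    (hp : p ∈ e.source) (hu : ContMDiffAt (𝓡 k) 𝓘(ℝ, ℝ) 1 u p)
    (hv : ContMDiffAt (𝓡 k) 𝓘(ℝ, ℝ) 2 v p) : ContDiffAt ℝ 1 (greenField e ψ u v) (e p) :=
  ((contDiffAt_chartDensity he (e.map_source hp) hψ).mul
    (contDiffAt_comp_symm_of_mem (n := 1) he hp hu)).smul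
    ((isLocalMetric_chartMetric he).contDiffAt_localGrad (n := 1) (e.map_source hp)
      (contDiffAt_comp_symm_of_mem (n := 2) he hp hv))

theorem inner_grad_eq_fderiv (he : IsSmoothChart e) {p : X} (hp : p ∈ e.source)
    (hu : ContMDiffAt (𝓡 k) 𝓘(ℝ, ℝ) 1 u p) (hv : ContMDiffAt (𝓡 k) 𝓘(ℝ, ℝ) 1 v p) :
    inner ℝ (grad (k := k) u p) (grad v p)
      = fderiv ℝ (u ∘ e.symm) (e p) (localGrad (chartMetric e) (v ∘ e.symm) (e p)) := by
  rw [inner_grad_left, mvfderiv_eq_fderiv_symm he hp hu, coords_grad he hp hv]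

/-- The derivative of √det g supplies the Christoffel trace that completes the coordinate divergence
of ∇v to Δv, the derivative of e^{-ψ} supplies the drift term, and the derivative of `u` supplies
⟨∇u,∇v⟩. -/
theorem traceCLM_fderiv_greenField (he : IsSmoothChart e) (hψ : ContMDiff (𝓡 k) 𝓘(ℝ, ℝ) ∞ ψ) {p : X}
    (hp : p ∈ e.source) (hu : ContMDiffAt (𝓡 k) 𝓘(ℝ, ℝ) 1 u p)
    (hv : ContMDiffAt (𝓡 k) 𝓘(ℝ, ℝ) 2 v p) :
    traceCLM _ (fderiv ℝ (greenField e ψ u v) (e p))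
      = chartDensity e ψ (e p) * greenIntegrand (k := k) ψ u v p := by
  have hG := isLocalMetric_chartMetric he
  have hp' := e.map_source hp
  have hv1 : ContMDiffAt (𝓡 k) 𝓘(ℝ, ℝ) 1 v p := hv.of_le (by norm_num)
  have hψ1 : ContMDiffAt (𝓡 k) 𝓘(ℝ, ℝ) 1 ψ p := hψ.contMDiffAt.of_le (by simp)
  have hY : HasFDerivAt (localGrad (chartMetric e) (v ∘ e.symm))
      (fderiv ℝ (localGrad (chartMetric e) (v ∘ e.symm)) (e p)) (e p) :=
    ((hG.contDiffAt_localGrad (n := 1) hp' (contDiffAt_comp_symm_of_mem (n := 2) he hp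
      hv)).differentiableAt (by simp)).hasFDerivAt
  have hu' : HasFDerivAt (fun y ↦ u (e.symm y)) (fderiv ℝ (u ∘ e.symm) (e p)) (e p) :=
    ((contDiffAt_comp_symm_of_mem (n := 1) he hp hu).differentiableAt (by simp)).hasFDerivAt
  have hψ' : HasFDerivAt (fun y ↦ ψ (e.symm y)) (fderiv ℝ (ψ ∘ e.symm) (e p)) (e p) :=
    ((contDiffAt_comp_symm_of_mem (n := 1) he hp hψ1).differentiableAt (by simp)).hasFDerivAt
  have hσ := hG.hasFDerivAt_sqrt_det hp'
  simp only [gramMatrix_chartMetric] at hσ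
  have hD : HasFDerivAt (chartDensity e ψ) _ (e p) := hσ.mul hψ'.neg.exp
  have h := (hD.mul hu').smul hY
  have h1 : fderiv ℝ (greenField e ψ u v) (e p) = _ := h.fderiv
  rw [h1, map_add, map_smul, greenIntegrand, weightedLaplacian, bilinTrace_hess he hp hv,
    inner_grad_eq_fderiv he hp hu hv1, inner_grad_eq_fderiv he hp hψ1 hv1, nablaGrad, covDerivOp,
    map_add, traceCLM_smulRight]
  simp only [add_apply, FunLike.coe_smul, Pi.smul_apply, smul_eq_mul, chartDensity, e.left_inv hp,
    ContinuousLinearMap.comp_apply, neg_apply, Pi.mul_apply, Pi.neg_apply]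
  ring

theorem grad_eq_zero_of_eventuallyEq {p : X} (h : u =ᶠ[𝓝 p] fun _ ↦ 0) : grad (k := k) u p = 0 := by
  have h1 : mvfderiv (𝓡 k) u p = 0 := by
    have h2 := h.mfderiv_eq (I := 𝓡 k) (I' := 𝓘(ℝ, ℝ))
    rw [mfderiv_const] at h2
    exact h2
  rw [grad, h1, map_zero]

theorem greenIntegrand_eq_zero {p : X} (h : u =ᶠ[𝓝 p] fun _ ↦ 0) :
    greenIntegrand (k := k) ψ u v p = 0 := by
  rw [greenIntegrand, grad_eq_zero_of_eventuallyEq h, h.self_of_nhds, zero_mul, inner_zero_left,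
    add_zero]

theorem continuousAt_greenIntegrand (hψ : ContMDiff (𝓡 k) 𝓘(ℝ, ℝ) ∞ ψ) {p : X}
    (hu : ContMDiffAt (𝓡 k) 𝓘(ℝ, ℝ) 1 u p) (hv : ContMDiffAt (𝓡 k) 𝓘(ℝ, ℝ) 2 v p) :
    ContinuousAt (greenIntegrand (k := k) ψ u v) p :=
  (hu.continuousAt.mul (contMDiffAt_weightedLaplacian (n := 0) (hψ.contMDiffAt.of_le (by simp))
    hv).continuousAt).add
      (contMDiffAt_inner_grad (n := 0) hu (hv.of_le (by norm_num))).continuousAt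

end Green

/-! ### Green's formula for functions supported in one chart -/

section GreenChart

variable {n : ℕ} {X : Type*} [TopologicalSpace X] [T2Space X]
  [ChartedSpace (EuclideanSpace ℝ (Fin (n + 1))) X]
  [IsManifold (𝓡 (n + 1)) ∞ X]
  [RiemannianBundle (fun x : X ↦ TangentSpace (𝓡 (n + 1)) x)]
  [IsContMDiffRiemannianBundle (𝓡 (n + 1)) ∞ (EuclideanSpace ℝ (Fin (n + 1)))
    (fun x : X ↦ TangentSpace (𝓡 (n + 1)) x)]
  [MeasurableSpace X] [BorelSpace X] [SecondCountableTopology X]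
  {e : OpenPartialHomeomorph X (EuclideanSpace ℝ (Fin (n + 1)))} {ψ u v : X → ℝ}

/-- Green's formula in a chart for the part of the domain lying below the slice `{yₙ = a}`. -/
theorem integral_greenIntegrand_chart (he : IsSmoothChart e)
    (hψ : ContMDiff (𝓡 (n + 1)) 𝓘(ℝ, ℝ) ∞ ψ) {Ω K : Set X} (hΩ : MeasurableSet Ω) {a : ℝ}
    (hK : IsCompact K) (hKe : K ⊆ e.source) (hKΩ : ∀ x ∈ K, x ∈ Ω ↔ e x (Fin.last n) < a)
    (huK : ∀ x ∉ K, u x = 0)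
    (hu : ∀ x ∈ K, e x (Fin.last n) ≤ a → ContMDiffAt (𝓡 (n + 1)) 𝓘(ℝ, ℝ) 1 u x)
    (hv : ∀ x ∈ K, e x (Fin.last n) ≤ a → ContMDiffAt (𝓡 (n + 1)) 𝓘(ℝ, ℝ) 2 v x) :
    ∫ x in Ω, greenIntegrand (k := n + 1) ψ u v x ∂(weightedVolume (k := n + 1) ψ)
      = ∫ z : EuclideanSpace ℝ (Fin n),
          (e '' K).indicator (greenField e ψ u v) (slicePoint z a) (Fin.last n) := by
  have hKc : IsCompact (e '' K) := hK.image_of_continuousOn (e.continuousOn.mono hKe)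
  -- The field is extended by zero to all of ℝⁿ⁺¹. As `u` vanishes off `K`, this does not change it
  -- on the chart target, so no regularity is lost at the edge of `e '' K`.
  set F := (e '' K).indicator (greenField e ψ u v) with hF
  have hu0 : ∀ x ∉ K, u =ᶠ[𝓝 x] fun _ ↦ 0 := fun x hx ↦ by
    filter_upwards [hK.isClosed.isOpen_compl.mem_nhds hx] with z hz using huK z hz
  have hF0 : ∀ y ∉ e '' K, F =ᶠ[𝓝 y] fun _ ↦ 0 := fun y hy ↦ by
    filter_upwards [hKc.isClosed.isOpen_compl.mem_nhds hy] with z hz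
    exact indicator_of_notMem hz _
  have hFe : ∀ x ∈ K, F =ᶠ[𝓝 (e x)] greenField e ψ u v := fun x hx ↦ by
    filter_upwards [e.open_target.mem_nhds (e.map_source (hKe hx))] with z hz
    by_cases hzK : z ∈ e '' K
    · exact indicator_of_mem hzK _
    · rw [hF, indicator_of_notMem hzK, greenField, huK, mul_zero, zero_smul]
      exact fun h ↦ hzK ⟨_, h, e.right_inv hz⟩
  obtain ⟨R, hR⟩ := hKc.isBounded.exists_norm_le
  have hFR : ∀ y, R + 1 ≤ ‖y‖ → F y = 0 := fun y hy ↦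
    indicator_of_notMem (fun h ↦ by linarith [hR y h]) _
  have hFC : ∀ y : EuclideanSpace ℝ (Fin (n + 1)), y (Fin.last n) ≤ a → ContDiffAt ℝ 1 F y := by
    intro y hy
    by_cases hyK : y ∈ e '' K
    · obtain ⟨x, hx, rfl⟩ := hyK
      exact (contDiffAt_greenField he hψ (hKe hx) (hu x hx hy) (hv x hx hy)).congr_of_eventuallyEq
        (hFe x hx)
    · exact contDiffAt_const.congr_of_eventuallyEq (hF0 y hyK)
  rw [← integral_divergence_halfSpace hFR hFC, ← integral_indicator hΩ]
  have hQ0 : ∀ x ∉ K, greenIntegrand (k := n + 1) ψ u v x = 0 := fun x hx ↦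
    greenIntegrand_eq_zero (hu0 x hx)
  have hind : Ω.indicator (greenIntegrand (k := n + 1) ψ u v)
      = (Ω ∩ K).indicator (greenIntegrand (k := n + 1) ψ u v) := by
    ext x
    by_cases hx : x ∈ K
    · by_cases hxΩ : x ∈ Ω <;> simp [hx, hxΩ]
    · by_cases hxΩ : x ∈ Ω <;> simp [hx, hxΩ, hQ0]
  have hmeas : AEStronglyMeasurable (Ω.indicator (greenIntegrand (k := n + 1) ψ u v))
      (weightedVolume (k := n + 1) ψ) := by
    rw [hind, aestronglyMeasurable_indicator_iff (hΩ.inter hK.measurableSet)]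
    refine ContinuousOn.aestronglyMeasurable (fun x hx ↦ ?_) (hΩ.inter hK.measurableSet)
    have hx' := ((hKΩ x hx.2).1 hx.1).le
    exact (continuousAt_greenIntegrand hψ (hu x hx.2 hx') (hv x hx.2 hx')).continuousWithinAt
  rw [integral_weightedVolume_eq he hψ.continuous (fun x hx ↦ by
    rw [hind]; exact indicator_of_notMem (fun h ↦ hx (hKe h.2)) _) hmeas,
    ← integral_indicator e.open_target.measurableSet, ← integral_indicator
      (measurableSet_lt (PiLp.continuous_apply 2 _ _).measurable measurable_const)]
  refine integral_congr_ae (Eventually.of_forall fun y ↦ ?_)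
  by_cases hyK : y ∈ e '' K
  · obtain ⟨x, hx, rfl⟩ := hyK
    rw [indicator_of_mem (e.map_source (hKe hx)), e.left_inv (hKe hx)]
    have hmem : e x ∈ {y : EuclideanSpace ℝ (Fin (n + 1)) | y (Fin.last n) < a} ↔ x ∈ Ω :=
      (hKΩ x hx).symm
    by_cases hxΩ : x ∈ Ω
    · have hxa := (hKΩ x hx).1 hxΩ
      rw [indicator_of_mem hxΩ, indicator_of_mem (hmem.2 hxΩ), (hFe x hx).fderiv_eq,
        traceCLM_fderiv_greenField he hψ (hKe hx) (hu x hx hxa.le) (hv x hx hxa.le)]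
    · rw [indicator_of_notMem hxΩ, indicator_of_notMem (fun h ↦ hxΩ (hmem.1 h)), mul_zero]
  · have h1 : ({y : EuclideanSpace ℝ (Fin (n + 1)) | y (Fin.last n) < a}).indicator
        (fun y ↦ traceCLM _ (fderiv ℝ F y)) y = 0 := by
      refine indicator_apply_eq_zero.2 fun _ ↦ ?_
      rw [(hF0 y hyK).fderiv_eq]
      simp
    rw [h1]
    refine indicator_apply_eq_zero.2 fun hy ↦ ?_
    rw [hind, indicator_of_notMem, mul_zero]
    exact fun h ↦ hyK ⟨_, h.2, e.right_inv hy⟩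

/-- Green's formula in a chart contained in the domain. -/
theorem integral_greenIntegrand_chart_interior (he : IsSmoothChart e)
    (hψ : ContMDiff (𝓡 (n + 1)) 𝓘(ℝ, ℝ) ∞ ψ) {Ω K : Set X} (hΩ : MeasurableSet Ω)
    (hK : IsCompact K) (hKe : K ⊆ e.source) (hKΩ : K ⊆ Ω) (huK : ∀ x ∉ K, u x = 0)
    (hu : ∀ x ∈ K, ContMDiffAt (𝓡 (n + 1)) 𝓘(ℝ, ℝ) 1 u x)
    (hv : ∀ x ∈ K, ContMDiffAt (𝓡 (n + 1)) 𝓘(ℝ, ℝ) 2 v x) :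
    ∫ x in Ω, greenIntegrand (k := n + 1) ψ u v x ∂(weightedVolume (k := n + 1) ψ) = 0 := by
  have hKc : IsCompact (e '' K) := hK.image_of_continuousOn (e.continuousOn.mono hKe)
  obtain ⟨R, hR⟩ := hKc.isBounded.exists_norm_le
  -- The slice is placed at height `R + 1`, above the whole image of `K`; the slice integral is then
  -- zero.
  have hlt : ∀ y ∈ e '' K, y (Fin.last n) < R + 1 := fun y hy ↦ by
    have h1 := (le_abs_self _).trans (PiLp.norm_apply_le y (Fin.last n))
    linarith [hR y hy]
  rw [integral_greenIntegrand_chart (a := R + 1) he hψ hΩ hK hKe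
    (fun x hx ↦ ⟨fun _ ↦ hlt _ ⟨x, hx, rfl⟩, fun _ ↦ hKΩ hx⟩) huK (fun x hx _ ↦ hu x hx)
    (fun x hx _ ↦ hv x hx)]
  have h0 : ∀ z : EuclideanSpace ℝ (Fin n), (e '' K).indicator (greenField e ψ u v)
      (slicePoint z (R + 1)) (Fin.last n) = 0 := fun z ↦ by
    rw [indicator_of_notMem]
    · rfl
    · intro h
      have := hlt _ h
      rw [slicePoint_last] at this
      exact lt_irrefl _ this
  simp only [h0, integral_zero]

end GreenChart

/-! ### Slice charts -/

section RestrictCharts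

variable {k : ℕ} {X : Type*} [TopologicalSpace X] [ChartedSpace (EuclideanSpace ℝ (Fin k)) X]
  {e : OpenPartialHomeomorph X (EuclideanSpace ℝ (Fin k))}

theorem IsSmoothChart.restrOpen (he : IsSmoothChart e) (s : Set X) (hs : IsOpen s) :
    IsSmoothChart (e.restrOpen s hs) :=
  ⟨he.contMDiffOn.mono inter_subset_left, he.contMDiffOn_symm.mono inter_subset_left⟩

theorem IsSmoothChart.transHomeomorph (he : IsSmoothChart e)
    (L : EuclideanSpace ℝ (Fin k) ≃L[ℝ] EuclideanSpace ℝ (Fin k)) :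
    IsSmoothChart (e.transHomeomorph L.toHomeomorph) := by
  refine ⟨?_, ?_⟩
  · exact L.contDiff.contMDiff.comp_contMDiffOn he.contMDiffOn
  · exact he.contMDiffOn_symm.comp L.symm.contDiff.contMDiff.contMDiffOn (fun y hy ↦ hy)

end RestrictCharts

/-! ### Linear splitting of ℝᵐ⁺¹ into a hyperplane and the last coordinate -/

section SliceLinear

variable {m : ℕ}

/-- The linear isomorphism `(u, a) ↦ slicePoint u a`. -/
def sliceEquiv (m : ℕ) : (EuclideanSpace ℝ (Fin m) × ℝ) ≃L[ℝ] EuclideanSpace ℝ (Fin (m + 1)) :=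
  LinearEquiv.toContinuousLinearEquiv
    { toFun := fun p ↦ slicePoint p.1 p.2
      map_add' := fun p q ↦ by
        ext i
        refine Fin.lastCases ?_ (fun i ↦ ?_) i <;> simp
      map_smul' := fun c p ↦ by
        ext i
        refine Fin.lastCases ?_ (fun i ↦ ?_) i <;> simp
      invFun := fun y ↦ (WithLp.toLp 2 fun i : Fin m ↦ y i.castSucc, y (Fin.last m))
      left_inv := fun p ↦ by
        ext i <;> simp
      right_inv := fun y ↦ by
        ext i
        refine Fin.lastCases ?_ (fun i ↦ ?_) i <;> simp }

theorem sliceEquiv_apply (p : EuclideanSpace ℝ (Fin m) × ℝ) :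
    sliceEquiv m p = slicePoint p.1 p.2 := rfl

theorem continuous_slicePoint : Continuous fun p : EuclideanSpace ℝ (Fin m) × ℝ ↦
    slicePoint p.1 p.2 := (sliceEquiv m).continuous

theorem exists_slicePoint_eq (y : EuclideanSpace ℝ (Fin (m + 1))) :
    ∃ u, slicePoint u (y (Fin.last m)) = y :=
  ⟨((sliceEquiv m).symm y).1, (sliceEquiv m).apply_symm_apply y⟩

theorem slicePoint_injective {u u' : EuclideanSpace ℝ (Fin m)} {a a' : ℝ}
    (h : slicePoint u a = slicePoint u' a') : u = u' ∧ a = a' := by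
  have := (sliceEquiv m).injective (a₁ := (u, a)) (a₂ := (u', a')) h
  exact Prod.mk.inj this

/-- The reflection in the last coordinate. -/
def sliceReflection (m : ℕ) :
    EuclideanSpace ℝ (Fin (m + 1)) ≃L[ℝ] EuclideanSpace ℝ (Fin (m + 1)) :=
  ((sliceEquiv m).symm.trans ((ContinuousLinearEquiv.refl ℝ _).prodCongr
    (ContinuousLinearEquiv.neg ℝ))).trans (sliceEquiv m)

theorem sliceReflection_slicePoint (u : EuclideanSpace ℝ (Fin m)) (a : ℝ) :
    sliceReflection m (slicePoint u a) = slicePoint u (-a) := by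
  have h : (sliceEquiv m).symm (slicePoint u a) = (u, a) :=
    (sliceEquiv m).symm_apply_apply (u, a)
  simp [sliceReflection, h, sliceEquiv_apply]

theorem sliceReflection_last (y : EuclideanSpace ℝ (Fin (m + 1))) :
    sliceReflection m y (Fin.last m) = -y (Fin.last m) := by
  obtain ⟨u, hu⟩ := exists_slicePoint_eq y
  rw [← hu, sliceReflection_slicePoint]
  simp

end SliceLinear

/-! ### Charts that flatten the boundary -/

section SliceCharts

variable {m : ℕ}
  {M : Type*} [TopologicalSpace M] [ChartedSpace (EuclideanSpace ℝ (Fin (m + 1))) M]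
  {S : Type*} [TopologicalSpace S] [ChartedSpace (EuclideanSpace ℝ (Fin m)) S]
  {Ω : Set M} {ι : S → M} {e : OpenPartialHomeomorph M (EuclideanSpace ℝ (Fin (m + 1)))}
  {d : OpenPartialHomeomorph S (EuclideanSpace ℝ (Fin m))}

/-- In the charts `e` and `d`, the domain `Ω` is the part `{yₘ < 0}` and `ι` is the inclusion of
`{yₘ = 0}`. -/
structure IsSliceChart (Ω : Set M) (ι : S → M)
    (e : OpenPartialHomeomorph M (EuclideanSpace ℝ (Fin (m + 1))))
    (d : OpenPartialHomeomorph S (EuclideanSpace ℝ (Fin m))) : Prop where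
  chart : IsSmoothChart e
  boundary_chart : IsSmoothChart d
  mem_source : ∀ s, s ∈ d.source ↔ ι s ∈ e.source
  apply_eq : ∀ s ∈ d.source, e (ι s) = slicePoint (d s) 0
  mem_iff : ∀ x ∈ e.source, x ∈ Ω ↔ e x (Fin.last m) < 0

namespace IsSliceChart

/-- A point on or below the slice is a limit of points obtained by lowering the last coordinate,
which lie in `Ω`. -/
theorem mem_closure (h : IsSliceChart Ω ι e d) {x : M} (hx : x ∈ e.source)
    (hl : e x (Fin.last m) ≤ 0) : x ∈ closure Ω := by
  obtain ⟨u, hu⟩ := exists_slicePoint_eq (e x)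
  have hc : Continuous fun t : ℝ ↦ slicePoint u (e x (Fin.last m) - t) :=
    continuous_slicePoint.comp (by fun_prop : Continuous fun t : ℝ ↦ (u, e x (Fin.last m) - t))
  have h0 : slicePoint u (e x (Fin.last m) - 0) = e x := by rw [sub_zero, hu]
  have htend : Tendsto (fun t : ℝ ↦ e.symm (slicePoint u (e x (Fin.last m) - t))) (𝓝[>] 0)
      (𝓝 x) := by
    have h1 : ContinuousAt (fun t : ℝ ↦ e.symm (slicePoint u (e x (Fin.last m) - t))) 0 := by
      refine ContinuousAt.comp (g := e.symm) ?_ hc.continuousAt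
      rw [h0]
      exact e.continuousAt_symm (e.map_source hx)
    have h2 := h1.tendsto
    simp only [h0, e.left_inv hx] at h2
    exact h2.mono_left nhdsWithin_le_nhds
  refine mem_closure_of_tendsto htend ?_
  have hev : ∀ᶠ t in 𝓝[>] (0 : ℝ), slicePoint u (e x (Fin.last m) - t) ∈ e.target := by
    refine (hc.continuousAt.eventually_mem ?_).filter_mono nhdsWithin_le_nhds
    rw [h0]
    exact e.open_target.mem_nhds (e.map_source hx)
  filter_upwards [hev, self_mem_nhdsWithin] with t ht ht0
  rw [h.mem_iff _ (e.map_target ht), e.right_inv ht, slicePoint_last]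
  have : 0 < t := ht0
  linarith

/-- A point of the slice is in the closure of `Ω` but not in `Ω`, hence comes from `S`. Thus the
target of `d` is the full slice of the target of `e`, and no part of the slice integral is missed.
-/
theorem target_iff (h : IsSliceChart Ω ι e d) (hΩ : IsOpen Ω) (hι : range ι = frontier Ω)
    (z : EuclideanSpace ℝ (Fin m)) : z ∈ d.target ↔ slicePoint z 0 ∈ e.target := by
  constructor
  · intro hz
    have h1 := d.map_target hz
    have h2 := h.apply_eq _ h1
    rw [d.right_inv hz] at h2
    rw [← h2]
    exact e.map_source ((h.mem_source _).1 h1)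
  · intro hz
    have hx := e.map_target hz
    have hex := e.right_inv hz
    have hf : e.symm (slicePoint z 0) ∈ frontier Ω := by
      rw [hΩ.frontier_eq]
      refine ⟨h.mem_closure hx ?_, fun hmem ↦ ?_⟩
      · rw [hex, slicePoint_last]
      · have := (h.mem_iff _ hx).1 hmem
        rw [hex, slicePoint_last] at this
        exact lt_irrefl _ this
    rw [← hι] at hf
    obtain ⟨s, hs⟩ := hf
    have hsd : s ∈ d.source := (h.mem_source s).2 (by rw [hs]; exact hx)
    have h2 := h.apply_eq s hsd
    rw [hs, hex] at h2
    rw [(slicePoint_injective h2).1]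
    exact d.map_source hsd

end IsSliceChart

/-- Off the frontier the space is the disjoint union of two open sets, `U` and its exterior. -/
theorem IsPreconnected.subset_or_subset_of_disjoint_frontier {X : Type*} [TopologicalSpace X]
    {P U : Set X} (hP : IsPreconnected P) (hU : IsOpen U) (h : Disjoint P (frontier U)) :
    P ⊆ U ∨ P ⊆ (closure U)ᶜ := by
  refine hP.subset_or_subset hU isClosed_closure.isOpen_compl
    (disjoint_left.2 fun x hx hx' ↦ hx' (subset_closure hx)) fun x hx ↦ ?_
  by_cases hxc : x ∈ closure U
  · by_contra hn
    refine disjoint_left.1 h hx ?_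
    rw [hU.frontier_eq]
    exact ⟨hxc, fun hxU ↦ hn (Or.inl hxU)⟩
  · exact Or.inr hxc

variable [IsManifold (𝓡 (m + 1)) ∞ M] [IsManifold (𝓡 m) ∞ S]
  [RiemannianBundle (fun x : M ↦ TangentSpace (𝓡 (m + 1)) x)]
  [RiemannianBundle (fun s : S ↦ TangentSpace (𝓡 m) s)]

/-- In the normal form of an immersion `ι` is z ↦ (z, 0), up to a linear isomorphism. Since `ι` is
an embedding, the ambient chart can be shrunk until it meets the frontier in this one sheet only. It
is shrunk further to have a ball as target, so that each open half is connected. -/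
theorem IsDomainWithBoundary.exists_chart_frontier (hΩ : IsDomainWithBoundary (m := m) Ω ι)
    (s₀ : S) :
    ∃ (e : OpenPartialHomeomorph M (EuclideanSpace ℝ (Fin (m + 1))))
      (d : OpenPartialHomeomorph S (EuclideanSpace ℝ (Fin m))), IsSmoothChart e ∧ IsSmoothChart d ∧
      s₀ ∈ d.source ∧ (∀ s, s ∈ d.source ↔ ι s ∈ e.source) ∧
      (∀ s ∈ d.source, e (ι s) = slicePoint (d s) 0) ∧ Convex ℝ e.target ∧
      ∀ x ∈ e.source, x ∈ frontier Ω ↔ e x (Fin.last m) = 0 := by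
  have h := hΩ.embedding.isImmersion.isImmersionAt s₀
  set d₀ := h.domChart with hd₀
  set c₀ := h.codChart with hc₀
  have hdS : IsSmoothChart d₀ := isSmoothChart_of_mem_maximalAtlas h.domChart_mem_maximalAtlas
  have hcS : IsSmoothChart c₀ := isSmoothChart_of_mem_maximalAtlas h.codChart_mem_maximalAtlas
  have hw : ∀ z ∈ d₀.target, c₀ (ι (d₀.symm z)) = h.equiv (z, 0) := fun z hz ↦
    h.writtenInCharts (by simpa using hz)
  let e1 := h.equiv.toLinearEquiv
  have hfin : FiniteDimensional ℝ h.complement :=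
    Module.Finite.of_injective (e1.toLinearMap ∘ₗ
      LinearMap.inr ℝ (EuclideanSpace ℝ (Fin m)) h.complement)
      (show Function.Injective (e1 ∘ Prod.mk 0) from
        e1.injective.comp (Prod.mk_right_injective 0))
  -- The complement in the normal form has dimension (m + 1) − m = 1, so it can be identified with
  -- the last coordinate axis.
  have hrank : Module.finrank ℝ h.complement = Module.finrank ℝ ℝ := by
    have := e1.finrank_eq
    rw [Module.finrank_prod, finrank_euclideanSpace_fin, finrank_euclideanSpace_fin] at this
    rw [Module.finrank_self]
    omega
  let φ := ContinuousLinearEquiv.ofFinrankEq hrank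
  let Λ := (h.equiv.symm.trans ((ContinuousLinearEquiv.refl ℝ _).prodCongr φ)).trans (sliceEquiv m)
  have hΛ : ∀ z, Λ (h.equiv (z, 0)) = slicePoint z 0 := by
    intro z
    simp [Λ, sliceEquiv_apply]
  let c₁ := c₀.transHomeomorph Λ.toHomeomorph
  have hc₁ : IsSmoothChart c₁ := hcS.transHomeomorph Λ
  have hc₁s : ∀ s ∈ d₀.source, ι s ∈ c₁.source ∧ c₁ (ι s) = slicePoint (d₀ s) 0 := by
    intro s hs
    refine ⟨h.source_subset_preimage_source hs, ?_⟩
    have h1 := hw _ (d₀.map_source hs)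
    rw [d₀.left_inv hs] at h1
    show Λ (c₀ (ι s)) = _
    rw [h1, hΛ]
  -- Openness in the induced topology: `W` excludes other sheets of the frontier.
  obtain ⟨W, hW, hWd⟩ := hΩ.embedding.isEmbedding.isOpen_iff.1 d₀.open_source
  have hWs : ∀ s, ι s ∈ W ↔ s ∈ d₀.source := fun s ↦ by rw [← hWd]; rfl
  let e₁ := c₁.restrOpen W hW
  have he₁ : IsSmoothChart e₁ := hc₁.restrOpen W hW
  have hs₀ : s₀ ∈ d₀.source := h.mem_domChart_source
  have hp₁ : ι s₀ ∈ e₁.source := ⟨(hc₁s s₀ hs₀).1, (hWs s₀).2 hs₀⟩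
  have hy₀ : e₁ (ι s₀) = slicePoint (d₀ s₀) 0 := (hc₁s s₀ hs₀).2
  -- The second condition ensures that each point of the ball on the slice is the image of a point
  -- of `S`.
  have hnhds : e₁.target ∩ {y | (((sliceEquiv m).symm y).1) ∈ d₀.target} ∈ 𝓝 (e₁ (ι s₀)) := by
    refine Filter.inter_mem (e₁.open_target.mem_nhds (e₁.map_source hp₁)) ?_
    refine (d₀.open_target.preimage (continuous_fst.comp (sliceEquiv m).symm.continuous)).mem_nhds ?_
    rw [hy₀]
    show ((sliceEquiv m).symm (sliceEquiv m (d₀ s₀, 0))).1 ∈ d₀.target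
    rw [ContinuousLinearEquiv.symm_apply_apply]
    exact d₀.map_source hs₀
  obtain ⟨r, hr, hball⟩ := Metric.mem_nhds_iff.1 hnhds
  set B := Metric.ball (e₁ (ι s₀)) r
  have hO : IsOpen (e₁.source ∩ e₁ ⁻¹' B) :=
    e₁.continuousOn.isOpen_inter_preimage e₁.open_source Metric.isOpen_ball
  let e := e₁.restrOpen _ hO
  have hesrc : ∀ x, x ∈ e.source ↔ x ∈ e₁.source ∧ e₁ x ∈ B := fun x ↦
    ⟨fun hx ↦ hx.2, fun hx ↦ ⟨hx.1, hx⟩⟩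
  have hetgt : e.target = B := by
    ext y
    constructor
    · rintro ⟨hy, -, hy'⟩
      rw [mem_preimage, e₁.right_inv hy] at hy'
      exact hy'
    · intro hy
      have hy1 := (hball hy).1
      exact ⟨hy1, e₁.map_target hy1, by rwa [mem_preimage, e₁.right_inv hy1]⟩
  have hO' : IsOpen (ι ⁻¹' e.source) :=
    e.open_source.preimage hΩ.embedding.isEmbedding.continuous
  let d := d₀.restrOpen _ hO'
  have hdsrc : ∀ s, s ∈ d.source ↔ ι s ∈ e.source := fun s ↦
    ⟨fun hs ↦ hs.2, fun hs ↦ ⟨(hWs s).1 ((hesrc _).1 hs).1.2, hs⟩⟩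
  have hda : ∀ s ∈ d.source, e (ι s) = slicePoint (d s) 0 := fun s hs ↦ (hc₁s s hs.1).2
  refine ⟨e, d, he₁.restrOpen _ _, hdS.restrOpen _ _, ?_, hdsrc, hda, ?_, fun x hx ↦ ?_⟩
  · rw [hdsrc, hesrc]
    exact ⟨hp₁, Metric.mem_ball_self hr⟩
  · rw [hetgt]
    exact convex_ball _ _
  · rw [← hΩ.range_eq]
    constructor
    · rintro ⟨s, rfl⟩
      rw [hda s ((hdsrc s).2 hx), slicePoint_last]
    · intro h0
      obtain ⟨z, hz⟩ := exists_slicePoint_eq (e x)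
      rw [h0] at hz
      have hxB : e x ∈ B := ((hesrc x).1 hx).2
      have hzd : z ∈ d₀.target := by
        have := (hball hxB).2
        rw [← hz] at this
        change ((sliceEquiv m).symm (sliceEquiv m (z, 0))).1 ∈ d₀.target at this
        rwa [ContinuousLinearEquiv.symm_apply_apply] at this
      have h1 := hc₁s _ (d₀.map_target hzd)
      rw [d₀.right_inv hzd, hz] at h1
      exact ⟨_, c₁.injOn h1.1 hx.1.1 h1.2⟩

/-- Each open half of the chart is connected and misses the frontier, so it lies in `Ω` or in the
exterior. Both halves in `Ω` would put a frontier point into the interior of the closure, which is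
`Ω`. Both outside would contradict that `ι s₀` is adherent to `Ω`. In the two remaining cases the
chart, or its reflection, is a slice chart. -/
theorem IsDomainWithBoundary.exists_isSliceChart (hΩ : IsDomainWithBoundary (m := m) Ω ι) (s₀ : S) :
    ∃ (e : OpenPartialHomeomorph M (EuclideanSpace ℝ (Fin (m + 1))))
      (d : OpenPartialHomeomorph S (EuclideanSpace ℝ (Fin m))), IsSliceChart Ω ι e d ∧
      s₀ ∈ d.source := by
  obtain ⟨e, d, he, hd, hs₀, hsrc, heq, hconv, hfr⟩ := hΩ.exists_chart_frontier s₀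
  have hp : ι s₀ ∈ e.source := (hsrc _).1 hs₀
  have hpf : ι s₀ ∈ frontier Ω := hΩ.range_eq ▸ mem_range_self s₀
  have side : ∀ T : Set (EuclideanSpace ℝ (Fin (m + 1))), Convex ℝ T →
      (∀ y ∈ T, y (Fin.last m) ≠ 0) → e.symm '' (e.target ∩ T) ⊆ Ω ∨
        e.symm '' (e.target ∩ T) ⊆ (closure Ω)ᶜ := by
    intro T hT hT0
    refine IsPreconnected.subset_or_subset_of_disjoint_frontier
      ((hconv.inter hT).isPreconnected.image _ (e.continuousOn_symm.mono inter_subset_left))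
      hΩ.isOpen ?_
    rw [disjoint_left]
    rintro _ ⟨y, hy, rfl⟩ hy'
    rw [hfr _ (e.map_target hy.1), e.right_inv hy.1] at hy'
    exact hT0 y hy.2 hy'
  have hlin : IsLinearMap ℝ fun y : EuclideanSpace ℝ (Fin (m + 1)) ↦ y (Fin.last m) :=
    ⟨fun _ _ ↦ rfl, fun _ _ ↦ rfl⟩
  have himg : ∀ {T : Set (EuclideanSpace ℝ (Fin (m + 1)))} {x}, x ∈ e.source → e x ∈ T →
      x ∈ e.symm '' (e.target ∩ T) := fun hx hT ↦ ⟨_, ⟨e.map_source hx, hT⟩, e.left_inv hx⟩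
  have hnot : ∀ x ∈ e.source, e x (Fin.last m) = 0 → x ∉ Ω := fun x hx h0 hxΩ ↦ by
    have := (hfr x hx).2 h0
    rw [hΩ.isOpen.frontier_eq] at this
    exact this.2 hxΩ
  rcases side {y | y (Fin.last m) < 0} (convex_halfSpace_lt hlin 0) (fun y hy ↦ ne_of_lt hy)
    with hN | hN <;>
  rcases side {y | 0 < y (Fin.last m)} (convex_halfSpace_gt hlin 0) (fun y hy ↦ ne_of_gt hy)
    with hP | hP
  · exfalso
    have h1 : e.source ⊆ closure Ω := by
      intro x hx
      rcases lt_trichotomy (e x (Fin.last m)) 0 with h0 | h0 | h0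
      · exact subset_closure (hN (himg hx h0))
      · exact frontier_subset_closure ((hfr x hx).2 h0)
      · exact subset_closure (hP (himg hx h0))
    have h2 : ι s₀ ∈ interior (closure Ω) := interior_mono h1 (by
      rw [e.open_source.interior_eq]; exact hp)
    rw [hΩ.interior_closure] at h2
    rw [hΩ.isOpen.frontier_eq] at hpf
    exact hpf.2 h2
  · refine ⟨e, d, ⟨he, hd, hsrc, heq, fun x hx ↦ ⟨fun hxΩ ↦ ?_, fun h0 ↦ hN (himg hx h0)⟩⟩, hs₀⟩
    rcases lt_trichotomy (e x (Fin.last m)) 0 with h0 | h0 | h0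
    · exact h0
    · exact absurd hxΩ (hnot x hx h0)
    · exact absurd (subset_closure hxΩ) (hP (himg hx h0))
  · refine ⟨e.transHomeomorph (sliceReflection m).toHomeomorph, d,
      ⟨he.transHomeomorph _, hd, hsrc, fun s hs ↦ ?_, fun x hx ↦ ?_⟩, hs₀⟩
    · show sliceReflection m (e (ι s)) = _
      rw [heq s hs, sliceReflection_slicePoint, neg_zero]
    · show x ∈ Ω ↔ sliceReflection m (e x) (Fin.last m) < 0
      rw [sliceReflection_last, neg_lt_zero]
      refine ⟨fun hxΩ ↦ ?_, fun h0 ↦ hP (himg hx h0)⟩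
      rcases lt_trichotomy (e x (Fin.last m)) 0 with h0 | h0 | h0
      · exact absurd (subset_closure hxΩ) (hN (himg hx h0))
      · exact absurd hxΩ (hnot x hx h0)
      · exact h0
  · exfalso
    obtain ⟨x, hx, hxΩ⟩ := mem_closure_iff.1 (frontier_subset_closure hpf) _ e.open_source hp
    rcases lt_trichotomy (e x (Fin.last m)) 0 with h0 | h0 | h0
    · exact hN (himg hx h0) (subset_closure hxΩ)
    · exact hnot x hx h0 hxΩ
    · exact hP (himg hx h0) (subset_closure hxΩ)

end SliceCharts

/-! ### Algebraic rules for gradients and Hessians -/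

section Rules

variable {k : ℕ} {X : Type*} [TopologicalSpace X] [ChartedSpace (EuclideanSpace ℝ (Fin k)) X]
  [RiemannianBundle (fun x : X ↦ TangentSpace (𝓡 k) x)] {a b : X → ℝ} {p : X}
  [IsManifold (𝓡 k) ∞ X] [IsContMDiffRiemannianBundle (𝓡 k) ∞ (EuclideanSpace ℝ (Fin k))
    (fun x : X ↦ TangentSpace (𝓡 k) x)]

theorem grad_eq_iff {w : TangentSpace (𝓡 k) p} :
    grad a p = w ↔ ∀ v, inner ℝ w v = mvfderiv (𝓡 k) a p v := by
  refine ⟨fun h v ↦ by rw [← h, inner_grad_left], fun h ↦ ?_⟩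
  exact ext_inner_right ℝ fun v ↦ by rw [inner_grad_left, h]

theorem grad_congr (h : a =ᶠ[𝓝 p] b) : grad (k := k) a p = grad b p := by
  rw [grad_eq_iff]
  intro v
  rw [inner_grad_left]
  have h2 := h.mfderiv_eq (I := 𝓡 k) (I' := 𝓘(ℝ, ℝ))
  exact (DFunLike.congr_fun h2 v).symm

theorem grad_add (ha : MDifferentiableAt (𝓡 k) 𝓘(ℝ, ℝ) a p)
    (hb : MDifferentiableAt (𝓡 k) 𝓘(ℝ, ℝ) b p) :
    grad (k := k) (fun x ↦ a x + b x) p = grad a p + grad b p := by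
  rw [grad_eq_iff]
  intro v
  rw [inner_add_left, inner_grad_left, inner_grad_left]
  exact (DFunLike.congr_fun (mvfderiv_add ha hb) v).symm

theorem grad_mul (ha : MDifferentiableAt (𝓡 k) 𝓘(ℝ, ℝ) a p)
    (hb : MDifferentiableAt (𝓡 k) 𝓘(ℝ, ℝ) b p) :
    grad (k := k) (fun x ↦ a x * b x) p = a p • grad b p + b p • grad a p := by
  rw [grad_eq_iff]
  intro v
  rw [inner_add_left, real_inner_smul_left, real_inner_smul_left, inner_grad_left, inner_grad_left]
  exact (DFunLike.congr_fun (mvfderiv_mul ha hb) v).symm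

theorem grad_const_mul (c : ℝ) (ha : MDifferentiableAt (𝓡 k) 𝓘(ℝ, ℝ) a p) :
    grad (k := k) (fun x ↦ c * a x) p = c • grad a p := by
  rw [grad_mul mdifferentiableAt_const ha]
  have : grad (k := k) (fun _ : X ↦ c) p = 0 := by
    rw [grad_eq_iff]
    intro v
    rw [inner_zero_left, mvfderiv_const]
    rfl
  rw [this, smul_zero, add_zero]

theorem hess_congr (h : a =ᶠ[𝓝 p] b) (ha : ContMDiffAt (𝓡 k) 𝓘(ℝ, ℝ) 2 a p)
    (v w : TangentSpace (𝓡 k) p) : hess a p v w = hess b p v w := by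
  have he := isSmoothChart_chartAt (k := k) p
  have hp := mem_chart_source (EuclideanSpace ℝ (Fin k)) p
  rw [hess_eq_localHess he hp ha, hess_eq_localHess he hp (ha.congr_of_eventuallyEq h.symm)]
  refine localHess_congr ?_ _ _
  have h1 := (OpenPartialHomeomorph.continuousAt_symm _
    (OpenPartialHomeomorph.map_source _ hp)).tendsto
  rw [OpenPartialHomeomorph.left_inv _ hp] at h1
  exact h1.eventually h

theorem localHess_add_const_mul {E : Type*} [NormedAddCommGroup E] [NormedSpace ℝ E]
    {G : E → E →L[ℝ] E →L[ℝ] ℝ} {a b : E → ℝ} {y : E} (c : ℝ) (ha : ContDiffAt ℝ 2 a y)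
    (hb : ContDiffAt ℝ 2 b y) (v w : E) :
    localHess G (fun z ↦ a z + c * b z) y v w = localHess G a y v w + c * localHess G b y v w := by
  have h1 : fderiv ℝ (fun z ↦ a z + c * b z) =ᶠ[𝓝 y] fun z ↦ fderiv ℝ a z + c • fderiv ℝ b z := by
    filter_upwards [ha.eventually (by simp), hb.eventually (by simp)] with z hza hzb
    have hza' := hza.differentiableAt (by simp)
    have hzb' := hzb.differentiableAt (by simp)
    rw [fderiv_fun_add hza' (hzb'.const_mul c), fderiv_const_mul hzb']
  have hda : DifferentiableAt ℝ (fderiv ℝ a) y :=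
    (ha.fderiv_right (m := 1) (by norm_num)).differentiableAt (by simp)
  have hdb : DifferentiableAt ℝ (fderiv ℝ b) y :=
    (hb.fderiv_right (m := 1) (by norm_num)).differentiableAt (by simp)
  rw [localHess, localHess, localHess, localGrad, localGrad, localGrad, h1.fderiv_eq,
    h1.eq_of_nhds, fderiv_fun_add hda (hdb.fun_const_smul c), fderiv_fun_const_smul hdb, map_add,
    map_add, map_smul, map_smul]
  simp only [add_apply, FunLike.coe_smul, Pi.smul_apply, smul_eq_mul]
  ring

theorem hess_add_const_mul (c : ℝ) (ha : ContMDiffAt (𝓡 k) 𝓘(ℝ, ℝ) 2 a p)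
    (hb : ContMDiffAt (𝓡 k) 𝓘(ℝ, ℝ) 2 b p) (v w : TangentSpace (𝓡 k) p) :
    hess (fun x ↦ a x + c * b x) p v w = hess a p v w + c * hess b p v w := by
  have he := isSmoothChart_chartAt (k := k) p
  have hp := mem_chart_source (EuclideanSpace ℝ (Fin k)) p
  have hab : ContMDiffAt (𝓡 k) 𝓘(ℝ, ℝ) 2 (fun x ↦ a x + c * b x) p :=
    ha.add (contMDiffAt_const.mul hb)
  rw [hess_eq_localHess he hp ha, hess_eq_localHess he hp hb, hess_eq_localHess he hp hab]
  exact localHess_add_const_mul c (contDiffAt_comp_symm_of_mem (n := 2) he hp ha)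
    (contDiffAt_comp_symm_of_mem (n := 2) he hp hb) _ _

theorem hess_add_right {u : X → ℝ} (v w w' : TangentSpace (𝓡 k) p) :
    hess u p v (w + w') = hess u p v w + hess u p v w' := inner_add_right _ _ _

theorem hess_smul_right {u : X → ℝ} (c : ℝ) (v w : TangentSpace (𝓡 k) p) :
    hess u p v (c • w) = c * hess u p v w := real_inner_smul_right _ _ _

end Rules

/-! ### The geometry of the boundary -/

section BilinTrace

variable {V W : Type*} [NormedAddCommGroup V] [InnerProductSpace ℝ V] [FiniteDimensional ℝ V]
  [NormedAddCommGroup W] [InnerProductSpace ℝ W] [FiniteDimensional ℝ W]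

/-- The trace of a bilinear form splits along an isometric hyperplane and its unit normal. -/
theorem bilinTrace_eq_add (A : V →ₗ[ℝ] V) (L : W →ₗ[ℝ] V) (n : V)
    (hL : ∀ v w, (inner ℝ (L v) (L w) : ℝ) = inner ℝ v w) (hn : ‖n‖ = 1)
    (hLn : ∀ v, (inner ℝ n (L v) : ℝ) = 0)
    (hdim : Module.finrank ℝ V = Module.finrank ℝ W + 1) :
    bilinTrace (fun v w ↦ inner ℝ (A v) w)
      = bilinTrace (fun v w ↦ inner ℝ (A (L v)) (L w)) + inner ℝ (A n) n := by
  let b := stdOrthonormalBasis ℝ W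
  let w : Fin (Module.finrank ℝ W) ⊕ Unit → V := Sum.elim (fun i ↦ L (b i)) fun _ ↦ n
  have hw : Orthonormal ℝ w := by
    rw [orthonormal_iff_ite]
    rintro (i | i) (j | j)
    · simp only [w, Sum.elim_inl, hL, Sum.inl.injEq]
      exact (orthonormal_iff_ite.1 b.orthonormal) i j
    · simp only [w, Sum.elim_inl, Sum.elim_inr, reduceCtorEq, if_false]
      rw [real_inner_comm, hLn]
    · simp only [w, Sum.elim_inl, Sum.elim_inr, reduceCtorEq, if_false]
      exact hLn _
    · simp only [w, Sum.elim_inr, if_true, real_inner_self_eq_norm_sq, hn]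
      norm_num
  have hcard : Fintype.card (Fin (Module.finrank ℝ W) ⊕ Unit) = Module.finrank ℝ V := by
    rw [Fintype.card_sum, Fintype.card_fin, Fintype.card_unit, hdim]
  let B := OrthonormalBasis.mk hw
    ((hw.linearIndependent.span_eq_top_of_card_eq_finrank' hcard).ge)
  have hB : ∀ i, B i = w i := fun i ↦ by simp [B]
  rw [bilinTrace_inner, LinearMap.trace_eq_sum_inner A B, Fintype.sum_sum_type, bilinTrace]
  simp only [hB, Finset.univ_unique, Finset.sum_singleton]
  rw [real_inner_comm]
  congr 1
  exact Finset.sum_congr rfl fun i _ ↦ real_inner_comm _ _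

end BilinTrace

/-! ### The unit normal as normalized gradient of the last coordinate -/

section SliceGeometry

variable {m : ℕ}
  {M : Type*} [TopologicalSpace M] [ChartedSpace (EuclideanSpace ℝ (Fin (m + 1))) M]
  [IsManifold (𝓡 (m + 1)) ∞ M]
  [RiemannianBundle (fun x : M ↦ TangentSpace (𝓡 (m + 1)) x)]
  [IsContMDiffRiemannianBundle (𝓡 (m + 1)) ∞ (EuclideanSpace ℝ (Fin (m + 1)))
    (fun x : M ↦ TangentSpace (𝓡 (m + 1)) x)]
  {S : Type*} [TopologicalSpace S] [ChartedSpace (EuclideanSpace ℝ (Fin m)) S]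
  [IsManifold (𝓡 m) ∞ S]
  [RiemannianBundle (fun s : S ↦ TangentSpace (𝓡 m) s)]
  [IsContMDiffRiemannianBundle (𝓡 m) ∞ (EuclideanSpace ℝ (Fin m))
    (fun s : S ↦ TangentSpace (𝓡 m) s)]
  {Ω : Set M} {ι : S → M} {ν : ∀ s : S, TangentSpace (𝓡 (m + 1)) (ι s)}
  {e : OpenPartialHomeomorph M (EuclideanSpace ℝ (Fin (m + 1)))}
  {d : OpenPartialHomeomorph S (EuclideanSpace ℝ (Fin m))} {u : M → ℝ} {s : S}

/-- The last coordinate of the chart `e`. -/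
def sliceFun (e : OpenPartialHomeomorph M (EuclideanSpace ℝ (Fin (m + 1)))) (x : M) : ℝ :=
  e x (Fin.last m)

theorem contMDiffAt_sliceFun (he : IsSmoothChart e) {p : M} (hp : p ∈ e.source) :
    ContMDiffAt (𝓡 (m + 1)) 𝓘(ℝ, ℝ) ∞ (sliceFun e) p :=
  contMDiffAt_of_comp_symm (n := ⊤) he hp
    (EuclideanSpace.proj (𝕜 := ℝ) (Fin.last m)).contDiff.contDiffAt
    (Eventually.of_forall fun _ ↦ rfl)

theorem mvfderiv_sliceFun (he : IsSmoothChart e) {p : M} (hp : p ∈ e.source)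
    (v : TangentSpace (𝓡 (m + 1)) p) :
    mvfderiv (𝓡 (m + 1)) (sliceFun e) p v = coords e p v (Fin.last m) := by
  let L : EuclideanSpace ℝ (Fin (m + 1)) →L[ℝ] ℝ := EuclideanSpace.proj (Fin.last m)
  rw [mvfderiv_eq_fderiv_comp he hp (u := sliceFun e) (F := L) L.differentiableAt
    (Eventually.of_forall fun _ ↦ rfl), L.fderiv]
  rfl

namespace IsSliceChart

theorem coords_mfderiv (hsl : IsSliceChart Ω ι e d) (hΩ : IsDomainWithBoundary (m := m) Ω ι)
    (hs : s ∈ d.source) (v : TangentSpace (𝓡 m) s) :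
    coords e (ι s) (mfderiv (𝓡 m) (𝓡 (m + 1)) ι s v) = slicePoint (coords d s v) 0 := by
  let J : EuclideanSpace ℝ (Fin m) →L[ℝ] EuclideanSpace ℝ (Fin (m + 1)) :=
    (sliceEquiv m).toContinuousLinearMap.comp (ContinuousLinearMap.inl ℝ _ ℝ)
  have hp := (hsl.mem_source s).1 hs
  have hι : MDifferentiableAt (𝓡 m) (𝓡 (m + 1)) ι s :=
    (hΩ.embedding.contMDiff s).mdifferentiableAt (by simp)
  have h1 := HasMFDerivAt.comp s (hsl.chart.mdifferentiable.mdifferentiableAt hp).hasMFDerivAt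
    hι.hasMFDerivAt
  have h2 := HasMFDerivAt.comp s J.hasFDerivAt.hasMFDerivAt
    (hsl.boundary_chart.mdifferentiable.mdifferentiableAt hs).hasMFDerivAt
  have h3 : e ∘ ι =ᶠ[𝓝 s] J ∘ d := by
    filter_upwards [d.open_source.mem_nhds hs] with t ht using hsl.apply_eq t ht
  exact DFunLike.congr_fun (hasMFDerivAt_unique (h1.congr_of_eventuallyEq h3.symm) h2) v

theorem exists_mfderiv_eq (hsl : IsSliceChart Ω ι e d) (hΩ : IsDomainWithBoundary (m := m) Ω ι)
    (hs : s ∈ d.source) {w : TangentSpace (𝓡 (m + 1)) (ι s)}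
    (hw : coords e (ι s) w (Fin.last m) = 0) :
    ∃ v : TangentSpace (𝓡 m) s, w = mfderiv (𝓡 m) (𝓡 (m + 1)) ι s v := by
  obtain ⟨z, hz⟩ := exists_slicePoint_eq (coords e (ι s) w)
  obtain ⟨v, hv⟩ := hsl.boundary_chart.exists_coords_eq hs z
  refine ⟨v, hsl.chart.coords_injective ((hsl.mem_source s).1 hs) ?_⟩
  rw [hsl.coords_mfderiv hΩ hs, hv, ← hz, hw]

/-- The component is nonzero, since otherwise ν would be tangent and thus orthogonal to itself. Its
sign follows from a coordinate line leaving the boundary with velocity −ν: it enters `Ω`, where the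
last coordinate is negative. -/
theorem coords_normal_pos (hsl : IsSliceChart Ω ι e d) (hΩ : IsDomainWithBoundary (m := m) Ω ι)
    (hν : IsOutwardUnitNormal (m := m) Ω ι ν) (hs : s ∈ d.source) :
    0 < coords e (ι s) (ν s) (Fin.last m) := by
  have hp := (hsl.mem_source s).1 hs
  have hne : coords e (ι s) (ν s) (Fin.last m) ≠ 0 := by
    intro h0
    obtain ⟨v, hv⟩ := hsl.exists_mfderiv_eq hΩ hs h0
    have h1 := hν.orthogonal s v
    rw [← hv, real_inner_self_eq_norm_sq, hν.norm_eq] at h1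
    norm_num at h1
  refine lt_of_le_of_ne ?_ hne.symm
  set c := chartAt (EuclideanSpace ℝ (Fin (m + 1))) (ι s) with hc_def
  have hc : IsSmoothChart c := isSmoothChart_chartAt _
  have hpc : ι s ∈ c.source := mem_chart_source _ _
  have hρ : ContMDiffAt (𝓡 (m + 1)) 𝓘(ℝ, ℝ) 1 (sliceFun e) (ι s) :=
    (contMDiffAt_sliceFun hsl.chart hp).of_le (by simp)
  -- The outward condition is expressed in the preferred chart `c`, so the last coordinate of `e` is
  -- differentiated after reading it in `c`.
  have hF : HasFDerivAt (sliceFun e ∘ c.symm) (fderiv ℝ (sliceFun e ∘ c.symm) (c (ι s)))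
      (c (ι s)) :=
    ((contDiffAt_comp_symm_of_mem (n := 1) hc hpc hρ).differentiableAt (by simp)).hasFDerivAt
  set w := coords c (ι s) (ν s) with hw
  have hγ : HasDerivAt (fun t : ℝ ↦ c (ι s) - t • w) (-w) 0 := by
    have := ((hasDerivAt_id (0 : ℝ)).smul_const w).const_sub (c (ι s))
    simpa using this
  have h0 : c (ι s) - (0 : ℝ) • w = c (ι s) := by rw [zero_smul, sub_zero]
  rw [← h0] at hF
  have hd := hF.comp_hasDerivAt 0 hγ
  rw [map_neg, h0, ← mvfderiv_eq_fderiv_symm hc hpc hρ, mvfderiv_sliceFun hsl.chart hp] at hd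
  have hz : ((sliceFun e ∘ c.symm) ∘ fun t : ℝ ↦ c (ι s) - t • w) 0 = 0 := by
    simp only [Function.comp, h0, c.left_inv hpc, sliceFun, hsl.apply_eq s hs, slicePoint_last]
  have hslope := hd.tendsto_slope_zero_right
  have hev : ∀ᶠ t in 𝓝[>] (0 : ℝ), c.symm (c (ι s) - t • w) ∈ e.source := by
    have h1 : ContinuousAt (fun t : ℝ ↦ c.symm (c (ι s) - t • w)) 0 := by
      refine ContinuousAt.comp (g := c.symm) ?_ hγ.continuousAt
      rw [h0]
      exact c.continuousAt_symm (c.map_source hpc)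
    refine (h1.eventually_mem ?_).filter_mono nhdsWithin_le_nhds
    rw [h0, c.left_inv hpc]
    exact e.open_source.mem_nhds hp
  have hle : -coords e (ι s) (ν s) (Fin.last m) ≤ 0 := by
    refine le_of_tendsto hslope ?_
    filter_upwards [hν.outward s, hev, self_mem_nhdsWithin] with t ht hte ht0
    have h1 := (hsl.mem_iff _ hte).1 ht
    rw [hz, sub_zero, zero_add, smul_eq_mul]
    exact mul_nonpos_of_nonneg_of_nonpos (inv_nonneg.2 (le_of_lt ht0)) h1.le
  linarith

theorem exists_eq_add (hsl : IsSliceChart Ω ι e d) (hΩ : IsDomainWithBoundary (m := m) Ω ι)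
    (hν : IsOutwardUnitNormal (m := m) Ω ι ν) (hs : s ∈ d.source)
    (w : TangentSpace (𝓡 (m + 1)) (ι s)) :
    ∃ (v : TangentSpace (𝓡 m) s) (a : ℝ),
      w = mfderiv (𝓡 m) (𝓡 (m + 1)) ι s v + a • ν s := by
  have hb := hsl.coords_normal_pos hΩ hν hs
  set a := coords e (ι s) w (Fin.last m) / coords e (ι s) (ν s) (Fin.last m) with ha
  obtain ⟨v, hv⟩ := hsl.exists_mfderiv_eq hΩ hs (w := w + (-a) • ν s) (by
    rw [coords_add, coords_smul]
    simp only [PiLp.add_apply, PiLp.smul_apply, smul_eq_mul, ha]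
    field_simp
    ring)
  refine ⟨v, a, ?_⟩
  rw [← hv, neg_smul, neg_add_cancel_right]

end IsSliceChart

theorem inner_normal_self (hν : IsOutwardUnitNormal (m := m) Ω ι ν) (s : S) :
    (inner ℝ (ν s) (ν s) : ℝ) = 1 := by
  rw [real_inner_self_eq_norm_sq, hν.norm_eq, one_pow]

theorem mvfderiv_comp_embedding (hΩ : IsDomainWithBoundary (m := m) Ω ι)
    (hu : MDifferentiableAt (𝓡 (m + 1)) 𝓘(ℝ, ℝ) u (ι s)) (v : TangentSpace (𝓡 m) s) :
    mvfderiv (𝓡 m) (u ∘ ι) s v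
      = mvfderiv (𝓡 (m + 1)) u (ι s) (mfderiv (𝓡 m) (𝓡 (m + 1)) ι s v) :=
  mvfderiv_comp_apply s hu ((hΩ.embedding.contMDiff s).mdifferentiableAt (by simp)) v

/-- The tangential and normal parts of a gradient at the boundary. -/
theorem grad_eq_add_normal (hΩ : IsDomainWithBoundary (m := m) Ω ι)
    (hν : IsOutwardUnitNormal (m := m) Ω ι ν)
    (hu : MDifferentiableAt (𝓡 (m + 1)) 𝓘(ℝ, ℝ) u (ι s)) :
    grad u (ι s) = mfderiv (𝓡 m) (𝓡 (m + 1)) ι s (grad (u ∘ ι) s) + normalDeriv ι ν u s • ν s := by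
  obtain ⟨e, d, hsl, hs⟩ := hΩ.exists_isSliceChart s
  rw [grad_eq_iff]
  intro w
  obtain ⟨v, a, rfl⟩ := hsl.exists_eq_add hΩ hν hs w
  have horth := hν.orthogonal s (grad (u ∘ ι) s)
  rw [real_inner_comm] at horth
  rw [map_add, map_smul, inner_add_left, inner_add_right, inner_add_right, hΩ.isometric,
    real_inner_smul_left, real_inner_smul_left, real_inner_smul_right, real_inner_smul_right,
    hν.orthogonal, inner_normal_self hν, horth, inner_grad_left,
    mvfderiv_comp_embedding hΩ hu, normalDeriv, inner_grad_left, smul_eq_mul]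
  ring

theorem inner_grad_eq_add_normal (hΩ : IsDomainWithBoundary (m := m) Ω ι)
    (hν : IsOutwardUnitNormal (m := m) Ω ι ν) {v : M → ℝ}
    (hu : MDifferentiableAt (𝓡 (m + 1)) 𝓘(ℝ, ℝ) u (ι s))
    (hv : MDifferentiableAt (𝓡 (m + 1)) 𝓘(ℝ, ℝ) v (ι s)) :
    inner ℝ (grad (k := m + 1) u (ι s)) (grad v (ι s))
      = inner ℝ (grad (k := m) (u ∘ ι) s) (grad (v ∘ ι) s)
        + normalDeriv ι ν u s * normalDeriv ι ν v s := by
  conv_lhs => rw [grad_eq_add_normal hΩ hν hv, inner_add_right, real_inner_smul_right,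
    inner_grad_left, ← mvfderiv_comp_embedding hΩ hu, ← inner_grad_left]
  rw [mul_comm (normalDeriv ι ν u s)]
  rfl

/-- The last coordinate vanishes along the boundary, so its gradient is normal, and its normal
derivative is positive. The right-hand side makes sense off the boundary as well: it extends ν to a
smooth ambient field, and smoothness of ν, which is not assumed, follows. -/
theorem IsSliceChart.normal_eq (hsl : IsSliceChart Ω ι e d)
    (hΩ : IsDomainWithBoundary (m := m) Ω ι)
    (hν : IsOutwardUnitNormal (m := m) Ω ι ν) (hs : s ∈ d.source) :
    0 < (inner ℝ (grad (k := m + 1) (sliceFun e) (ι s)) (grad (sliceFun e) (ι s)) : ℝ) ∧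
    ν s = (√(inner ℝ (grad (k := m + 1) (sliceFun e) (ι s)) (grad (sliceFun e) (ι s)) : ℝ))⁻¹
      • grad (sliceFun e) (ι s) := by
  have hp := (hsl.mem_source s).1 hs
  have hρ : MDifferentiableAt (𝓡 (m + 1)) 𝓘(ℝ, ℝ) (sliceFun e) (ι s) :=
    (contMDiffAt_sliceFun hsl.chart hp).mdifferentiableAt (by simp)
  have h0 : grad (k := m) (sliceFun e ∘ ι) s = 0 := by
    rw [grad_eq_iff]
    intro v
    rw [mvfderiv_comp_embedding hΩ hρ, mvfderiv_sliceFun hsl.chart hp, hsl.coords_mfderiv hΩ hs,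
      slicePoint_last, inner_zero_left]
  have hpos : 0 < normalDeriv ι ν (sliceFun e) s := by
    rw [normalDeriv, inner_grad_left, mvfderiv_sliceFun hsl.chart hp]
    exact hsl.coords_normal_pos hΩ hν hs
  have h1 := inner_grad_eq_add_normal hΩ hν hρ hρ
  rw [h0, inner_zero_left, zero_add] at h1
  rw [h1]
  refine ⟨mul_pos hpos hpos, ?_⟩
  rw [Real.sqrt_mul_self hpos.le]
  conv_rhs => rw [grad_eq_add_normal hΩ hν hρ, h0, map_zero, zero_add, smul_smul,
    inv_mul_cancel₀ hpos.ne', one_smul]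

end SliceGeometry

/-! ### The second fundamental form and the splitting of Hessian and Laplacian -/

section BoundaryGeometry

variable {m : ℕ}
  {M : Type*} [TopologicalSpace M] [ChartedSpace (EuclideanSpace ℝ (Fin (m + 1))) M]
  [IsManifold (𝓡 (m + 1)) ∞ M]
  [RiemannianBundle (fun x : M ↦ TangentSpace (𝓡 (m + 1)) x)]
  [IsContMDiffRiemannianBundle (𝓡 (m + 1)) ∞ (EuclideanSpace ℝ (Fin (m + 1)))
    (fun x : M ↦ TangentSpace (𝓡 (m + 1)) x)]
  {S : Type*} [TopologicalSpace S] [ChartedSpace (EuclideanSpace ℝ (Fin m)) S]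
  [IsManifold (𝓡 m) ∞ S]
  [RiemannianBundle (fun s : S ↦ TangentSpace (𝓡 m) s)]
  [IsContMDiffRiemannianBundle (𝓡 m) ∞ (EuclideanSpace ℝ (Fin m))
    (fun s : S ↦ TangentSpace (𝓡 m) s)]
  {Ω : Set M} {ι : S → M} {ν : ∀ s : S, TangentSpace (𝓡 (m + 1)) (ι s)}
  {e : OpenPartialHomeomorph M (EuclideanSpace ℝ (Fin (m + 1)))}
  {d : OpenPartialHomeomorph S (EuclideanSpace ℝ (Fin m))} {u : M → ℝ} {s : S}

/-- The normal derivative of `u` along the level sets of the last coordinate of `e`. -/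
def sliceNormalDeriv (e : OpenPartialHomeomorph M (EuclideanSpace ℝ (Fin (m + 1)))) (u : M → ℝ)
    (x : M) : ℝ :=
  inner ℝ (grad (k := m + 1) u x) (grad (sliceFun e) x)
    * (√(inner ℝ (grad (k := m + 1) (sliceFun e) x) (grad (sliceFun e) x) : ℝ))⁻¹

theorem IsSliceChart.normalDeriv_eq (hsl : IsSliceChart Ω ι e d)
    (hΩ : IsDomainWithBoundary (m := m) Ω ι)
    (hν : IsOutwardUnitNormal (m := m) Ω ι ν) (hs : s ∈ d.source) (u : M → ℝ) :
    normalDeriv ι ν u s = sliceNormalDeriv e u (ι s) := by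
  rw [normalDeriv, (hsl.normal_eq hΩ hν hs).2, real_inner_smul_right, mul_comm]
  rfl

theorem contMDiffAt_sliceNormalDeriv (he : IsSmoothChart e) {p : M} (hp : p ∈ e.source) {n : ℕ}
    (hu : ContMDiffAt (𝓡 (m + 1)) 𝓘(ℝ, ℝ) (n + 1 : ℕ) u p)
    (hpos : 0 < (inner ℝ (grad (k := m + 1) (sliceFun e) p) (grad (sliceFun e) p) : ℝ)) :
    ContMDiffAt (𝓡 (m + 1)) 𝓘(ℝ, ℝ) n (sliceNormalDeriv e u) p := by
  have hρ : ContMDiffAt (𝓡 (m + 1)) 𝓘(ℝ, ℝ) (n + 1 : ℕ) (sliceFun e) p :=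
    (contMDiffAt_sliceFun he hp).of_le (by exact_mod_cast le_top)
  refine (contMDiffAt_inner_grad hu hρ).mul ?_
  have h1 : ContDiffAt ℝ n (fun t : ℝ ↦ (√t)⁻¹)
      (inner ℝ (grad (k := m + 1) (sliceFun e) p) (grad (sliceFun e) p)) :=
    (Real.contDiffAt_sqrt hpos.ne').inv (Real.sqrt_pos.2 hpos).ne'
  exact ContMDiffAt.comp (g := fun t : ℝ ↦ (√t)⁻¹) p (contMDiffAt_iff_contDiffAt.2 h1) (contMDiffAt_inner_grad hρ hρ)

theorem contMDiffAt_normalDeriv (hΩ : IsDomainWithBoundary (m := m) Ω ι)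
    (hν : IsOutwardUnitNormal (m := m) Ω ι ν) {n : ℕ}
    (hu : ContMDiffAt (𝓡 (m + 1)) 𝓘(ℝ, ℝ) (n + 1 : ℕ) u (ι s)) :
    ContMDiffAt (𝓡 m) 𝓘(ℝ, ℝ) n (normalDeriv ι ν u) s := by
  obtain ⟨e, d, hsl, hs⟩ := hΩ.exists_isSliceChart s
  refine (ContMDiffAt.comp s (contMDiffAt_sliceNormalDeriv hsl.chart ((hsl.mem_source s).1 hs) hu
    (hsl.normal_eq hΩ hν hs).1)
    ((hΩ.embedding.contMDiff s).of_le (by exact_mod_cast le_top))).congr_of_eventuallyEq ?_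
  filter_upwards [d.open_source.mem_nhds hs] with t ht using hsl.normalDeriv_eq hΩ hν ht u

/-- With ν = β∇ρ, the derivative D_v ν is β∇_v∇ρ plus a multiple of ∇ρ, and the latter is orthogonal
to the boundary. -/
theorem IsSliceChart.secondFundamentalForm_eq (hsl : IsSliceChart Ω ι e d)
    (hΩ : IsDomainWithBoundary (m := m) Ω ι)
    (hν : IsOutwardUnitNormal (m := m) Ω ι ν) (hs : s ∈ d.source) (v w : TangentSpace (𝓡 m) s) :
    secondFundamentalForm ι ν s v w
      = (√(inner ℝ (grad (k := m + 1) (sliceFun e) (ι s)) (grad (sliceFun e) (ι s)) : ℝ))⁻¹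
        * hess (sliceFun e) (ι s) (mfderiv (𝓡 m) (𝓡 (m + 1)) ι s v)
          (mfderiv (𝓡 m) (𝓡 (m + 1)) ι s w) := by
  have hp := (hsl.mem_source s).1 hs
  have hρ : ContMDiffAt (𝓡 (m + 1)) 𝓘(ℝ, ℝ) 2 (sliceFun e) (ι s) :=
    (contMDiffAt_sliceFun hsl.chart hp).of_le two_le_infty
  have hρ1 : ContMDiffAt (𝓡 (m + 1)) 𝓘(ℝ, ℝ) 1 (sliceFun e) (ι s) := hρ.of_le (by norm_num)
  set c := chartAt (EuclideanSpace ℝ (Fin (m + 1))) (ι s) with hc_def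
  have hc : IsSmoothChart c := isSmoothChart_chartAt _
  have hpc : ι s ∈ c.source := mem_chart_source _ _
  have hG := isLocalMetric_chartMetric hc
  have hιs : ContMDiffAt (𝓡 m) (𝓡 (m + 1)) ∞ ι s := hΩ.embedding.contMDiff s
  set Y := localGrad (chartMetric c) (sliceFun e ∘ c.symm) with hY_def
  set β : EuclideanSpace ℝ (Fin (m + 1)) → ℝ := fun y ↦ (√(chartMetric c y (Y y) (Y y)))⁻¹ with hβ
  obtain ⟨hpos, -⟩ := hsl.normal_eq hΩ hν hs
  have hYd : DifferentiableAt ℝ Y (c (ι s)) :=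
    (hG.contDiffAt_localGrad (n := 1) (c.map_source hpc)
      (contDiffAt_comp_symm_of_mem (n := 2) hc hpc hρ)).differentiableAt (by simp)
  have hr : DifferentiableAt ℝ (fun y ↦ chartMetric c y (Y y) (Y y)) (c (ι s)) :=
    (contDiffAt_chartMetric_localGrad (n := 1) hc hpc hρ hρ).differentiableAt (by simp)
  have hr0 : 0 < chartMetric c (c (ι s)) (Y (c (ι s))) (Y (c (ι s))) := by
    rw [hY_def, ← inner_grad_eq hc hpc hρ1 hρ1]
    exact hpos
  have hβd : DifferentiableAt ℝ β (c (ι s)) :=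
    (hr.sqrt hr0.ne').inv (Real.sqrt_pos.2 hr0).ne'
  have hW : ∀ᶠ t in 𝓝 s, coords c (ι t) (ν t) = β (c (ι t)) • Y (c (ι t)) := by
    filter_upwards [d.open_source.mem_nhds hs,
      hιs.continuousAt.preimage_mem_nhds (c.open_source.mem_nhds hpc)] with t ht htc
    have hρt : ContMDiffAt (𝓡 (m + 1)) 𝓘(ℝ, ℝ) 1 (sliceFun e) (ι t) :=
      (contMDiffAt_sliceFun hsl.chart ((hsl.mem_source t).1 ht)).of_le (by simp)
    rw [(hsl.normal_eq hΩ hν ht).2, coords_smul, coords_grad hc htc hρt,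
      inner_grad_eq hc htc hρt hρt]
  have h1 := coords_covDerivAlong (hιs.mdifferentiableAt (by simp)) hc_def
    (W := fun y ↦ β y • Y y) (hβd.fun_smul hYd) hW v
  have h2 : chartMetric c (c (ι s)) (Y (c (ι s)))
      (coords c (ι s) (mfderiv (𝓡 m) (𝓡 (m + 1)) ι s w)) = 0 := by
    rw [hY_def, ← coords_grad hc hpc hρ1, ← inner_eq_chartMetric hc hpc, inner_grad_left,
      mvfderiv_sliceFun hsl.chart hp, hsl.coords_mfderiv hΩ hs, slicePoint_last]
  rw [secondFundamentalForm, inner_eq_chartMetric hc hpc, h1, hess_eq_nablaGrad hc hpc hρ,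
    covDerivOp_apply, fderiv_fun_smul hβd hYd, nablaGrad, covDerivOp_apply,
    inner_grad_eq hc hpc hρ1 hρ1]
  simp only [add_apply, map_add, FunLike.coe_smul, Pi.smul_apply, map_smul, smul_eq_mul,
    ContinuousLinearMap.smulRight_apply, h2, mul_zero, add_zero, hβ, ← hY_def]
  ring

/-- The Gauss formula for the Hessian of a function at the boundary. -/
theorem hess_eq_hess_comp_add (hΩ : IsDomainWithBoundary (m := m) Ω ι)
    (hν : IsOutwardUnitNormal (m := m) Ω ι ν)
    (hu : ContMDiffAt (𝓡 (m + 1)) 𝓘(ℝ, ℝ) 2 u (ι s)) (v w : TangentSpace (𝓡 m) s) :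
    hess u (ι s) (mfderiv (𝓡 m) (𝓡 (m + 1)) ι s v) (mfderiv (𝓡 m) (𝓡 (m + 1)) ι s w)
      = hess (u ∘ ι) s v w + normalDeriv ι ν u s * secondFundamentalForm ι ν s v w := by
  obtain ⟨e, d, hsl, hs⟩ := hΩ.exists_isSliceChart s
  have hp := (hsl.mem_source s).1 hs
  have hρ : ContMDiffAt (𝓡 (m + 1)) 𝓘(ℝ, ℝ) 2 (sliceFun e) (ι s) :=
    (contMDiffAt_sliceFun hsl.chart hp).of_le two_le_infty
  have hρd : MDifferentiableAt (𝓡 (m + 1)) 𝓘(ℝ, ℝ) (sliceFun e) (ι s) :=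
    hρ.mdifferentiableAt (by simp)
  have hud : MDifferentiableAt (𝓡 (m + 1)) 𝓘(ℝ, ℝ) u (ι s) := hu.mdifferentiableAt (by simp)
  have hι := hΩ.embedding.contMDiff
  obtain ⟨hpos, hνe⟩ := hsl.normal_eq hΩ hν hs
  set β := (√(inner ℝ (grad (k := m + 1) (sliceFun e) (ι s)) (grad (sliceFun e) (ι s)) : ℝ))⁻¹
    with hβ
  -- The multiple of the last coordinate that removes the normal derivative of `u`. The corrected
  -- function has the same restriction to the boundary and a tangential gradient, so the isometric
  -- comparison of Hessians applies to it.
  set c : ℝ := -(normalDeriv ι ν u s * β) with hc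
  set a : M → ℝ := fun x ↦ u x + c * sliceFun e x with ha_def
  have ha : ContMDiffAt (𝓡 (m + 1)) 𝓘(ℝ, ℝ) 2 a (ι s) := hu.add (contMDiffAt_const.mul hρ)
  have hga : grad (k := m + 1) a (ι s) = grad u (ι s) - normalDeriv ι ν u s • ν s := by
    have hcd : MDifferentiableAt (𝓡 (m + 1)) 𝓘(ℝ, ℝ) (fun x ↦ c * sliceFun e x) (ι s) :=
      mdifferentiableAt_const.mul hρd
    rw [ha_def, grad_add hud hcd, grad_const_mul c hρd, hνe, smul_smul,
      hc, neg_smul, sub_eq_add_neg]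
  have han : normalDeriv ι ν a s = 0 := by
    rw [normalDeriv, hga, inner_sub_left, real_inner_smul_left, inner_normal_self hν, mul_one]
    exact sub_self _
  have hac : a ∘ ι =ᶠ[𝓝 s] u ∘ ι := by
    filter_upwards [d.open_source.mem_nhds hs] with t ht
    simp only [ha_def, Function.comp, sliceFun, hsl.apply_eq t ht, slicePoint_last, mul_zero,
      add_zero]
  have h1 := hess_comp_of_isometric hι hΩ.isometric ha (by
    rw [grad_eq_add_normal hΩ hν (ha.mdifferentiableAt (by simp)), han, zero_smul, add_zero]) v w
  rw [ha_def, hess_add_const_mul c hu hρ, ← ha_def, hess_congr hac (ContMDiffAt.comp s ha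
    ((hι s).of_le two_le_infty))] at h1
  rw [← h1, hsl.secondFundamentalForm_eq hΩ hν hs, ← hβ, hc]
  ring

/-- The trace is taken over the tangent space of the boundary, where the Gauss formula applies, and
the normal line. The drift splits likewise, and its normal part turns H into H_φ. -/
theorem weightedLaplacian_eq_add (hΩ : IsDomainWithBoundary (m := m) Ω ι)
    (hν : IsOutwardUnitNormal (m := m) Ω ι ν) {φ : M → ℝ}
    (hφ : MDifferentiableAt (𝓡 (m + 1)) 𝓘(ℝ, ℝ) φ (ι s))
    (hu : ContMDiffAt (𝓡 (m + 1)) 𝓘(ℝ, ℝ) 2 u (ι s)) :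
    weightedLaplacian (k := m + 1) φ u (ι s) = weightedLaplacian (k := m) (φ ∘ ι) (u ∘ ι) s
      + weightedMeanCurvature ι ν φ s * normalDeriv ι ν u s + hess u (ι s) (ν s) (ν s) := by
  set c := chartAt (EuclideanSpace ℝ (Fin (m + 1))) (ι s) with hc_def
  have hc : IsSmoothChart c := isSmoothChart_chartAt _
  have hpc : ι s ∈ c.source := mem_chart_source _ _
  obtain ⟨A, hA, -, -⟩ := exists_endomorphism_coords hc hpc (nablaGrad c u (c (ι s)))
  have hAu : ∀ v w, hess u (ι s) v w = inner ℝ (A v) w := fun v w ↦ by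
    rw [hess_eq_nablaGrad hc hpc hu, inner_eq_chartMetric hc hpc, hA]
  have hdim : Module.finrank ℝ (TangentSpace (𝓡 (m + 1)) (ι s))
      = Module.finrank ℝ (TangentSpace (𝓡 m) s) + 1 := by
    have h1 : Module.finrank ℝ (TangentSpace (𝓡 (m + 1)) (ι s)) = m + 1 :=
      finrank_euclideanSpace_fin
    have h2 : Module.finrank ℝ (TangentSpace (𝓡 m) s) = m := finrank_euclideanSpace_fin
    rw [h1, h2]
  have htr := bilinTrace_eq_add A (mfderiv (𝓡 m) (𝓡 (m + 1)) ι s).toLinearMap (ν s)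
    (fun v w ↦ hΩ.isometric s v w) (hν.norm_eq s) (fun v ↦ hν.orthogonal s v) hdim
  have h1 : bilinTrace (fun v w ↦ inner ℝ (A v) w) = bilinTrace (hess (k := m + 1) u (ι s)) := by
    congr 1
    ext v w
    exact (hAu v w).symm
  have h2 : bilinTrace (fun v w ↦ (inner ℝ (A ((mfderiv (𝓡 m) (𝓡 (m + 1)) ι s).toLinearMap v))
      ((mfderiv (𝓡 m) (𝓡 (m + 1)) ι s).toLinearMap w) : ℝ))
      = bilinTrace (hess (k := m) (u ∘ ι) s)
        + normalDeriv ι ν u s * bilinTrace (secondFundamentalForm ι ν s) := by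
    rw [bilinTrace, bilinTrace, bilinTrace, Finset.mul_sum, ← Finset.sum_add_distrib]
    refine Finset.sum_congr rfl fun i _ ↦ ?_
    rw [← hAu]
    exact hess_eq_hess_comp_add hΩ hν hu _ _
  rw [h1, h2, ← hAu] at htr
  rw [weightedLaplacian, htr, weightedLaplacian, weightedMeanCurvature,
    inner_grad_eq_add_normal hΩ hν hφ (hu.mdifferentiableAt (by simp))]
  ring

/-- The product rule for ⟨∇u, ν⟩: as ν has unit length, D_v ν is tangent, so only the tangential
part Du pairs with it, giving A(v, Du). The proof differentiates the ambient extension ⟨∇u,∇ρ⟩/|∇ρ|.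
-/
theorem mvfderiv_normalDeriv (hΩ : IsDomainWithBoundary (m := m) Ω ι)
    (hν : IsOutwardUnitNormal (m := m) Ω ι ν)
    (hu : ContMDiffAt (𝓡 (m + 1)) 𝓘(ℝ, ℝ) 2 u (ι s)) (v : TangentSpace (𝓡 m) s) :
    mvfderiv (𝓡 m) (normalDeriv ι ν u) s v
      = hess u (ι s) (mfderiv (𝓡 m) (𝓡 (m + 1)) ι s v) (ν s)
        + secondFundamentalForm ι ν s v (grad (u ∘ ι) s) := by
  obtain ⟨e, d, hsl, hs⟩ := hΩ.exists_isSliceChart s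
  have hp := (hsl.mem_source s).1 hs
  have hρ : ContMDiffAt (𝓡 (m + 1)) 𝓘(ℝ, ℝ) 2 (sliceFun e) (ι s) :=
    (contMDiffAt_sliceFun hsl.chart hp).of_le two_le_infty
  have hud : MDifferentiableAt (𝓡 (m + 1)) 𝓘(ℝ, ℝ) u (ι s) := hu.mdifferentiableAt (by simp)
  obtain ⟨hpos, hνe⟩ := hsl.normal_eq hΩ hν hs
  have hq : ContMDiffAt (𝓡 (m + 1)) 𝓘(ℝ, ℝ) 1 (sliceNormalDeriv e u) (ι s) :=
    contMDiffAt_sliceNormalDeriv (n := 1) hsl.chart hp hu hpos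
  have hnear : normalDeriv ι ν u =ᶠ[𝓝 s] sliceNormalDeriv e u ∘ ι := by
    filter_upwards [d.open_source.mem_nhds hs] with t ht using hsl.normalDeriv_eq hΩ hν ht u
  have h0 : mvfderiv (𝓡 m) (normalDeriv ι ν u) s v
      = mvfderiv (𝓡 (m + 1)) (sliceNormalDeriv e u) (ι s)
        (mfderiv (𝓡 m) (𝓡 (m + 1)) ι s v) := by
    rw [← mvfderiv_comp_embedding hΩ (hq.mdifferentiableAt (by simp))]
    exact DFunLike.congr_fun (hnear.mfderiv_eq (I := 𝓡 m) (I' := 𝓘(ℝ, ℝ))) v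
  set V := mfderiv (𝓡 m) (𝓡 (m + 1)) ι s v with hV
  set a : M → ℝ := fun x ↦ inner ℝ (grad (k := m + 1) u x) (grad (sliceFun e) x) with ha
  set r : M → ℝ := fun x ↦ inner ℝ (grad (k := m + 1) (sliceFun e) x) (grad (sliceFun e) x) with hr
  have haC : ContMDiffAt (𝓡 (m + 1)) 𝓘(ℝ, ℝ) 1 a (ι s) := contMDiffAt_inner_grad (n := 1) hu hρ
  have hrC : ContMDiffAt (𝓡 (m + 1)) 𝓘(ℝ, ℝ) 1 r (ι s) := contMDiffAt_inner_grad (n := 1) hρ hρ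
  have had : HasFDerivAt (a ∘ e.symm) (fderiv ℝ (a ∘ e.symm) (e (ι s))) (e (ι s)) :=
    ((contDiffAt_comp_symm_of_mem (n := 1) hsl.chart hp haC).differentiableAt (by simp)).hasFDerivAt
  have hrd : HasFDerivAt (r ∘ e.symm) (fderiv ℝ (r ∘ e.symm) (e (ι s))) (e (ι s)) :=
    ((contDiffAt_comp_symm_of_mem (n := 1) hsl.chart hp hrC).differentiableAt (by simp)).hasFDerivAt
  have hr0 : (r ∘ e.symm) (e (ι s)) = r (ι s) := by simp only [Function.comp, e.left_inv hp]
  have ha0 : (a ∘ e.symm) (e (ι s)) = a (ι s) := by simp only [Function.comp, e.left_inv hp]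
  have hrpos : 0 < r (ι s) := hpos
  have hsq : HasFDerivAt (fun y ↦ √((r ∘ e.symm) y)) _ (e (ι s)) :=
    hrd.sqrt (by rw [hr0]; exact hrpos.ne')
  have hinv := (hasDerivAt_inv (x := √((r ∘ e.symm) (e (ι s))))
    (by rw [hr0]; exact (Real.sqrt_pos.2 hrpos).ne')).comp_hasFDerivAt (e (ι s)) hsq
  have hmul := had.mul hinv
  have hfd : fderiv ℝ (sliceNormalDeriv e u ∘ e.symm) (e (ι s)) = _ := hmul.fderiv
  have hda := mvfderiv_inner_grad hu hρ V
  have hdr := mvfderiv_inner_grad hρ hρ V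
  rw [mvfderiv_eq_fderiv_symm hsl.chart hp haC] at hda
  rw [mvfderiv_eq_fderiv_symm hsl.chart hp hrC] at hdr
  have hgrad := grad_eq_add_normal hΩ hν hud
  have hgρ : grad (k := m + 1) (sliceFun e) (ι s) = √(r (ι s)) • ν s := by
    rw [hνe, smul_smul, mul_inv_cancel₀ (Real.sqrt_pos.2 hrpos).ne', one_smul]
  have hau : a (ι s) = normalDeriv ι ν u s * √(r (ι s)) := by
    rw [hsl.normalDeriv_eq hΩ hν hs, sliceNormalDeriv, mul_assoc]
    rw [inv_mul_cancel₀ (Real.sqrt_pos.2 hrpos).ne', mul_one]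
  have hA := hsl.secondFundamentalForm_eq hΩ hν hs v (grad (u ∘ ι) s)
  change _ = (√(r (ι s)))⁻¹ * hess (sliceFun e) (ι s) V _ at hA
  rw [h0, mvfderiv_eq_fderiv_symm hsl.chart hp hq, hfd, hA]
  simp only [add_apply, FunLike.coe_smul, Pi.smul_apply, smul_eq_mul, hda, hdr, Function.comp,
    e.left_inv hp]
  -- With ∇ρ = √r ν, the derivative of the factor 1/|∇ρ| cancels the term in which ∇²ρ is paired
  -- with the normal part of ∇u.
  rw [hgrad, hgρ, hess_add_right, hess_smul_right, hess_smul_right, hess_smul_right, hau]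
  have hσ := Real.sq_sqrt hrpos.le
  have hσ0 := (Real.sqrt_pos.2 hrpos).ne'
  field_simp
  ring

end BoundaryGeometry

/-! ### Green's formula -/

/-! ### Localization by partitions of unity -/

section Gluing

variable {k : ℕ} {X : Type*} [TopologicalSpace X] [ChartedSpace (EuclideanSpace ℝ (Fin k)) X]
  [IsManifold (𝓡 k) ∞ X] [T2Space X] [SecondCountableTopology X]

/-- By local finiteness only finitely many members of a smooth partition of unity meet a compact
neighbourhood of `K`. The sum is 1 near `K`, and not only on it, so that the gradients of the
members add up to zero on `K`. -/
theorem exists_finite_partitionOfUnity {K : Set X} (hK : IsCompact K) {U : X → Set X}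
    (hU : ∀ x, U x ∈ 𝓝 x) :
    ∃ (I : Finset X) (η : X → X → ℝ), (∀ i, ContMDiff (𝓡 k) 𝓘(ℝ, ℝ) ∞ (η i)) ∧
      (∀ i, tsupport (η i) ⊆ U i) ∧ (∀ i x, 0 ≤ η i x) ∧ (∀ x, ∑ i ∈ I, η i x ≤ 1) ∧
      ∀ x ∈ K, ∀ᶠ y in 𝓝 x, ∑ i ∈ I, η i y = 1 := by
  classical
  have : LocallyCompactSpace X := ChartedSpace.locallyCompactSpace (EuclideanSpace ℝ (Fin k)) X
  obtain ⟨K', hK', hKK'⟩ := exists_compact_superset hK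
  obtain ⟨η, hη⟩ := SmoothPartitionOfUnity.exists_isSubordinate (𝓡 k) isClosed_univ
    (fun x ↦ interior (U x)) (fun x ↦ isOpen_interior)
    fun x _ ↦ mem_iUnion.2 ⟨x, mem_interior_iff_mem_nhds.2 (hU x)⟩
  have hfin := η.locallyFinite.finite_nonempty_inter_compact hK'
  have hsub : ∀ x, (η.finsupport x : Set X) ⊆ {i | η i x ≠ 0} := fun x i hi ↦ by
    simpa using hi
  refine ⟨hfin.toFinset, fun i ↦ η i, fun i ↦ (η i).contMDiff,
    fun i ↦ (hη i).trans interior_subset, fun i x ↦ η.nonneg i x, fun x ↦ ?_, fun x hx ↦ ?_⟩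
  · refine le_trans ?_ (η.sum_le_one x)
    rw [finsum_eq_sum_of_support_subset (s := hfin.toFinset ∪ η.finsupport x)]
    · exact Finset.sum_le_sum_of_subset_of_nonneg Finset.subset_union_left
        fun i _ _ ↦ η.nonneg i x
    · intro i hi
      rw [Finset.coe_union]
      exact Or.inr (by simpa using hi)
  · filter_upwards [isOpen_interior.mem_nhds (hKK' hx)] with y hy
    refine η.sum_finsupport' y (mem_univ y) fun i hi ↦ ?_
    rw [Set.Finite.mem_toFinset]
    exact ⟨y, hsub y hi, interior_subset hy⟩

/-- An additive functional on compactly supported functions that vanishes on the functions with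
small support is zero. -/
theorem eq_zero_of_locally_eq_zero {C : Set X} {Φ : (X → ℝ) → ℝ}
    (hadd : ∀ u u' : X → ℝ, ∀ K K' : Set X, IsCompact K → IsCompact K' → (∀ x ∉ K, u x = 0) →
      (∀ x ∉ K', u' x = 0) → (∀ x ∈ C, ContMDiffAt (𝓡 k) 𝓘(ℝ, ℝ) 1 u x) →
      (∀ x ∈ C, ContMDiffAt (𝓡 k) 𝓘(ℝ, ℝ) 1 u' x) → Φ (fun x ↦ u x + u' x) = Φ u + Φ u')
    (hloc : ∀ x, ∃ U ∈ 𝓝 x, ∀ u : X → ℝ, ∀ K ⊆ U, IsCompact K → (∀ x ∉ K, u x = 0) →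
      (∀ x ∈ C, ContMDiffAt (𝓡 k) 𝓘(ℝ, ℝ) 1 u x) → Φ u = 0)
    {u : X → ℝ} {K : Set X} (hK : IsCompact K) (hu0 : ∀ x ∉ K, u x = 0)
    (hu : ∀ x ∈ C, ContMDiffAt (𝓡 k) 𝓘(ℝ, ℝ) 1 u x) : Φ u = 0 := by
  classical
  choose U hU hΦ using hloc
  obtain ⟨I, η, hη, hηU, -, -, hη1⟩ := exists_finite_partitionOfUnity (k := k) hK hU
  have hηu : ∀ i, ∀ x ∉ K, η i x * u x = 0 := fun i x hx ↦ by rw [hu0 x hx, mul_zero]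
  have hηC : ∀ i, ∀ x ∈ C, ContMDiffAt (𝓡 k) 𝓘(ℝ, ℝ) 1 (fun x ↦ η i x * u x) x := fun i x hx ↦
    ((hη i).contMDiffAt.of_le (by simp)).mul (hu x hx)
  have h0 : Φ (fun _ ↦ 0) = 0 := by
    have := hadd (fun _ ↦ 0) (fun _ ↦ 0) ∅ ∅ isCompact_empty isCompact_empty (fun _ _ ↦ rfl)
      (fun _ _ ↦ rfl) (fun _ _ ↦ contMDiffAt_const) (fun _ _ ↦ contMDiffAt_const)
    simpa using this
  have hsum : ∀ J : Finset X, Φ (fun x ↦ ∑ i ∈ J, η i x * u x) = 0 := by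
    intro J
    induction J using Finset.induction_on with
    | empty => simpa using h0
    | insert i J hi ih =>
      simp only [Finset.sum_insert hi]
      rw [hadd (fun x ↦ η i x * u x) (fun x ↦ ∑ i ∈ J, η i x * u x) K K hK hK (hηu i)
        (fun x hx ↦ Finset.sum_eq_zero fun j _ ↦ hηu j x hx) (hηC i)
        (fun x hx ↦ ContMDiffAt.sum fun j _ ↦ hηC j x hx), ih, add_zero]
      refine hΦ i _ (K ∩ tsupport (η i)) (inter_subset_right.trans (hηU i))
        (hK.inter_right (isClosed_tsupport _)) (fun x hx ↦ ?_) (hηC i)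
      by_cases hxK : x ∈ K
      · rw [image_eq_zero_of_notMem_tsupport fun h ↦ hx ⟨hxK, h⟩, zero_mul]
      · exact hηu i x hxK
  have hfin : (fun x ↦ ∑ i ∈ I, η i x * u x) = u := by
    ext x
    rw [← Finset.sum_mul]
    by_cases hx : x ∈ K
    · rw [(hη1 x hx).self_of_nhds, one_mul]
    · rw [hu0 x hx, mul_zero]
  rw [← hfin]
  exact hsum I

end Gluing

theorem integrableOn_of_continuousAt {X : Type*} [TopologicalSpace X] [T2Space X]
    [MeasurableSpace X] [BorelSpace X] {μ : Measure X} [IsLocallyFiniteMeasure μ] {F : X → ℝ}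
    {Ω K : Set X} (hΩ : MeasurableSet Ω) (hK : IsCompact K) (hF0 : ∀ x ∉ K, F x = 0)
    (hF : ∀ x ∈ closure Ω, x ∈ K → ContinuousAt F x) : IntegrableOn F Ω μ := by
  have h1 : IntegrableOn F (K ∩ closure Ω) μ :=
    ContinuousOn.integrableOn_compact' (hK.inter_right isClosed_closure)
      (hK.inter_right isClosed_closure).measurableSet
      fun x hx ↦ (hF x hx.2 hx.1).continuousWithinAt
  refine (h1.mono_set (s := Ω ∩ K) fun x hx ↦ ⟨hx.2, subset_closure hx.1⟩).of_forall_sdiff_eq_zero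
    hΩ fun x hx ↦ hF0 x fun h ↦ hx.2 ⟨hx.1, h⟩

/-! ### Green's formula without boundary term -/

section GreenClosed

variable {n : ℕ} {X : Type*} [TopologicalSpace X] [T2Space X]
  [ChartedSpace (EuclideanSpace ℝ (Fin (n + 1))) X]
  [IsManifold (𝓡 (n + 1)) ∞ X]
  [RiemannianBundle (fun x : X ↦ TangentSpace (𝓡 (n + 1)) x)]
  [IsContMDiffRiemannianBundle (𝓡 (n + 1)) ∞ (EuclideanSpace ℝ (Fin (n + 1)))
    (fun x : X ↦ TangentSpace (𝓡 (n + 1)) x)]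
  [MeasurableSpace X] [BorelSpace X] [SecondCountableTopology X]
  {ψ u v : X → ℝ}

theorem greenIntegrand_add {k : ℕ} {X : Type*} [TopologicalSpace X]
    [ChartedSpace (EuclideanSpace ℝ (Fin k)) X] [IsManifold (𝓡 k) ∞ X]
    [RiemannianBundle (fun x : X ↦ TangentSpace (𝓡 k) x)]
    [IsContMDiffRiemannianBundle (𝓡 k) ∞ (EuclideanSpace ℝ (Fin k))
      (fun x : X ↦ TangentSpace (𝓡 k) x)] {ψ u u' v : X → ℝ} {p : X}
    (hu : MDifferentiableAt (𝓡 k) 𝓘(ℝ, ℝ) u p) (hu' : MDifferentiableAt (𝓡 k) 𝓘(ℝ, ℝ) u' p) :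
    greenIntegrand (k := k) ψ (fun x ↦ u x + u' x) v p
      = greenIntegrand (k := k) ψ u v p + greenIntegrand (k := k) ψ u' v p := by
  rw [greenIntegrand, grad_add hu hu', inner_add_left, greenIntegrand, greenIntegrand]
  ring

theorem integrableOn_greenIntegrand (hψ : ContMDiff (𝓡 (n + 1)) 𝓘(ℝ, ℝ) ∞ ψ) {Ω K : Set X}
    (hΩ : MeasurableSet Ω) (hK : IsCompact K) (huK : ∀ x ∉ K, u x = 0)
    (hu : ∀ x ∈ closure Ω, ContMDiffAt (𝓡 (n + 1)) 𝓘(ℝ, ℝ) 1 u x)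
    (hv : ∀ x ∈ closure Ω, ContMDiffAt (𝓡 (n + 1)) 𝓘(ℝ, ℝ) 2 v x) :
    IntegrableOn (greenIntegrand (k := n + 1) ψ u v) Ω (weightedVolume (k := n + 1) ψ) := by
  have := isLocallyFiniteMeasure_weightedVolume (k := n + 1) hψ.continuous
  refine integrableOn_of_continuousAt hΩ hK (fun x hx ↦ greenIntegrand_eq_zero ?_)
    fun x hx _ ↦ continuousAt_greenIntegrand hψ (hu x hx) (hv x hx)
  filter_upwards [hK.isClosed.isOpen_compl.mem_nhds hx] with z hz using huK z hz

/-- Green's formula on a manifold without boundary. -/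
theorem integral_greenIntegrand_eq_zero (hψ : ContMDiff (𝓡 (n + 1)) 𝓘(ℝ, ℝ) ∞ ψ) {K : Set X}
    (hK : IsCompact K) (huK : ∀ x ∉ K, u x = 0)
    (hu : ∀ x, ContMDiffAt (𝓡 (n + 1)) 𝓘(ℝ, ℝ) 1 u x)
    (hv : ∀ x, ContMDiffAt (𝓡 (n + 1)) 𝓘(ℝ, ℝ) 2 v x) :
    ∫ x, greenIntegrand (k := n + 1) ψ u v x ∂(weightedVolume (k := n + 1) ψ) = 0 := by
  refine eq_zero_of_locally_eq_zero (k := n + 1) (C := univ)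
    (Φ := fun u ↦ ∫ x, greenIntegrand (k := n + 1) ψ u v x ∂(weightedVolume (k := n + 1) ψ))
    ?_ ?_ hK huK (fun x _ ↦ hu x)
  · intro u u' K K' hK hK' hu0 hu0' hu hu'
    have h1 := integrableOn_greenIntegrand hψ MeasurableSet.univ hK hu0
      (fun x _ ↦ hu x trivial) (fun x _ ↦ hv x)
    have h2 := integrableOn_greenIntegrand hψ MeasurableSet.univ hK' hu0'
      (fun x _ ↦ hu' x trivial) (fun x _ ↦ hv x)
    rw [integrableOn_univ] at h1 h2
    rw [← integral_add h1 h2]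
    exact integral_congr_ae (Eventually.of_forall fun x ↦ greenIntegrand_add
      ((hu x trivial).mdifferentiableAt (by simp)) ((hu' x trivial).mdifferentiableAt (by simp)))
  · intro x
    refine ⟨_, (chartAt (EuclideanSpace ℝ (Fin (n + 1))) x).open_source.mem_nhds
      (mem_chart_source _ x), fun u K hKs hK hu0 hu ↦ ?_⟩
    rw [← setIntegral_univ]
    exact integral_greenIntegrand_chart_interior (isSmoothChart_chartAt x) hψ MeasurableSet.univ hK
      hKs (subset_univ _) hu0 (fun y _ ↦ hu y trivial) (fun y _ ↦ hv y)

end GreenClosed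

/-! ### Green's formula with boundary term -/

section BoundaryGreen

variable {m : ℕ}
  {M : Type*} [TopologicalSpace M] [ChartedSpace (EuclideanSpace ℝ (Fin (m + 1))) M]
  [IsManifold (𝓡 (m + 1)) ∞ M]
  [RiemannianBundle (fun x : M ↦ TangentSpace (𝓡 (m + 1)) x)]
  [IsContMDiffRiemannianBundle (𝓡 (m + 1)) ∞ (EuclideanSpace ℝ (Fin (m + 1)))
    (fun x : M ↦ TangentSpace (𝓡 (m + 1)) x)]
  {S : Type*} [TopologicalSpace S] [ChartedSpace (EuclideanSpace ℝ (Fin m)) S]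
  [IsManifold (𝓡 m) ∞ S]
  [RiemannianBundle (fun s : S ↦ TangentSpace (𝓡 m) s)]
  [IsContMDiffRiemannianBundle (𝓡 m) ∞ (EuclideanSpace ℝ (Fin m))
    (fun s : S ↦ TangentSpace (𝓡 m) s)]
  {Ω : Set M} {ι : S → M} {ν : ∀ s : S, TangentSpace (𝓡 (m + 1)) (ι s)}
  {e : OpenPartialHomeomorph M (EuclideanSpace ℝ (Fin (m + 1)))}
  {d : OpenPartialHomeomorph S (EuclideanSpace ℝ (Fin m))} {u : M → ℝ} {s : S}

namespace IsSliceChart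

/-- The Gram matrix of the boundary is the leading block of the ambient one. By the cofactor formula
the quotient of the determinants is the last diagonal entry of g⁻¹, which is |∇ρ|² for the last
coordinate ρ. -/
theorem det_gram_eq (hsl : IsSliceChart Ω ι e d) (hΩ : IsDomainWithBoundary (m := m) Ω ι)
    (hs : s ∈ d.source) :
    (gram d (d s)).det = inner ℝ (grad (k := m + 1) (sliceFun e) (ι s)) (grad (sliceFun e) (ι s))
      * (gram e (e (ι s))).det := by
  have hp := (hsl.mem_source s).1 hs
  have he := hsl.chart
  have hG := isLocalMetric_chartMetric he
  have hy := e.map_source hp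
  have hρ : ContMDiffAt (𝓡 (m + 1)) 𝓘(ℝ, ℝ) 1 (sliceFun e) (ι s) :=
    (contMDiffAt_sliceFun he hp).of_le (by simp)
  have hsub : (gram e (e (ι s))).submatrix Fin.castSucc Fin.castSucc = gram d (d s) := by
    ext i j
    have hv : ∀ i : Fin m, ∃ v : TangentSpace (𝓡 m) s, coords d s v = stdVec i := fun i ↦
      hsl.boundary_chart.exists_coords_eq hs _
    obtain ⟨v, hv'⟩ := hv i
    obtain ⟨w, hw'⟩ := hv j
    have hst : ∀ i : Fin m, slicePoint (stdVec i) 0 = stdVec i.castSucc := fun i ↦ by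
      ext l
      refine Fin.lastCases ?_ (fun l ↦ ?_) l
      · simp [(Fin.castSucc_lt_last i).ne']
      · simp
    rw [Matrix.submatrix_apply, ← gramMatrix_chartMetric, ← gramMatrix_chartMetric]
    simp only [gramMatrix, Matrix.of_apply]
    rw [← hst, ← hst, ← hv', ← hw', ← hsl.coords_mfderiv hΩ hs, ← hsl.coords_mfderiv hΩ hs,
      ← inner_eq_chartMetric he hp, hΩ.isometric, inner_eq_chartMetric hsl.boundary_chart hs]
  have hpos := det_gram_pos he hy
  have hr : inner ℝ (grad (k := m + 1) (sliceFun e) (ι s)) (grad (sliceFun e) (ι s))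
      = (gram e (e (ι s)))⁻¹ (Fin.last m) (Fin.last m) := by
    rw [inner_grad_left, mvfderiv_sliceFun he hp, coords_grad he hp hρ,
      apply_eq_sum_gramMatrix_inv (hG.symm _ hy) (hG.pos _ hy), gramMatrix_chartMetric]
    have h1 : ∀ j, chartMetric e (e (ι s))
        (localGrad (chartMetric e) (sliceFun e ∘ e.symm) (e (ι s))) (stdVec j)
          = (stdVec j : EuclideanSpace ℝ (Fin (m + 1))) (Fin.last m) := by
      intro j
      obtain ⟨w, hw⟩ := he.exists_coords_eq hp (stdVec j)
      rw [← coords_grad he hp hρ, ← hw, ← inner_eq_chartMetric he hp, inner_grad_left,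
        mvfderiv_sliceFun he hp]
    simp [h1]
  rw [hr, Matrix.inv_def, Matrix.smul_apply, Ring.inverse_eq_inv', smul_eq_mul,
    Matrix.adjugate_fin_succ_eq_det_submatrix, Fin.succAbove_last, hsub, Even.neg_one_pow ⟨_, rfl⟩,
    one_mul, mul_comm, mul_inv_cancel_left₀ hpos.ne']

/-- The last component of ∇v is ⟨∇v,∇ρ⟩ = |∇ρ| v_ν, and the factor |∇ρ| converts the volume density
into the area density. -/
theorem greenField_slicePoint (hsl : IsSliceChart Ω ι e d)
    (hΩ : IsDomainWithBoundary (m := m) Ω ι)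
    (hν : IsOutwardUnitNormal (m := m) Ω ι ν) {ψ v : M → ℝ} (hs : s ∈ d.source)
    (hv : ContMDiffAt (𝓡 (m + 1)) 𝓘(ℝ, ℝ) 1 v (ι s)) :
    greenField e ψ u v (e (ι s)) (Fin.last m)
      = chartDensity d (ψ ∘ ι) (d s) * (u (ι s) * normalDeriv ι ν v s) := by
  have hp := (hsl.mem_source s).1 hs
  have hpos := (hsl.normal_eq hΩ hν hs).1
  rw [greenField, PiLp.smul_apply, ← coords_grad hsl.chart hp hv, ← mvfderiv_sliceFun hsl.chart hp,
    ← inner_grad_left, hsl.normalDeriv_eq hΩ hν hs, sliceNormalDeriv, chartDensity, chartDensity,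
    e.left_inv hp, d.left_inv hs, hsl.det_gram_eq hΩ hs, Real.sqrt_mul hpos.le, smul_eq_mul,
    real_inner_comm]
  have h0 := (Real.sqrt_pos.2 hpos).ne'
  simp only [Function.comp]
  field_simp

end IsSliceChart

variable [T2Space M] [MeasurableSpace M] [BorelSpace M] [SecondCountableTopology M]
  [T2Space S] [MeasurableSpace S] [BorelSpace S] [SecondCountableTopology S] {ψ v : M → ℝ}

theorem isClosedEmbedding_of_isDomainWithBoundary (hΩ : IsDomainWithBoundary (m := m) Ω ι) :
    Topology.IsClosedEmbedding ι :=
  ⟨hΩ.embedding.isEmbedding, by rw [hΩ.range_eq]; exact isClosed_frontier⟩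

theorem mem_closure_of_isDomainWithBoundary (hΩ : IsDomainWithBoundary (m := m) Ω ι) (s : S) :
    ι s ∈ closure Ω :=
  frontier_subset_closure (hΩ.range_eq ▸ mem_range_self s)

theorem continuous_mul_normalDeriv (hΩ : IsDomainWithBoundary (m := m) Ω ι)
    (hν : IsOutwardUnitNormal (m := m) Ω ι ν) {K : Set M} (hK : IsCompact K)
    (huK : ∀ x ∉ K, u x = 0) (hu : ∀ x ∈ closure Ω, ContinuousAt u x)
    (hv : ∀ x ∈ closure Ω, x ∈ K → ContMDiffAt (𝓡 (m + 1)) 𝓘(ℝ, ℝ) 1 v x) :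
    Continuous fun s ↦ u (ι s) * normalDeriv ι ν v s := by
  rw [continuous_iff_continuousAt]
  intro s
  have hι : Continuous ι := hΩ.embedding.isEmbedding.continuous
  have hc := mem_closure_of_isDomainWithBoundary hΩ s
  by_cases hs : ι s ∈ K
  · exact ((hu _ hc).comp hι.continuousAt).mul
      (contMDiffAt_normalDeriv (n := 0) hΩ hν (hv _ hc hs)).continuousAt
  · have h0 : (fun s ↦ u (ι s) * normalDeriv ι ν v s) =ᶠ[𝓝 s] fun _ ↦ 0 := by
      filter_upwards [(hK.isClosed.isOpen_compl.preimage hι).mem_nhds hs] with t ht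
      rw [huK _ ht, zero_mul]
    exact continuousAt_const.congr h0.symm

theorem integrable_mul_normalDeriv (hψ : ContMDiff (𝓡 (m + 1)) 𝓘(ℝ, ℝ) ∞ ψ)
    (hΩ : IsDomainWithBoundary (m := m) Ω ι) (hν : IsOutwardUnitNormal (m := m) Ω ι ν) {K : Set M}
    (hK : IsCompact K) (huK : ∀ x ∉ K, u x = 0) (hu : ∀ x ∈ closure Ω, ContinuousAt u x)
    (hv : ∀ x ∈ closure Ω, x ∈ K → ContMDiffAt (𝓡 (m + 1)) 𝓘(ℝ, ℝ) 1 v x) :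
    Integrable (fun s ↦ u (ι s) * normalDeriv ι ν v s) (weightedVolume (k := m) (ψ ∘ ι)) := by
  have hι := isClosedEmbedding_of_isDomainWithBoundary hΩ
  have := isLocallyFiniteMeasure_weightedVolume (k := m) (hψ.continuous.comp hι.continuous)
  rw [← integrableOn_univ]
  exact integrableOn_of_continuousAt MeasurableSet.univ (hι.isCompact_preimage hK)
    (fun s hs ↦ by rw [huK _ hs, zero_mul])
    fun s _ _ ↦ (continuous_mul_normalDeriv hΩ hν hK huK hu hv).continuousAt

theorem IsSliceChart.integral_greenIntegrand (hsl : IsSliceChart Ω ι e d)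
    (hψ : ContMDiff (𝓡 (m + 1)) 𝓘(ℝ, ℝ) ∞ ψ)
    (hΩ : IsDomainWithBoundary (m := m) Ω ι) (hν : IsOutwardUnitNormal (m := m) Ω ι ν) {K : Set M}
    (hK : IsCompact K) (hKe : K ⊆ e.source) (huK : ∀ x ∉ K, u x = 0)
    (hu : ∀ x ∈ closure Ω, ContMDiffAt (𝓡 (m + 1)) 𝓘(ℝ, ℝ) 1 u x)
    (hv : ∀ x ∈ closure Ω, ContMDiffAt (𝓡 (m + 1)) 𝓘(ℝ, ℝ) 2 v x) :
    ∫ x in Ω, greenIntegrand (k := m + 1) ψ u v x ∂(weightedVolume (k := m + 1) ψ)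
      = ∫ s, u (ι s) * normalDeriv ι ν v s ∂(weightedVolume (k := m) (ψ ∘ ι)) := by
  have hι := isClosedEmbedding_of_isDomainWithBoundary hΩ
  have hv1 : ∀ x ∈ closure Ω, ContMDiffAt (𝓡 (m + 1)) 𝓘(ℝ, ℝ) 1 v x := fun x hx ↦
    (hv x hx).of_le (by norm_num)
  rw [integral_greenIntegrand_chart hsl.chart hψ hΩ.isOpen.measurableSet hK hKe
    (fun x hx ↦ hsl.mem_iff x (hKe hx)) huK
    (fun x hx h0 ↦ hu x (hsl.mem_closure (hKe hx) h0))
    (fun x hx h0 ↦ hv x (hsl.mem_closure (hKe hx) h0)),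
    integral_weightedVolume_eq hsl.boundary_chart (hψ.continuous.comp hι.continuous)
      (fun s hs ↦ by rw [huK _ fun h ↦ hs ((hsl.mem_source s).2 (hKe h)), zero_mul])
      (continuous_mul_normalDeriv hΩ hν hK huK (fun x hx ↦ (hu x hx).continuousAt)
        fun x hx _ ↦ hv1 x hx).aestronglyMeasurable,
    ← integral_indicator d.open_target.measurableSet]
  refine integral_congr_ae (Eventually.of_forall fun z ↦ ?_)
  beta_reduce
  by_cases hz : z ∈ d.target
  · have hs := d.map_target hz
    have hp := (hsl.mem_source _).1 hs
    have hes : slicePoint z 0 = e (ι (d.symm z)) := by rw [hsl.apply_eq _ hs, d.right_inv hz]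
    rw [indicator_of_mem hz]
    by_cases hK' : ι (d.symm z) ∈ K
    · rw [hes, indicator_of_mem (mem_image_of_mem e hK'), hsl.greenField_slicePoint hΩ hν hs
        (hv1 _ (mem_closure_of_isDomainWithBoundary hΩ _)), d.right_inv hz]
    · rw [huK _ hK', zero_mul, mul_zero, indicator_of_notMem]
      · rfl
      · rintro ⟨x, hx, hxe⟩
        rw [hes] at hxe
        exact hK' (e.injOn (hKe hx) hp hxe ▸ hx)
  -- A point of the slice in the image of `K` would belong to the target of `e`, hence to that of
  -- `d`.
  · rw [indicator_of_notMem hz, indicator_of_notMem]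
    · rfl
    · rintro ⟨x, hx, hxe⟩
      refine hz ((hsl.target_iff hΩ.isOpen hΩ.range_eq z).2 ?_)
      rw [← hxe]
      exact e.map_source (hKe hx)

/-- Green's formula for compactly supported functions on a domain with boundary. -/
theorem integral_greenIntegrand_eq (hψ : ContMDiff (𝓡 (m + 1)) 𝓘(ℝ, ℝ) ∞ ψ)
    (hΩ : IsDomainWithBoundary (m := m) Ω ι) (hν : IsOutwardUnitNormal (m := m) Ω ι ν) {K : Set M}
    (hK : IsCompact K) (huK : ∀ x ∉ K, u x = 0)
    (hu : ∀ x ∈ closure Ω, ContMDiffAt (𝓡 (m + 1)) 𝓘(ℝ, ℝ) 1 u x)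
    (hv : ∀ x ∈ closure Ω, ContMDiffAt (𝓡 (m + 1)) 𝓘(ℝ, ℝ) 2 v x) :
    ∫ x in Ω, greenIntegrand (k := m + 1) ψ u v x ∂(weightedVolume (k := m + 1) ψ)
      = ∫ s, u (ι s) * normalDeriv ι ν v s ∂(weightedVolume (k := m) (ψ ∘ ι)) := by
  have hv1 : ∀ x ∈ closure Ω, ContMDiffAt (𝓡 (m + 1)) 𝓘(ℝ, ℝ) 1 v x := fun x hx ↦
    (hv x hx).of_le (by norm_num)
  have hΩm := hΩ.isOpen.measurableSet
  rw [← sub_eq_zero]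
  refine eq_zero_of_locally_eq_zero (k := m + 1) (C := closure Ω)
    (Φ := fun u ↦ ∫ x in Ω, greenIntegrand (k := m + 1) ψ u v x ∂(weightedVolume (k := m + 1) ψ)
      - ∫ s, u (ι s) * normalDeriv ι ν v s ∂(weightedVolume (k := m) (ψ ∘ ι))) ?_ ?_ hK huK hu
  · intro u u' K K' hK hK' hu0 hu0' hu hu'
    have h1 := integral_add (integrableOn_greenIntegrand hψ hΩm hK hu0 hu hv)
      (integrableOn_greenIntegrand hψ hΩm hK' hu0' hu' hv)
    have h2 := integral_add
      (integrable_mul_normalDeriv hψ hΩ hν hK hu0 (fun x hx ↦ (hu x hx).continuousAt)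
        fun x hx _ ↦ hv1 x hx)
      (integrable_mul_normalDeriv hψ hΩ hν hK' hu0' (fun x hx ↦ (hu' x hx).continuousAt)
        fun x hx _ ↦ hv1 x hx)
    have h3 : ∫ x in Ω, greenIntegrand (k := m + 1) ψ (fun x ↦ u x + u' x) v x
          ∂(weightedVolume (k := m + 1) ψ)
        = ∫ x in Ω, (greenIntegrand (k := m + 1) ψ u v x + greenIntegrand (k := m + 1) ψ u' v x)
          ∂(weightedVolume (k := m + 1) ψ) :=
      setIntegral_congr_fun hΩm fun x hx ↦ greenIntegrand_add
        ((hu x (subset_closure hx)).mdifferentiableAt (by simp))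
        ((hu' x (subset_closure hx)).mdifferentiableAt (by simp))
    simp only [add_mul]
    rw [h3, h1, h2]
    ring
  · intro x
    -- Near a point of `Ω` both sides vanish by the interior case; near a boundary point a slice
    -- chart is used; near an exterior point `u` vanishes on the closure of `Ω`.
    by_cases hxΩ : x ∈ Ω
    · set e := (chartAt (EuclideanSpace ℝ (Fin (m + 1))) x).restrOpen Ω hΩ.isOpen
      have he : IsSmoothChart e := (isSmoothChart_chartAt x).restrOpen _ _
      refine ⟨_, e.open_source.mem_nhds ⟨mem_chart_source _ x, hxΩ⟩, fun u K hKs hK hu0 hu ↦ ?_⟩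
      have hKΩ : K ⊆ Ω := fun y hy ↦ (hKs hy).2
      have hb : ∀ s, u (ι s) = 0 := fun s ↦ hu0 _ fun h ↦ by
        have h1 : ι s ∈ frontier Ω := hΩ.range_eq ▸ mem_range_self s
        rw [hΩ.isOpen.frontier_eq] at h1
        exact h1.2 (hKΩ h)
      simp only [hb, zero_mul, integral_zero, sub_zero]
      exact integral_greenIntegrand_chart_interior he hψ hΩm hK hKs hKΩ hu0
        (fun y hy ↦ hu y (subset_closure (hKΩ hy))) (fun y hy ↦ hv y (subset_closure (hKΩ hy)))
    by_cases hxc : x ∈ closure Ω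
    · have hxf : x ∈ range ι := by
        rw [hΩ.range_eq, hΩ.isOpen.frontier_eq]
        exact ⟨hxc, hxΩ⟩
      obtain ⟨s, rfl⟩ := hxf
      obtain ⟨e, d, hsl, hs⟩ := hΩ.exists_isSliceChart s
      refine ⟨e.source, e.open_source.mem_nhds ((hsl.mem_source s).1 hs),
        fun u K hKs hK hu0 hu ↦ ?_⟩
      rw [sub_eq_zero]
      exact hsl.integral_greenIntegrand hψ hΩ hν hK hKs hu0 hu hv
    · refine ⟨(closure Ω)ᶜ, isClosed_closure.isOpen_compl.mem_nhds hxc,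
        fun u K hKs hK hu0 hu ↦ ?_⟩
      have hb : ∀ x ∈ closure Ω, u x = 0 := fun x hx ↦ hu0 _ fun h ↦ hKs h hx
      have hb' : ∀ s, u (ι s) = 0 := fun s ↦ hb _ (mem_closure_of_isDomainWithBoundary hΩ s)
      simp only [hb', zero_mul, integral_zero, sub_zero]
      refine setIntegral_eq_zero_of_forall_eq_zero fun x hx ↦ greenIntegrand_eq_zero ?_
      filter_upwards [hΩ.isOpen.mem_nhds hx] with z hz using hb z (subset_closure hz)

end BoundaryGreen

/-! ### Smoothing Lipschitz functions -/

section Mollification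

variable {E : Type*} [NormedAddCommGroup E] [NormedSpace ℝ E] [FiniteDimensional ℝ E]

/-- Convolution averages translates of `F`. The bound `N (y - z)` depends only on the difference, so
it passes to the average with no loss in the constant. The doubled ball leaves room for the
translates. -/
theorem exists_contDiff_approx {F N : E → ℝ} {y₀ : E} {r C ε : ℝ} (hr : 0 < r) (hε : 0 < ε)
    (hF : ∀ y ∈ Metric.ball y₀ (2 * r), ∀ z ∈ Metric.ball y₀ (2 * r), |F y - F z| ≤ N (y - z))
    (hN : ∀ v, N v ≤ C * ‖v‖) :
    ∃ g : E → ℝ, ContDiff ℝ ∞ g ∧ (∀ y ∈ Metric.ball y₀ r, |g y - F y| ≤ ε) ∧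
      ∀ y ∈ Metric.ball y₀ r, ∀ z ∈ Metric.ball y₀ r, |g y - g z| ≤ N (y - z) := by
  borelize E
  let μ : Measure E := Measure.addHaar
  set B := Metric.ball y₀ (2 * r) with hB
  have hy₀ : y₀ ∈ B := Metric.mem_ball_self (by positivity)
  have hC' : ∀ y ∈ B, ∀ z ∈ B, |F y - F z| ≤ |C| * ‖y - z‖ := fun y hy z hz ↦
    ((hF y hy z hz).trans (hN _)).trans (by gcongr; exact le_abs_self C)
  have hcont : ContinuousOn F B := by
    have : LipschitzOnWith (Real.toNNReal |C|) F B := LipschitzOnWith.of_dist_le_mul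
      fun y hy z hz ↦ by
        rw [Real.dist_eq, dist_eq_norm, Real.coe_toNNReal _ (abs_nonneg C)]
        exact hC' y hy z hz
    exact this.continuousOn
  have hint : IntegrableOn F B μ := by
    refine IntegrableOn.of_bound measure_ball_lt_top
      (hcont.aestronglyMeasurable Metric.isOpen_ball.measurableSet) (|F y₀| + |C| * (2 * r)) ?_
    refine (ae_restrict_mem Metric.isOpen_ball.measurableSet).mono fun y hy ↦ ?_
    have h1 := hC' y hy y₀ hy₀
    have h2 : |C| * ‖y - y₀‖ ≤ |C| * (2 * r) := by
      gcongr
      exact (mem_ball_iff_norm.1 hy).le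
    have h3 : |F y| ≤ |F y - F y₀| + |F y₀| := by simpa using abs_add_le (F y - F y₀) (F y₀)
    rw [Real.norm_eq_abs]
    linarith
  set F' := B.indicator F with hF'
  have hint' : Integrable F' μ := (integrable_indicator_iff Metric.isOpen_ball.measurableSet).2 hint
  -- The radius of the bump: at most `r` to keep translates in the doubled ball, and small enough
  -- that `F` varies by at most `ε`. The denominator |C| + 1 avoids division by zero.
  obtain ⟨δ, hδ, hδr, hδε⟩ : ∃ δ > 0, δ ≤ r ∧ |C| * δ ≤ ε := by
    refine ⟨min r (ε / (|C| + 1)), lt_min hr (by positivity), min_le_left _ _, ?_⟩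
    calc |C| * min r (ε / (|C| + 1)) ≤ (|C| + 1) * (ε / (|C| + 1)) := by
          gcongr
          · linarith
          · exact min_le_right _ _
      _ = ε := by field_simp
  let b : ContDiffBump (0 : E) := ⟨δ / 2, δ, by positivity, by linarith⟩
  have hmem : ∀ y ∈ Metric.ball y₀ r, ∀ t ∈ Metric.ball (0 : E) δ, y - t ∈ B := fun y hy t ht ↦ by
    rw [mem_ball_iff_norm] at *
    rw [sub_zero] at ht
    calc ‖y - t - y₀‖ = ‖(y - y₀) - t‖ := by congr 1; abel
      _ ≤ ‖y - y₀‖ + ‖t‖ := norm_sub_le _ _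
      _ < 2 * r := by linarith
  have hmemB : ∀ y ∈ Metric.ball y₀ r, y ∈ B := fun y hy ↦
    Metric.ball_subset_ball (by linarith) hy
  refine ⟨convolution (b.normed μ) F' (ContinuousLinearMap.lsmul ℝ ℝ) μ,
    b.hasCompactSupport_normed.contDiff_convolution_left _ b.contDiff_normed
      hint'.locallyIntegrable, fun y hy ↦ ?_, fun y hy z hz ↦ ?_⟩
  · have h := b.dist_normed_convolution_le (μ := μ) (g := F') (x₀ := y) (ε := ε)
      hint'.aestronglyMeasurable fun x hx ↦ by
        have hx' : x ∈ B := by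
          have := hmem y hy (y - x) (by
            rw [mem_ball_zero_iff, norm_sub_rev]
            exact mem_ball_iff_norm.1 hx)
          simpa using this
        rw [hF', indicator_of_mem hx', indicator_of_mem (hmemB y hy), Real.dist_eq]
        refine (hC' x hx' y (hmemB y hy)).trans (le_trans ?_ hδε)
        gcongr
        exact (mem_ball_iff_norm.1 hx).le
    rwa [Real.dist_eq, show F' y = F y from indicator_of_mem (hmemB y hy) F] at h
  · have hex : ConvolutionExists (b.normed μ) F' (ContinuousLinearMap.lsmul ℝ ℝ) μ :=
      b.hasCompactSupport_normed.convolutionExists_left _ b.continuous_normed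
        hint'.locallyIntegrable
    rw [convolution_def, convolution_def, ← integral_sub (hex y) (hex z), ← Real.norm_eq_abs]
    have hle : ∀ t, ‖ContinuousLinearMap.lsmul ℝ ℝ (b.normed μ t) (F' (y - t))
        - ContinuousLinearMap.lsmul ℝ ℝ (b.normed μ t) (F' (z - t))‖
          ≤ b.normed μ t * N (y - z) := by
      intro t
      rw [← map_sub, ContinuousLinearMap.lsmul_apply, norm_smul, Real.norm_eq_abs, Real.norm_eq_abs,
        abs_of_nonneg (b.nonneg_normed t)]
      by_cases ht : t ∈ Metric.ball (0 : E) δ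
      · have h1 := hmem y hy t ht
        have h2 := hmem z hz t ht
        rw [hF', indicator_of_mem h1, indicator_of_mem h2]
        refine mul_le_mul_of_nonneg_left ((hF _ h1 _ h2).trans_eq ?_) (b.nonneg_normed t)
        congr 1
        abel
      · have : b.normed μ t = 0 := by
          rw [← Function.notMem_support, b.support_normed_eq]
          exact ht
        simp [this]
    refine (norm_integral_le_of_norm_le (b.integrable_normed.mul_const _)
      (Eventually.of_forall hle)).trans_eq ?_
    rw [integral_mul_const, b.integral_normed, one_mul]

theorem abs_fderiv_le_of_forall_abs_sub_le {F N : E → ℝ} {y : E} (hF : DifferentiableAt ℝ F y)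
    (hN : ∀ (t : ℝ) v, N (t • v) = |t| * N v) (h : ∀ᶠ z in 𝓝 y, |F z - F y| ≤ N (z - y)) (v : E) :
    |fderiv ℝ F y v| ≤ N v := by
  -- Nonnegativity of `N` is not assumed; homogeneity and the Lipschitz bound at one small nonzero
  -- parameter imply it.
  have hN0 : 0 ≤ N v := by
    have h1 : ∀ᶠ t : ℝ in 𝓝[≠] 0, |F (y + t • v) - F y| ≤ N (y + t • v - y) := by
      have hc : Tendsto (fun t : ℝ ↦ y + t • v) (𝓝[≠] 0) (𝓝 y) := by
        have : ContinuousAt (fun t : ℝ ↦ y + t • v) 0 := by fun_prop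
        simpa [ContinuousAt] using this.mono_left (nhdsWithin_le_nhds (s := {0}ᶜ))
      exact hc.eventually h
    obtain ⟨t, ht, ht0⟩ := (h1.and self_mem_nhdsWithin).exists
    rw [add_sub_cancel_left, hN] at ht
    exact nonneg_of_mul_nonneg_right ((abs_nonneg _).trans ht) (abs_pos.2 ht0)
  have hd : HasDerivAt (fun t : ℝ ↦ F (y + t • v)) (fderiv ℝ F y v) 0 := by
    have h1 : HasDerivAt (fun t : ℝ ↦ y + t • v) v 0 := by
      simpa using ((hasDerivAt_id (0 : ℝ)).smul_const v).const_add y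
    have h2 : HasFDerivAt F (fderiv ℝ F y) (y + (0 : ℝ) • v) := by simpa using hF.hasFDerivAt
    exact h2.comp_hasDerivAt 0 h1
  rw [← Real.norm_eq_abs]
  refine hd.le_of_lip' hN0 ?_
  have hc : Tendsto (fun t : ℝ ↦ y + t • v) (𝓝 0) (𝓝 y) := by
    have : ContinuousAt (fun t : ℝ ↦ y + t • v) 0 := by fun_prop
    simpa [ContinuousAt] using this
  filter_upwards [hc.eventually h] with t ht
  rw [add_sub_cancel_left, hN] at ht
  simpa [mul_comm] using ht

/-- On a small ball the metrics lie between 1/2 and 3/2 of the one at the centre, by compactness of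
the unit sphere and continuity. Their ratios are then at most 3; the value 4 is chosen for its exact
square root. -/
theorem IsLocalMetric.exists_ball_le {G : E → E →L[ℝ] E →L[ℝ] ℝ} {U : Set E}
    (hG : IsLocalMetric G U) {y₀ : E} (hy₀ : y₀ ∈ U) :
    ∃ r > 0, Metric.ball y₀ r ⊆ U ∧ ∀ y ∈ Metric.ball y₀ r, ∀ z ∈ Metric.ball y₀ r, ∀ v,
      G y v v ≤ 4 * G z v v := by
  obtain ⟨c, hc, hcG⟩ := (isCompact_sphere (0 : E) 1).exists_forall_le'
    (f := fun v ↦ G y₀ v v) (by fun_prop) (a := 0)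
    fun v hv ↦ hG.pos y₀ hy₀ v (ne_zero_of_mem_unit_sphere ⟨v, hv⟩)
  have hlow : ∀ v, c * ‖v‖ ^ 2 ≤ G y₀ v v := by
    intro v
    by_cases hv : v = 0
    · simp [hv]
    have h1 := hcG (‖v‖⁻¹ • v) (by simp [norm_smul, hv])
    have h2 : ‖v‖ ≠ 0 := norm_ne_zero_iff.2 hv
    simp only [map_smul, FunLike.coe_smul, Pi.smul_apply, smul_eq_mul] at h1
    calc c * ‖v‖ ^ 2 ≤ (‖v‖⁻¹ * (‖v‖⁻¹ * G y₀ v v)) * ‖v‖ ^ 2 := by gcongr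
      _ = G y₀ v v := by field_simp
  have hcont : ContinuousAt G y₀ := (hG.contDiffAt hy₀).continuousAt
  have hU : ∀ᶠ y in 𝓝 y₀, y ∈ U := hG.isOpen.mem_nhds hy₀
  obtain ⟨r, hr, hrG⟩ := Metric.eventually_nhds_iff_ball.1 (hU.and
      (hcont.eventually (Metric.closedBall_mem_nhds (G y₀) (half_pos hc))))
  have hclose : ∀ y ∈ Metric.ball y₀ r, ∀ v, |G y v v - G y₀ v v| ≤ G y₀ v v / 2 := by
    intro y hy v
    have h1 : ‖G y - G y₀‖ ≤ c / 2 := by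
      rw [← dist_eq_norm]
      exact (hrG y hy).2
    calc |G y v v - G y₀ v v| = ‖(G y - G y₀) v v‖ := rfl
      _ ≤ ‖G y - G y₀‖ * ‖v‖ * ‖v‖ := ContinuousLinearMap.le_opNorm₂ _ v v
      _ ≤ c / 2 * ‖v‖ * ‖v‖ := by gcongr
      _ ≤ G y₀ v v / 2 := by linarith [hlow v]
  refine ⟨r, hr, fun y hy ↦ (hrG y hy).1, fun y hy z hz v ↦ ?_⟩
  have h1 := abs_le.1 (hclose y hy v)
  have h2 := abs_le.1 (hclose z hz v)
  have h3 : 0 ≤ G y₀ v v := (by positivity : 0 ≤ c * ‖v‖ ^ 2).trans (hlow v)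
  linarith

end Mollification

/-! ### The theorem of Hopf and Rinow -/

section ProperSpace

/-- The radii with compact closed ball about a point have no finite supremum. A ball of radius R is
totally bounded if all smaller concentric ones are compact, since its points are close to such a
smaller ball. By local compactness a compact ball has a compact thickening, which contains a larger
ball. -/
theorem properSpace_of_approximate_midpoints {X : Type*} [MetricSpace X] [CompleteSpace X]
    [LocallyCompactSpace X]
    (hX : ∀ x y : X, ∀ r s : ℝ, 0 ≤ r → 0 < s → dist x y < r + s →
      ∃ z, dist x z ≤ r ∧ dist z y < s) :
    ProperSpace X := by
  have hmono : ∀ (x : X) {r r' : ℝ}, r' ≤ r → IsCompact (Metric.closedBall x r) →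
      IsCompact (Metric.closedBall x r') := fun x r r' h hr ↦
    hr.of_isClosed_subset Metric.isClosed_closedBall (Metric.closedBall_subset_closedBall h)
  have hlim : ∀ (x : X) {R : ℝ}, 0 < R → (∀ r < R, IsCompact (Metric.closedBall x r)) →
      IsCompact (Metric.closedBall x R) := by
    intro x R hR h
    refine isCompact_iff_totallyBounded_isComplete.2 ⟨?_, Metric.isClosed_closedBall.isComplete⟩
    refine Metric.totallyBounded_iff.2 fun ε hε ↦ ?_
    -- The radius stays below `R` and nonnegative, while `R < r + ε / 2`.
    set r := max 0 (R - ε / 4) with hr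
    have hrR : r < R := max_lt hR (by linarith)
    obtain ⟨t, ht, htc⟩ := Metric.totallyBounded_iff.1 (h r hrR).totallyBounded (ε / 2)
      (half_pos hε)
    refine ⟨t, ht, fun y hy ↦ ?_⟩
    rw [Metric.mem_closedBall'] at hy
    obtain ⟨z, hz, hzy⟩ := hX x y r (ε / 2) (le_max_left _ _) (half_pos hε)
      (by linarith [le_max_right 0 (R - ε / 4)])
    have hz' := htc (Metric.mem_closedBall'.2 hz)
    simp only [mem_iUnion, Metric.mem_ball] at hz' ⊢
    obtain ⟨w, hw, hzw⟩ := hz'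
    exact ⟨w, hw, by linarith [dist_triangle y z w, dist_comm y z]⟩
  have hext : ∀ (x : X) {R : ℝ}, 0 ≤ R → IsCompact (Metric.closedBall x R) →
      ∃ R' > R, IsCompact (Metric.closedBall x R') := by
    intro x R hR h
    obtain ⟨δ, hδ, hδc⟩ := h.exists_isCompact_cthickening
    refine ⟨R + δ / 2, by linarith, hδc.of_isClosed_subset Metric.isClosed_closedBall fun y hy ↦ ?_⟩
    obtain ⟨z, hz, hzy⟩ := hX x y R δ hR hδ (by linarith [Metric.mem_closedBall'.1 hy])
    exact Metric.mem_cthickening_of_dist_le y z δ _ (Metric.mem_closedBall'.2 hz)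
      (by rw [dist_comm]; exact hzy.le)
  refine ⟨fun x r ↦ ?_⟩
  by_contra hr
  have hr0 : 0 ≤ r := by
    by_contra h
    exact hr (by rw [Metric.closedBall_eq_empty.2 (not_le.1 h)]; exact isCompact_empty)
  set A : Set ℝ := {R | IsCompact (Metric.closedBall x R)} with hA
  have hAr : ∀ R ∈ A, R ≤ r := fun R hR ↦ by
    by_contra h
    exact hr (hmono x (not_le.1 h).le hR)
  have h0A : (0 : ℝ) ∈ A := by
    rw [hA, mem_ofPred_eq, Metric.closedBall_zero]
    exact isCompact_singleton
  have hbdd : BddAbove A := ⟨r, hAr⟩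
  obtain ⟨R₁, hR₁, hR₁A⟩ := hext x le_rfl h0A
  have hpos : 0 < sSup A := hR₁.trans_le (le_csSup hbdd hR₁A)
  have hsup : IsCompact (Metric.closedBall x (sSup A)) := hlim x hpos fun r' hr' ↦ by
    obtain ⟨a, ha, har⟩ := exists_lt_of_lt_csSup ⟨0, h0A⟩ hr'
    exact hmono x har.le ha
  obtain ⟨R₂, hR₂, hR₂A⟩ := hext x hpos.le hsup
  exact absurd (le_csSup hbdd hR₂A) (not_le.2 hR₂)

/-- A path from `x` to `y` of length less than r + s passes through a point at distance exactly r
from `x`. The arc up to it has length at least r, so the rest is shorter than s. -/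
theorem exists_dist_le_dist_lt (k : ℕ) {M : Type*} [MetricSpace M] [ChartedSpace (EuclideanSpace ℝ (Fin k)) M]
    [RiemannianBundle (fun x : M ↦ TangentSpace (𝓡 k) x)] [IsRiemannianManifold (𝓡 k) M]
    {x y : M} {r s : ℝ} (hr : 0 ≤ r) (hs : 0 < s) (h : dist x y < r + s) :
    ∃ z, dist x z ≤ r ∧ dist z y < s := by
  by_cases hxy : dist x y ≤ r
  · exact ⟨y, hxy, by simpa using hs⟩
  push Not at hxy
  have h1 : riemannianEDist (𝓡 k) x y < ENNReal.ofReal (r + s) := by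
    rw [← IsRiemannianManifold.out (I := 𝓡 k) x y, edist_dist]
    exact (ENNReal.ofReal_lt_ofReal_iff (by linarith)).2 h
  obtain ⟨γ, hγ0, hγ1, hγ, hlen⟩ := exists_lt_of_riemannianEDist_lt h1
  have hc : ContinuousOn (fun t ↦ dist x (γ t)) (Icc 0 1) :=
    (continuous_const.dist continuous_id).comp_continuousOn hγ.continuousOn
  obtain ⟨t, ht, htr⟩ := intermediate_value_Icc zero_le_one hc
    (show r ∈ Icc (dist x (γ 0)) (dist x (γ 1)) by
      rw [hγ0, hγ1, dist_self]
      exact ⟨hr, hxy.le⟩)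
  refine ⟨γ t, htr.le, ?_⟩
  have h2 : ENNReal.ofReal r ≤ pathELength (𝓡 k) γ 0 t := by
    rw [← htr, ← edist_dist, IsRiemannianManifold.out (I := 𝓡 k) x (γ t)]
    exact riemannianEDist_le_pathELength (hγ.mono (Icc_subset_Icc_right ht.2)) hγ0 rfl ht.1
  have h3 : edist (γ t) y ≤ pathELength (𝓡 k) γ t 1 := by
    rw [IsRiemannianManifold.out (I := 𝓡 k) (γ t) y]
    exact riemannianEDist_le_pathELength (hγ.mono (Icc_subset_Icc_left ht.1)) rfl hγ1 ht.2
  rw [← pathELength_add ht.1 ht.2, ENNReal.ofReal_add hr hs.le] at hlen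
  have h4 : ENNReal.ofReal r + edist (γ t) y < ENNReal.ofReal r + ENNReal.ofReal s :=
    (add_le_add h2 h3).trans_lt hlen
  have h5 := (ENNReal.add_lt_add_iff_left ENNReal.ofReal_ne_top).1 h4
  rw [edist_dist] at h5
  exact (ENNReal.ofReal_lt_ofReal_iff hs).1 h5

theorem properSpace_of_completeSpace (k : ℕ) (M : Type*) [MetricSpace M] [ChartedSpace (EuclideanSpace ℝ (Fin k)) M]
    [RiemannianBundle (fun x : M ↦ TangentSpace (𝓡 k) x)] [IsRiemannianManifold (𝓡 k) M]
    [CompleteSpace M] : ProperSpace M := by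
  have : LocallyCompactSpace M := ChartedSpace.locallyCompactSpace (EuclideanSpace ℝ (Fin k)) M
  exact properSpace_of_approximate_midpoints fun x y r s hr hs h ↦
    exists_dist_le_dist_lt k hr hs h

end ProperSpace

/-- `N` is twice the norm of the metric at the centre, so the comparison constant 4 gives both
bounds. A function `N` independent of the point is needed because convolution preserves only
translation-invariant bounds. -/
theorem IsLocalMetric.exists_seminorm {E : Type*} [NormedAddCommGroup E] [NormedSpace ℝ E]
    [FiniteDimensional ℝ E] {G : E → E →L[ℝ] E →L[ℝ] ℝ} {U : Set E}
    (hG : IsLocalMetric G U) {y₀ : E} (hy₀ : y₀ ∈ U) :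
    ∃ (r : ℝ) (N : E → ℝ) (C : ℝ), 0 < r ∧ Metric.ball y₀ r ⊆ U ∧
      (∀ (t : ℝ) v, N (t • v) = |t| * N v) ∧ (∀ v, N v ≤ C * ‖v‖) ∧
      ∀ y ∈ Metric.ball y₀ r, ∀ v,
        Real.sqrt (G y v v) ≤ N v ∧ N v ≤ 4 * Real.sqrt (G y v v) := by
  obtain ⟨r, hr, hrU, hrG⟩ := hG.exists_ball_le hy₀
  have h4 : ∀ a : ℝ, Real.sqrt (4 * a) = 2 * Real.sqrt a := fun a ↦ by
    rw [Real.sqrt_mul (by norm_num), show (4 : ℝ) = 2 ^ 2 by norm_num,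
      Real.sqrt_sq (by norm_num)]
  have hmem := Metric.mem_ball_self (x := y₀) hr
  refine ⟨r, fun v ↦ 2 * Real.sqrt (G y₀ v v), 2 * Real.sqrt ‖G y₀‖, hr, hrU, fun t v ↦ ?_,
    fun v ↦ ?_, fun y hy v ↦ ⟨?_, ?_⟩⟩
  · simp only [map_smul, FunLike.coe_smul, Pi.smul_apply, smul_eq_mul]
    rw [← mul_assoc t t, Real.sqrt_mul (mul_self_nonneg t), Real.sqrt_mul_self_eq_abs]
    ring
  · have h1 : G y₀ v v ≤ ‖G y₀‖ * ‖v‖ ^ 2 := by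
      refine (le_abs_self _).trans ((ContinuousLinearMap.le_opNorm₂ (G y₀) v v).trans_eq ?_)
      ring
    have h2 : Real.sqrt (G y₀ v v) ≤ Real.sqrt ‖G y₀‖ * ‖v‖ := by
      refine (Real.sqrt_le_sqrt h1).trans_eq ?_
      rw [Real.sqrt_mul (norm_nonneg _), Real.sqrt_sq (norm_nonneg _)]
    linarith
  · exact (Real.sqrt_le_sqrt (hrG y hy y₀ hmem v)).trans_eq (h4 _)
  · have h1 := Real.sqrt_le_sqrt (hrG y₀ hmem y hy v)
    rw [h4] at h1
    linarith

/-! ### Lipschitz functions in charts -/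

section Lipschitz

variable {k : ℕ} {M : Type*} [MetricSpace M] [ChartedSpace (EuclideanSpace ℝ (Fin k)) M]
  [RiemannianBundle (fun x : M ↦ TangentSpace (𝓡 k) x)] [IsRiemannianManifold (𝓡 k) M]
  {e : OpenPartialHomeomorph M (EuclideanSpace ℝ (Fin k))}

/-- The image of the coordinate segment is a path of speed at most `c` over the unit interval. -/
theorem dist_symm_le (he : IsSmoothChart e) {y z : EuclideanSpace ℝ (Fin k)} {c : ℝ}
    (hseg : segment ℝ y z ⊆ e.target)
    (hc : ∀ w ∈ segment ℝ y z, ‖chartVec e w (z - y)‖ ≤ c) :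
    dist (e.symm y) (e.symm z) ≤ c := by
  have hc0 : 0 ≤ c := (norm_nonneg _).trans (hc y (left_mem_segment ℝ y z))
  set η : ℝ → EuclideanSpace ℝ (Fin k) := fun t ↦ y + t • (z - y) with hη
  have hηs : ∀ t ∈ Icc (0 : ℝ) 1, η t ∈ segment ℝ y z := fun t ht ↦ by
    rw [segment_eq_image']
    exact mem_image_of_mem _ ht
  have hηd : ∀ t, HasDerivAt η (z - y) t := fun t ↦ by
    have h := ((hasDerivAt_id t).smul_const (z - y)).const_add y
    rw [one_smul] at h
    exact h
  have hηc : ContDiff ℝ 1 η := by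
    rw [hη]
    fun_prop
  have hγ : ∀ t ∈ Icc (0 : ℝ) 1, ContMDiffAt 𝓘(ℝ, ℝ) (𝓡 k) 1 (fun t ↦ e.symm (η t)) t :=
    fun t ht ↦ ContMDiffAt.comp t (g := e.symm)
      ((he.contMDiffAt_symm (hseg (hηs t ht))).of_le (by simp)) hηc.contMDiff.contMDiffAt
  have hle : edist (e.symm y) (e.symm z)
      ≤ pathELength (𝓡 k) (fun t ↦ e.symm (η t)) 0 1 := by
    rw [IsRiemannianManifold.out (I := 𝓡 k) (e.symm y) (e.symm z)]
    exact riemannianEDist_le_pathELength (fun t ht ↦ (hγ t ht).contMDiffWithinAt)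
      (by simp [hη]) (by simp [hη]) zero_le_one
  have hlen : pathELength (𝓡 k) (fun t ↦ e.symm (η t)) 0 1 ≤ ENNReal.ofReal c := by
    rw [pathELength_eq_lintegral_mfderiv_Icc]
    calc _ ≤ ∫⁻ _ in Icc (0 : ℝ) 1, ENNReal.ofReal c := by
          refine setLIntegral_mono measurable_const fun t ht ↦ ?_
          have hd : mfderiv 𝓘(ℝ, ℝ) (𝓡 k) (fun t ↦ e.symm (η t)) t (1 : ℝ)
              = chartVec e (η t) (z - y) := by
            have h1 := mfderiv_comp t (g := e.symm)
              ((he.contMDiffAt_symm (hseg (hηs t ht))).mdifferentiableAt (by simp))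
              (hηd t).differentiableAt.mdifferentiableAt
            have h2 : mfderiv 𝓘(ℝ, ℝ) 𝓘(ℝ, EuclideanSpace ℝ (Fin k)) η t (1 : ℝ) = z - y := by
              rw [mfderiv_eq_fderiv]
              exact (hηd t).deriv
            exact (DFunLike.congr_fun h1 (1 : ℝ)).trans (congrArg (chartVec e (η t)) h2)
          rw [← ofReal_norm]
          refine ENNReal.ofReal_le_ofReal ?_
          exact (congrArg norm hd).trans_le (hc _ (hηs t ht))
      _ = ENNReal.ofReal c := by simp
  rw [edist_dist] at hle
  exact (ENNReal.ofReal_le_ofReal_iff hc0).1 (hle.trans hlen)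

variable [IsManifold (𝓡 k) ∞ M]
  [IsContMDiffRiemannianBundle (𝓡 k) ∞ (EuclideanSpace ℝ (Fin k))
    (fun x : M ↦ TangentSpace (𝓡 k) x)] {f : M → ℝ} {L : ℝ}

theorem norm_grad_le_of_fderiv_le (he : IsSmoothChart e) {x : M} (hx : x ∈ e.source)
    {g : EuclideanSpace ℝ (Fin k) → ℝ} (hg : DifferentiableAt ℝ g (e x)) {c : ℝ} (hc0 : 0 ≤ c)
    (hc : ∀ v, |fderiv ℝ g (e x) v| ≤ c * Real.sqrt (chartMetric e (e x) v v)) :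
    ‖grad (k := k) (g ∘ e) x‖ ≤ c := by
  set V := grad (k := k) (g ∘ e) x with hV
  have h2 : inner ℝ V V = fderiv ℝ g (e x) (coords e x V) := by
    rw [hV, inner_grad_left]
    exact mvfderiv_eq_fderiv_comp he hx hg (Eventually.of_forall fun _ ↦ rfl) _
  have h1 : ‖V‖ * ‖V‖ ≤ c * ‖V‖ := by
    rw [← real_inner_self_eq_norm_mul_norm, h2]
    refine (le_abs_self _).trans ((hc _).trans_eq ?_)
    rw [← inner_eq_chartMetric he hx, ← norm_eq_sqrt_real_inner]
  by_cases h0 : ‖V‖ = 0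
  · rw [h0]
    exact hc0
  · exact le_of_mul_le_mul_right h1 ((norm_nonneg V).lt_of_ne' h0)

/-- Along coordinate segments `f` is Lipschitz with respect to `L N`; mollification keeps this
bound, and comparing `N` with the metric costs the factor 4. The neighbourhood does not depend on
`ε`, so a partition of unity can be fixed before the accuracy. -/
theorem exists_nhds_approx (hL : 0 ≤ L) (hf : ∀ x y, |f x - f y| ≤ L * dist x y) (p : M) :
    ∃ U ∈ 𝓝 p, ∀ ε > 0, ∃ u : M → ℝ, ∀ x ∈ U, ContMDiffAt (𝓡 k) 𝓘(ℝ, ℝ) ∞ u x ∧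
      |u x - f x| ≤ ε ∧ ‖grad (k := k) u x‖ ≤ 4 * L := by
  set e := chartAt (EuclideanSpace ℝ (Fin k)) p
  have he : IsSmoothChart e := isSmoothChart_chartAt p
  have hp : p ∈ e.source := mem_chart_source _ p
  obtain ⟨r, N, C, hr, hrt, hNs, hNC, hN⟩ :=
    (isLocalMetric_chartMetric he).exists_seminorm (e.map_source hp)
  have hF : ∀ y ∈ Metric.ball (e p) r, ∀ z ∈ Metric.ball (e p) r,
      |f (e.symm y) - f (e.symm z)| ≤ L * N (y - z) := by
    intro y hy z hz
    have hseg : segment ℝ z y ⊆ Metric.ball (e p) r := (convex_ball (e p) r).segment_subset hz hy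
    refine (hf _ _).trans (mul_le_mul_of_nonneg_left ?_ hL)
    rw [dist_comm]
    refine dist_symm_le he (hseg.trans hrt) fun w hw ↦ ?_
    rw [norm_eq_sqrt_real_inner, ← chartMetric_apply]
    exact (hN w (hseg hw) _).1
  have hr2 : 2 * (r / 2) = r := by ring
  refine ⟨e.source ∩ e ⁻¹' Metric.ball (e p) (r / 2), inter_mem (e.open_source.mem_nhds hp)
    ((e.continuousAt hp).preimage_mem_nhds (Metric.ball_mem_nhds _ (half_pos hr))),
    fun ε hε ↦ ?_⟩
  obtain ⟨g, hg, hgf, hgN⟩ := exists_contDiff_approx (F := f ∘ e.symm) (N := fun v ↦ L * N v)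
    (C := L * C) (half_pos hr) hε (by rw [hr2]; exact hF)
    (fun v ↦ by rw [mul_assoc]; exact mul_le_mul_of_nonneg_left (hNC v) hL)
  refine ⟨g ∘ e, fun x hx ↦ ?_⟩
  have hxr : e x ∈ Metric.ball (e p) r := Metric.ball_subset_ball (by linarith) hx.2
  have hgd : DifferentiableAt ℝ g (e x) := hg.differentiable (by simp) _
  refine ⟨ContMDiffAt.comp x (g := g) hg.contMDiff.contMDiffAt (he.contMDiffAt hx.1), ?_,
    norm_grad_le_of_fderiv_le he hx.1 hgd (by positivity) fun v ↦ ?_⟩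
  · have := hgf (e x) hx.2
    rwa [Function.comp, e.left_inv hx.1] at this
  · refine (abs_fderiv_le_of_forall_abs_sub_le (N := fun v ↦ L * N v) hgd
      (fun t v ↦ ?_) ?_ v).trans ?_
    · rw [hNs]
      ring
    · filter_upwards [Metric.isOpen_ball.mem_nhds hx.2] with z hz using hgN z hz _ hx.2
    · calc L * N v ≤ L * (4 * Real.sqrt (chartMetric e (e x) v v)) :=
            mul_le_mul_of_nonneg_left (hN _ hxr v).2 hL
        _ = 4 * L * Real.sqrt (chartMetric e (e x) v v) := by ring

end Lipschitz

/-! ### Cutoff functions -/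

section Cutoff

theorem continuousAt_norm_grad {k : ℕ} {X : Type*} [TopologicalSpace X]
    [ChartedSpace (EuclideanSpace ℝ (Fin k)) X] [IsManifold (𝓡 k) ∞ X]
    [RiemannianBundle (fun x : X ↦ TangentSpace (𝓡 k) x)]
    [IsContMDiffRiemannianBundle (𝓡 k) ∞ (EuclideanSpace ℝ (Fin k))
      (fun x : X ↦ TangentSpace (𝓡 k) x)] {u : X → ℝ} {x : X}
    (hu : ContMDiffAt (𝓡 k) 𝓘(ℝ, ℝ) 1 u x) :
    ContinuousAt (fun x ↦ ‖grad (k := k) u x‖) x := by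
  simp only [norm_eq_sqrt_real_inner]
  exact (contMDiffAt_inner_grad (n := 0) hu hu).continuousAt.sqrt

variable {k : ℕ} {M : Type*} [MetricSpace M] [ChartedSpace (EuclideanSpace ℝ (Fin k)) M]
  [RiemannianBundle (fun x : M ↦ TangentSpace (𝓡 k) x)] [IsRiemannianManifold (𝓡 k) M]
  [IsManifold (𝓡 k) ∞ M]
  [IsContMDiffRiemannianBundle (𝓡 k) ∞ (EuclideanSpace ℝ (Fin k))
    (fun x : M ↦ TangentSpace (𝓡 k) x)] {f : M → ℝ} {L ε : ℝ}

theorem grad_finset_sum_smul {ι : Type*} (I : Finset ι) {η u : ι → M → ℝ} {x : M}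
    (hη : ∀ i ∈ I, MDifferentiableAt (𝓡 k) 𝓘(ℝ, ℝ) (η i) x)
    (hu : ∀ i ∈ I, MDifferentiableAt (𝓡 k) 𝓘(ℝ, ℝ) (u i) x) :
    MDifferentiableAt (𝓡 k) 𝓘(ℝ, ℝ) (fun y ↦ ∑ i ∈ I, η i y * u i y) x ∧
    grad (k := k) (fun y ↦ ∑ i ∈ I, η i y * u i y) x
      = ∑ i ∈ I, (η i x • grad (u i) x + u i x • grad (η i) x) := by
  classical
  induction I using Finset.induction_on with
  | empty =>
    simp only [Finset.sum_empty]
    exact ⟨mdifferentiableAt_const, grad_eq_zero_of_eventuallyEq (Eventually.of_forall fun _ ↦ rfl)⟩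
  | insert i I hi ih =>
    obtain ⟨h1, h2⟩ := ih (fun j hj ↦ hη j (Finset.mem_insert_of_mem hj))
      fun j hj ↦ hu j (Finset.mem_insert_of_mem hj)
    have h3 : MDifferentiableAt (𝓡 k) 𝓘(ℝ, ℝ) (fun y ↦ η i y * u i y) x :=
      (hη i (Finset.mem_insert_self i I)).mul (hu i (Finset.mem_insert_self i I))
    simp only [Finset.sum_insert hi]
    refine ⟨h3.add h1, ?_⟩
    rw [grad_add h3 h1, h2, grad_mul (hη i (Finset.mem_insert_self i I))
      (hu i (Finset.mem_insert_self i I))]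

/-- With a partition η and local approximations w, the gradient of ∑ ηᵢwᵢ is ∑ ηᵢ∇wᵢ + ∑ (wᵢ −
f)∇ηᵢ, because ∑ ∇ηᵢ vanishes on `K` and `f` vanishes off `K`. The first sum is bounded by 4L, and
the second by L if the local accuracy is chosen after η. -/
theorem exists_smooth_approx [SecondCountableTopology M] (hL : 0 < L)
    (hf : ∀ x y, |f x - f y| ≤ L * dist x y) {K : Set M} (hK : IsCompact K)
    (hfK : ∀ x ∉ K, f x = 0) (hε : 0 < ε) :
    ∃ u : M → ℝ, ContMDiff (𝓡 k) 𝓘(ℝ, ℝ) ∞ u ∧ (∃ K', IsCompact K' ∧ ∀ x ∉ K', u x = 0) ∧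
      (∀ x, |u x - f x| ≤ ε) ∧ ∀ x, ‖grad (k := k) u x‖ ≤ 5 * L := by
  classical
  have : LocallyCompactSpace M := ChartedSpace.locallyCompactSpace (EuclideanSpace ℝ (Fin k)) M
  choose U hU hUapprox using exists_nhds_approx (k := k) hL.le hf
  have hV : ∀ p, ∃ V ∈ 𝓝 p, V ⊆ U p ∧ IsCompact V := fun p ↦ local_compact_nhds (hU p)
  choose V hVn hVU hVc using hV
  obtain ⟨I, η, hη, hηV, hη0, hη1, hηK⟩ := exists_finite_partitionOfUnity (k := k) hK hVn
  have hηd : ∀ i x, MDifferentiableAt (𝓡 k) 𝓘(ℝ, ℝ) (η i) x := fun i x ↦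
    (hη i).contMDiffAt.mdifferentiableAt (by simp)
  have hbound : ∀ i, ∃ C, 0 ≤ C ∧ ∀ x, ‖grad (k := k) (η i) x‖ ≤ C := by
    intro i
    obtain ⟨C, hC⟩ := (hVc i).exists_bound_of_continuousOn
      (f := fun x ↦ ‖grad (k := k) (η i) x‖) fun x _ ↦
        (continuousAt_norm_grad ((hη i).contMDiffAt.of_le (by simp))).continuousWithinAt
    refine ⟨max C 0, le_max_right _ _, fun x ↦ ?_⟩
    by_cases hx : x ∈ V i
    · exact (norm_norm (grad (k := k) (η i) x) ▸ hC x hx).trans (le_max_left _ _)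
    · rw [grad_eq_zero_of_eventuallyEq
        (notMem_tsupport_iff_eventuallyEq.1 fun h ↦ hx (hηV i h)), norm_zero]
      exact le_max_right _ _
  choose C hC0 hC using hbound
  set D := ∑ i ∈ I, C i with hD
  have hD0 : 0 ≤ D := Finset.sum_nonneg fun i _ ↦ hC0 i
  -- `D` bounds the sum of the gradients of the partition functions, so this accuracy keeps the
  -- second sum below `L`.
  set δ := min ε (L / (D + 1)) with hδ
  have hδ0 : 0 < δ := lt_min hε (by positivity)
  choose w hw using fun p ↦ hUapprox p δ hδ0
  have hηw : ∀ i x, ContMDiffAt (𝓡 k) 𝓘(ℝ, ℝ) ∞ (fun y ↦ η i y * w i y) x := by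
    intro i x
    by_cases hx : x ∈ tsupport (η i)
    · exact (hη i).contMDiffAt.mul (hw i x (hVU i (hηV i hx))).1
    · refine (contMDiffAt_const (c := (0 : ℝ))).congr_of_eventuallyEq ?_
      filter_upwards [notMem_tsupport_iff_eventuallyEq.1 hx] with y hy
      rw [hy, Pi.zero_apply, zero_mul]
  have hη0' : ∀ i x, x ∉ tsupport (η i) → η i x = 0 := fun i x ↦ image_eq_zero_of_notMem_tsupport
  refine ⟨fun x ↦ ∑ i ∈ I, η i x * w i x, fun x ↦ ContMDiffAt.sum fun i _ ↦ hηw i x,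
    ⟨⋃ i ∈ I, V i, I.isCompact_biUnion fun i _ ↦ hVc i, fun x hx ↦ ?_⟩, fun x ↦ ?_, fun x ↦ ?_⟩
  · refine Finset.sum_eq_zero fun i hi ↦ ?_
    rw [hη0' i x fun h ↦ hx (mem_biUnion hi (hηV i h)), zero_mul]
  · have hfx : f x = ∑ i ∈ I, η i x * f x := by
      by_cases hx : x ∈ K
      · rw [← Finset.sum_mul, (hηK x hx).self_of_nhds, one_mul]
      · simp [hfK x hx]
    rw [hfx, ← Finset.sum_sub_distrib]
    refine (Finset.abs_sum_le_sum_abs _ _).trans ?_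
    calc ∑ i ∈ I, |η i x * w i x - η i x * f x| ≤ ∑ i ∈ I, η i x * δ := by
          refine Finset.sum_le_sum fun i _ ↦ ?_
          rw [← mul_sub, abs_mul, abs_of_nonneg (hη0 i x)]
          by_cases hx : x ∈ tsupport (η i)
          · exact mul_le_mul_of_nonneg_left (hw i x (hVU i (hηV i hx))).2.1 (hη0 i x)
          · rw [hη0' i x hx, zero_mul, zero_mul]
      _ = (∑ i ∈ I, η i x) * δ := by rw [Finset.sum_mul]
      _ ≤ 1 * ε := by
          gcongr
          · exact hη1 x
          · exact min_le_left _ _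
      _ = ε := one_mul ε
  -- Only indices whose support contains `x` are kept, since the other local approximations need not
  -- be differentiable there.
  · set J := I.filter fun i ↦ x ∈ tsupport (η i) with hJ
    have hloc : ∀ i, x ∉ tsupport (η i) → grad (k := k) (η i) x = 0 := fun i hi ↦
      grad_eq_zero_of_eventuallyEq (notMem_tsupport_iff_eventuallyEq.1 hi)
    have hev : (fun y ↦ ∑ i ∈ I, η i y * w i y) =ᶠ[𝓝 x] fun y ↦ ∑ i ∈ J, η i y * w i y := by
      have h1 : ∀ᶠ y in 𝓝 x, ∀ i ∈ I, x ∉ tsupport (η i) → η i y = 0 := by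
        rw [Finset.eventually_all]
        intro i _
        by_cases hi : x ∈ tsupport (η i)
        · exact Eventually.of_forall fun y h ↦ absurd hi h
        · filter_upwards [notMem_tsupport_iff_eventuallyEq.1 hi] with y hy _ using hy
      filter_upwards [h1] with y hy
      rw [hJ, Finset.sum_filter_of_ne]
      intro i hi hne
      by_contra h
      exact hne (by rw [hy i hi h, zero_mul])
    have hJt : ∀ i ∈ J, x ∈ tsupport (η i) := fun i hi ↦ (Finset.mem_filter.1 hi).2
    have hwd : ∀ i ∈ J, MDifferentiableAt (𝓡 k) 𝓘(ℝ, ℝ) (w i) x := fun i hi ↦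
      (hw i x (hVU i (hηV i (hJt i hi)))).1.mdifferentiableAt (by simp)
    have hfx : ∑ i ∈ J, f x • grad (k := k) (η i) x = 0 := by
      by_cases hx : x ∈ K
      · have h1 := (grad_finset_sum_smul (k := k) I (u := fun _ _ ↦ (1 : ℝ))
          (fun i _ ↦ hηd i x) fun i _ ↦ mdifferentiableAt_const).2
        have h2 : grad (k := k) (fun y ↦ ∑ i ∈ I, η i y * (1 : ℝ)) x
            = grad (k := k) (fun _ ↦ (1 : ℝ)) x := by
          refine grad_congr ?_
          filter_upwards [hηK x hx] with y hy
          rw [← Finset.sum_mul, hy, one_mul]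
        have h3 : grad (k := k) (fun _ : M ↦ (1 : ℝ)) x = 0 := by
          rw [grad_eq_iff]
          intro v
          simp [mvfderiv, mfderiv_const]
        rw [h2, h3] at h1
        simp only [smul_zero, zero_add, one_smul] at h1
        rw [← Finset.smul_sum, hJ, Finset.sum_filter_of_ne, ← h1, smul_zero]
        intro i _ hne
        by_contra h
        exact hne (hloc i h)
      · simp [hfK x hx]
    have hgrad : grad (k := k) (fun y ↦ ∑ i ∈ I, η i y * w i y) x
        = ∑ i ∈ J, η i x • grad (k := k) (w i) x
          + ∑ i ∈ J, (w i x - f x) • grad (k := k) (η i) x := by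
      rw [grad_congr hev, (grad_finset_sum_smul J (fun i _ ↦ hηd i x) hwd).2,
        Finset.sum_add_distrib]
      simp only [sub_smul, Finset.sum_sub_distrib]
      rw [hfx, sub_zero]
    rw [hgrad]
    have h1 : ‖∑ i ∈ J, η i x • grad (k := k) (w i) x‖ ≤ 4 * L := by
      calc _ ≤ ∑ i ∈ J, ‖η i x • grad (k := k) (w i) x‖ := norm_sum_le _ _
        _ ≤ ∑ i ∈ J, η i x * (4 * L) := by
          refine Finset.sum_le_sum fun i hi ↦ ?_
          rw [norm_smul, Real.norm_eq_abs, abs_of_nonneg (hη0 i x)]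
          exact mul_le_mul_of_nonneg_left (hw i x (hVU i (hηV i (hJt i hi)))).2.2 (hη0 i x)
        _ ≤ ∑ i ∈ I, η i x * (4 * L) :=
          Finset.sum_le_sum_of_subset_of_nonneg (Finset.filter_subset _ _) fun i _ _ ↦
            mul_nonneg (hη0 i x) (by positivity)
        _ = (∑ i ∈ I, η i x) * (4 * L) := by rw [Finset.sum_mul]
        _ ≤ 1 * (4 * L) := by
          gcongr
          exact hη1 x
        _ = 4 * L := one_mul _
    have h2 : ‖∑ i ∈ J, (w i x - f x) • grad (k := k) (η i) x‖ ≤ L := by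
      calc _ ≤ ∑ i ∈ J, ‖(w i x - f x) • grad (k := k) (η i) x‖ := norm_sum_le _ _
        _ ≤ ∑ i ∈ J, δ * C i := by
          refine Finset.sum_le_sum fun i hi ↦ ?_
          rw [norm_smul, Real.norm_eq_abs]
          exact mul_le_mul (hw i x (hVU i (hηV i (hJt i hi)))).2.1 (hC i x) (norm_nonneg _) hδ0.le
        _ ≤ ∑ i ∈ I, δ * C i :=
          Finset.sum_le_sum_of_subset_of_nonneg (Finset.filter_subset _ _) fun i _ _ ↦
            mul_nonneg hδ0.le (hC0 i)
        _ = δ * D := by rw [Finset.mul_sum]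
        _ ≤ L / (D + 1) * (D + 1) := by
          gcongr
          · exact min_le_right _ _
          · linarith
        _ = L := by field_simp
    calc _ ≤ _ := norm_add_le _ _
      _ ≤ 4 * L + L := add_le_add h1 h2
      _ = 5 * L := by ring

theorem abs_clamp_sub_clamp_le (a b : ℝ) :
    |max 0 (min 1 a) - max 0 (min 1 b)| ≤ |a - b| := by
  have h1 := abs_max_sub_max_le_abs (min 1 a) (min 1 b) 0
  rw [max_comm 0, max_comm 0]
  refine h1.trans ?_
  have h2 := abs_min_sub_min_le_max 1 a 1 b
  simpa using h2

variable (k M) in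
/-- On a complete Riemannian manifold, there are compactly supported smooth functions that converge
to `1` and whose gradients converge uniformly to `0`. -/
theorem exists_cutoff [CompleteSpace M] [Nonempty M] :
    ∃ χ : ℕ → M → ℝ, (∀ j, ContMDiff (𝓡 k) 𝓘(ℝ, ℝ) ∞ (χ j)) ∧
      (∀ j, ∃ K, IsCompact K ∧ ∀ x ∉ K, χ j x = 0) ∧ (∀ j x, |χ j x| ≤ 2) ∧
      (∀ j x, ‖grad (k := k) (χ j) x‖ ≤ 5 / (j + 1)) ∧ ∀ x, Tendsto (fun j ↦ χ j x) atTop (𝓝 1) := by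
  have := properSpace_of_completeSpace k M
  have : SecondCountableTopology M := secondCountable_of_proper
  obtain ⟨x₀⟩ := ‹Nonempty M›
  -- This truncation is 1 on the ball of radius j + 1, vanishes outside the ball of radius 2(j + 1),
  -- and has Lipschitz constant 1/(j + 1).
  set F : ℕ → M → ℝ := fun j x ↦ max 0 (min 1 (2 - dist x x₀ / (j + 1))) with hF
  have hLip : ∀ j x y, |F j x - F j y| ≤ (1 / (j + 1) : ℝ) * dist x y := by
    intro j x y
    refine (abs_clamp_sub_clamp_le _ _).trans ?_
    have h1 : (2 - dist x x₀ / (j + 1)) - (2 - dist y x₀ / (j + 1))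
        = (1 / (j + 1) : ℝ) * (dist y x₀ - dist x x₀) := by ring
    rw [h1, abs_mul, abs_of_pos (by positivity), abs_sub_comm]
    gcongr
    exact abs_dist_sub_le x y x₀
  have hsupp : ∀ j : ℕ, ∀ x ∉ Metric.closedBall x₀ (2 * (j + 1)), F j x = 0 := by
    intro j x hx
    rw [Metric.mem_closedBall, not_le] at hx
    refine max_eq_left ((min_le_right _ _).trans ?_)
    have : 2 < dist x x₀ / (j + 1) := (lt_div_iff₀ (by positivity)).2 hx
    linarith
  have hF1 : ∀ j x, |F j x| ≤ 1 := fun j x ↦ by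
    rw [abs_of_nonneg (le_max_left _ _)]
    exact max_le zero_le_one (min_le_left _ _)
  choose χ hχ hχK hχF hχg using fun j : ℕ ↦ exists_smooth_approx (k := k)
    (L := (1 / (j + 1) : ℝ)) (ε := (1 / (j + 1) : ℝ)) (by positivity) (hLip j)
    (isCompact_closedBall x₀ _) (hsupp j) (by positivity)
  refine ⟨χ, hχ, hχK, fun j x ↦ ?_, fun j x ↦ ?_, fun x ↦ ?_⟩
  · have h1 : |χ j x| ≤ |χ j x - F j x| + |F j x| := by
      simpa using abs_add_le (χ j x - F j x) (F j x)
    have h2 : (1 / (j + 1) : ℝ) ≤ 1 := by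
      rw [div_le_one (by positivity)]
      linarith [(Nat.cast_nonneg j : (0 : ℝ) ≤ j)]
    linarith [hχF j x, hF1 j x]
  · exact (hχg j x).trans_eq (by ring)
  · have h1 : Tendsto (fun j ↦ χ j x - F j x) atTop (𝓝 0) :=
      squeeze_zero_norm (fun j ↦ hχF j x) tendsto_one_div_add_atTop_nhds_zero_nat
    have h2 : ∀ᶠ j in atTop, F j x = 1 := by
      filter_upwards [eventually_ge_atTop ⌈dist x x₀⌉₊] with j hj
      have h3 : dist x x₀ ≤ j := (Nat.le_ceil _).trans (by exact_mod_cast hj)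
      have h4 : dist x x₀ / (j + 1) ≤ 1 := by
        rw [div_le_one (by positivity)]
        linarith
      rw [hF]
      simp only
      rw [min_eq_left (by linarith), max_eq_right zero_le_one]
    have h3 : Tendsto (fun j ↦ F j x) atTop (𝓝 1) :=
      tendsto_const_nhds.congr' (h2.mono fun j hj ↦ hj.symm)
    simpa using h1.add h3

end Cutoff

/-! ### The bulk and boundary integrands -/

theorem natCast_le_infty (n : ℕ) : (n : ℕ∞ω) ≤ (∞ : ℕ∞ω) := by
  exact_mod_cast (le_top : (n : ℕ∞) ≤ ⊤)

section BilinForm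

variable {V : Type*} [NormedAddCommGroup V] [InnerProductSpace ℝ V] [FiniteDimensional ℝ V]

theorem bilinNormSq_nonneg (B : V → V → ℝ) : 0 ≤ bilinNormSq B :=
  Finset.sum_nonneg fun _ _ ↦ Finset.sum_nonneg fun _ _ ↦ sq_nonneg _

theorem sum_sq_repr_stdOrthonormalBasis (v : V) :
    ∑ i, ((stdOrthonormalBasis ℝ V).repr v i) ^ 2 = ‖v‖ ^ 2 := by
  rw [← (stdOrthonormalBasis ℝ V).repr.norm_map v, EuclideanSpace.norm_sq_eq]
  simp

/-- Cauchy–Schwarz for sums over pairs of basis vectors. -/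
theorem LinearMap.sq_apply_le_bilinNormSq (B : V →ₗ[ℝ] V →ₗ[ℝ] ℝ) (v w : V) :
    (B v w) ^ 2 ≤ bilinNormSq (fun v w ↦ B v w) * (‖v‖ ^ 2 * ‖w‖ ^ 2) := by
  set b := stdOrthonormalBasis ℝ V with hb
  have h1 : B v w = ∑ p : Fin (Module.finrank ℝ V) × Fin (Module.finrank ℝ V),
      B (b p.1) (b p.2) * (b.repr v p.1 * b.repr w p.2) := by
    conv_lhs => rw [← b.sum_repr v, ← b.sum_repr w]
    simp only [map_sum, map_smul, LinearMap.sum_apply, LinearMap.smul_apply, smul_eq_mul,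
      Finset.mul_sum, Fintype.sum_prod_type]
    rw [Finset.sum_comm]
    refine Finset.sum_congr rfl fun i _ ↦ Finset.sum_congr rfl fun j _ ↦ ?_
    ring
  have h2 : bilinNormSq (fun v w ↦ B v w)
      = ∑ p : Fin (Module.finrank ℝ V) × Fin (Module.finrank ℝ V), B (b p.1) (b p.2) ^ 2 := by
    rw [bilinNormSq, Fintype.sum_prod_type]
  have h3 : ‖v‖ ^ 2 * ‖w‖ ^ 2 = ∑ p : Fin (Module.finrank ℝ V) × Fin (Module.finrank ℝ V),
      (b.repr v p.1 * b.repr w p.2) ^ 2 := by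
    rw [← sum_sq_repr_stdOrthonormalBasis v, ← sum_sq_repr_stdOrthonormalBasis w,
      Finset.sum_mul_sum, Fintype.sum_prod_type]
    simp only [mul_pow, hb]
  rw [h1, h2, h3]
  exact Finset.sum_mul_sq_le_sq_mul_sq _ _ _

end BilinForm

section Integrands

variable {k : ℕ} {X : Type*} [TopologicalSpace X] [ChartedSpace (EuclideanSpace ℝ (Fin k)) X]
  [IsManifold (𝓡 k) ∞ X] [RiemannianBundle (fun x : X ↦ TangentSpace (𝓡 k) x)]
  [IsContMDiffRiemannianBundle (𝓡 k) ∞ (EuclideanSpace ℝ (Fin k))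
    (fun x : X ↦ TangentSpace (𝓡 k) x)] {φ h f χ u v : X → ℝ} {p : X}

theorem abs_hess_le (hu : ContMDiffAt (𝓡 k) 𝓘(ℝ, ℝ) 2 u p) (v w : TangentSpace (𝓡 k) p) :
    |hess u p v w| ≤ Real.sqrt (bilinNormSq (hess (k := k) u p)) * (‖v‖ * ‖w‖) := by
  have h := LinearMap.sq_apply_le_bilinNormSq (LinearMap.mk₂ ℝ (hess (k := k) u p)
    (hess_add_left hu) (hess_smul_left hu) hess_add_right fun c v w ↦ hess_smul_right c v w) v w
  simp only [LinearMap.mk₂_apply] at h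
  refine abs_le_of_sq_le_sq (h.trans_eq ?_) (by positivity)
  rw [mul_pow, Real.sq_sqrt (bilinNormSq_nonneg _), mul_pow]

theorem inner_grad_inner_grad (hu : ContMDiffAt (𝓡 k) 𝓘(ℝ, ℝ) 2 u p)
    (hv : ContMDiffAt (𝓡 k) 𝓘(ℝ, ℝ) 2 v p) (w : TangentSpace (𝓡 k) p) :
    inner ℝ (grad (k := k) (fun q ↦ inner ℝ (grad (k := k) u q) (grad v q)) p) w
      = hess u p w (grad v p) + hess v p w (grad u p) := by
  rw [inner_grad_left, mvfderiv_inner_grad hu hv]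

theorem greenIntegrand_mul (hχ : MDifferentiableAt (𝓡 k) 𝓘(ℝ, ℝ) χ p)
    (hu : MDifferentiableAt (𝓡 k) 𝓘(ℝ, ℝ) u p) :
    greenIntegrand (k := k) φ (fun x ↦ χ x * u x) v p
      = χ p * greenIntegrand (k := k) φ u v p
        + u p * inner ℝ (grad (k := k) χ p) (grad v p) := by
  rw [greenIntegrand, grad_mul hχ hu, inner_add_left, real_inner_smul_left, real_inner_smul_left,
    greenIntegrand]
  ring

/-- The first factors in the six applications of Green's formula that make up the Reilly
formula. -/
def reillyLeft (k : ℕ) {X : Type*} [TopologicalSpace X]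
    [ChartedSpace (EuclideanSpace ℝ (Fin k)) X]
    [RiemannianBundle (fun x : X ↦ TangentSpace (𝓡 k) x)] (φ h f : X → ℝ) : Fin 6 → X → ℝ :=
  ![fun x ↦ h x * weightedLaplacian (k := k) φ f x, fun x ↦ (-1 / 2) * h x,
    fun x ↦ (-1) * inner ℝ (grad (k := k) f x) (grad h x),
    fun x ↦ inner ℝ (grad (k := k) f x) (grad f x), fun x ↦ 2 * (h x * f x),
    fun x ↦ (-1) * (f x * f x)]

/-- The second factors in the six applications of Green's formula that make up the Reilly
formula. -/
def reillyRight (k : ℕ) {X : Type*} [TopologicalSpace X]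
    [ChartedSpace (EuclideanSpace ℝ (Fin k)) X]
    [RiemannianBundle (fun x : X ↦ TangentSpace (𝓡 k) x)] (h f : X → ℝ) : Fin 6 → X → ℝ :=
  ![f, fun x ↦ inner ℝ (grad (k := k) f x) (grad f x), f, h, f, h]

theorem contMDiffAt_reillyLeft (hφ : ContMDiffAt (𝓡 k) 𝓘(ℝ, ℝ) ∞ φ p)
    (hh : ContMDiffAt (𝓡 k) 𝓘(ℝ, ℝ) ∞ h p) (hf : ContMDiffAt (𝓡 k) 𝓘(ℝ, ℝ) ∞ f p) (i : Fin 6) :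
    ContMDiffAt (𝓡 k) 𝓘(ℝ, ℝ) 1 (reillyLeft k φ h f i) p := by
  have hh1 : ContMDiffAt (𝓡 k) 𝓘(ℝ, ℝ) 1 h p := hh.of_le (by simp)
  have hf1 : ContMDiffAt (𝓡 k) 𝓘(ℝ, ℝ) 1 f p := hf.of_le (by simp)
  have hw : ContMDiffAt (𝓡 k) 𝓘(ℝ, ℝ) 1 (weightedLaplacian (k := k) φ f) p :=
    contMDiffAt_weightedLaplacian (n := 1) (hφ.of_le (natCast_le_infty _))
      (hf.of_le (natCast_le_infty _))
  have hs : ContMDiffAt (𝓡 k) 𝓘(ℝ, ℝ) 1 (fun x ↦ inner ℝ (grad (k := k) f x) (grad h x)) p :=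
    contMDiffAt_inner_grad (n := 1) (hf.of_le (natCast_le_infty _))
      (hh.of_le (natCast_le_infty _))
  have hq : ContMDiffAt (𝓡 k) 𝓘(ℝ, ℝ) 1 (fun x ↦ inner ℝ (grad (k := k) f x) (grad f x)) p :=
    contMDiffAt_inner_grad (n := 1) (hf.of_le (natCast_le_infty _))
      (hf.of_le (natCast_le_infty _))
  fin_cases i
  · exact hh1.mul hw
  · exact contMDiffAt_const.mul hh1
  · exact contMDiffAt_const.mul hs
  · exact hq
  · exact contMDiffAt_const.mul (hh1.mul hf1)
  · exact contMDiffAt_const.mul (hf1.mul hf1)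

theorem contMDiffAt_reillyRight (hh : ContMDiffAt (𝓡 k) 𝓘(ℝ, ℝ) ∞ h p)
    (hf : ContMDiffAt (𝓡 k) 𝓘(ℝ, ℝ) ∞ f p) (i : Fin 6) :
    ContMDiffAt (𝓡 k) 𝓘(ℝ, ℝ) 2 (reillyRight k h f i) p := by
  have hh2 : ContMDiffAt (𝓡 k) 𝓘(ℝ, ℝ) 2 h p := hh.of_le two_le_infty
  have hf2 : ContMDiffAt (𝓡 k) 𝓘(ℝ, ℝ) 2 f p := hf.of_le two_le_infty
  have hq : ContMDiffAt (𝓡 k) 𝓘(ℝ, ℝ) 2 (fun x ↦ inner ℝ (grad (k := k) f x) (grad f x)) p :=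
    contMDiffAt_inner_grad (n := 2) (hf.of_le (natCast_le_infty _))
      (hf.of_le (natCast_le_infty _))
  fin_cases i
  · exact hf2
  · exact hq
  · exact hf2
  · exact hh2
  · exact hf2
  · exact hh2

/-- The pointwise identity behind the formula. By Bochner, h⟨∇Δ_φ f,∇f⟩ cancels between the first
two pairs, and the products ∇²f(∇f,∇h) from pairs two and three cancel those from pair four. The
terms Δ_φ f⟨∇f,∇h⟩ from pairs one and three and f⟨∇f,∇h⟩ from the last two pairs also cancel. -/
theorem sum_greenIntegrand_reilly (hφ : ContMDiffAt (𝓡 k) 𝓘(ℝ, ℝ) ∞ φ p)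
    (hh : ContMDiffAt (𝓡 k) 𝓘(ℝ, ℝ) ∞ h p) (hf : ContMDiffAt (𝓡 k) 𝓘(ℝ, ℝ) ∞ f p) :
    ∑ i, greenIntegrand (k := k) φ (reillyLeft k φ h f i) (reillyRight k h f i) p
      = h p * ((weightedLaplacian (k := k) φ f p + f p) ^ 2 - bilinNormSq (hess (k := k) f p))
        - (hess (k := k) h p (grad f p) (grad f p)
          - weightedLaplacian (k := k) φ h p * ‖grad (k := k) f p‖ ^ 2
          - 2 * h p * ‖grad (k := k) f p‖ ^ 2
          + h p * weightedRicci (k := k) φ p (grad f p) (grad f p))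
        - (weightedLaplacian (k := k) φ h p + h p) * f p ^ 2 := by
  have hh2 : ContMDiffAt (𝓡 k) 𝓘(ℝ, ℝ) 2 h p := hh.of_le two_le_infty
  have hf2 : ContMDiffAt (𝓡 k) 𝓘(ℝ, ℝ) 2 f p := hf.of_le two_le_infty
  have hhd : MDifferentiableAt (𝓡 k) 𝓘(ℝ, ℝ) h p := hh.mdifferentiableAt (by simp)
  have hfd : MDifferentiableAt (𝓡 k) 𝓘(ℝ, ℝ) f p := hf.mdifferentiableAt (by simp)
  have hwd : MDifferentiableAt (𝓡 k) 𝓘(ℝ, ℝ) (weightedLaplacian (k := k) φ f) p :=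
    (contMDiffAt_weightedLaplacian (n := 1) (hφ.of_le (natCast_le_infty _))
      (hf.of_le (natCast_le_infty _))).mdifferentiableAt (by simp)
  have hsd : MDifferentiableAt (𝓡 k) 𝓘(ℝ, ℝ)
      (fun x ↦ inner ℝ (grad (k := k) f x) (grad h x)) p :=
    (contMDiffAt_inner_grad (n := 1) (hf.of_le (natCast_le_infty _))
      (hh.of_le (natCast_le_infty _))).mdifferentiableAt (by simp)
  have hhf : MDifferentiableAt (𝓡 k) 𝓘(ℝ, ℝ) (fun x ↦ h x * f x) p := hhd.mul hfd
  have hff : MDifferentiableAt (𝓡 k) 𝓘(ℝ, ℝ) (fun x ↦ f x * f x) p := hfd.mul hfd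
  have hB := bochner_formula (hφ.of_le two_le_infty)
    (hf.of_le (natCast_le_infty 3))
  have hhq : inner ℝ (grad (k := k) h p)
      (grad (fun x ↦ inner ℝ (grad (k := k) f x) (grad f x)) p)
        = 2 * hess (k := k) f p (grad h p) (grad f p) := by
    rw [real_inner_comm, inner_grad_inner_grad hf2 hf2]
    ring
  have hcomm : inner ℝ (grad (k := k) h p) (grad f p) = inner ℝ (grad (k := k) f p) (grad h p) :=
    real_inner_comm _ _
  simp only [Fin.sum_univ_six, reillyLeft, reillyRight, Matrix.cons_val, greenIntegrand]
  rw [hB, grad_mul hhd hwd, grad_const_mul _ hhd, grad_const_mul _ hsd, grad_const_mul _ hhf,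
    grad_const_mul _ hff, grad_mul hhd hfd, grad_mul hfd hfd]
  simp only [inner_add_left, real_inner_smul_left]
  rw [inner_grad_inner_grad hf2 hh2, inner_grad_inner_grad hf2 hf2, hhq,
    ← inner_grad_left (weightedLaplacian (k := k) φ f) p, ← real_inner_self_eq_norm_sq,
    hess_symm hf2 (grad h p)]
  simp only [hcomm]
  ring

/-- This is the error created by a cutoff. Cauchy–Schwarz and Young's inequality bound it by the two
bulk densities in the definition of a suitable pair. -/
theorem abs_sum_mul_inner_grad_reilly_le
    (hf : ContMDiffAt (𝓡 k) 𝓘(ℝ, ℝ) ∞ f p) :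
    |∑ i, reillyLeft k φ h f i p * inner ℝ (grad (k := k) χ p) (grad (reillyRight k h f i) p)|
      ≤ ‖grad (k := k) χ p‖ * (2 * (|h p| * (f p ^ 2 + ‖grad (k := k) f p‖ ^ 2
        + bilinNormSq (hess (k := k) f p) + weightedLaplacian (k := k) φ f p ^ 2))
        + 2 * (‖grad (k := k) h p‖ * (f p ^ 2 + ‖grad (k := k) f p‖ ^ 2))) := by
  have hf2 : ContMDiffAt (𝓡 k) 𝓘(ℝ, ℝ) 2 f p := hf.of_le two_le_infty
  set a := ‖grad (k := k) χ p‖ with ha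
  set g := ‖grad (k := k) f p‖ with hg
  set b := ‖grad (k := k) h p‖ with hb
  set w := weightedLaplacian (k := k) φ f p with hw
  set H := Real.sqrt (bilinNormSq (hess (k := k) f p)) with hH
  have hHs : bilinNormSq (hess (k := k) f p) = H ^ 2 := (Real.sq_sqrt (bilinNormSq_nonneg _)).symm
  have hχf : |inner ℝ (grad (k := k) χ p) (grad f p)| ≤ a * g := abs_real_inner_le_norm _ _
  have hχh : |inner ℝ (grad (k := k) χ p) (grad h p)| ≤ a * b := abs_real_inner_le_norm _ _
  have hfh : |inner ℝ (grad (k := k) f p) (grad h p)| ≤ g * b := abs_real_inner_le_norm _ _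
  have hhess := abs_hess_le hf2 (grad (k := k) χ p) (grad (k := k) f p)
  rw [← hH, ← ha, ← hg] at hhess
  have hq : inner ℝ (grad (k := k) χ p)
      (grad (fun x ↦ inner ℝ (grad (k := k) f x) (grad f x)) p)
        = 2 * hess (k := k) f p (grad χ p) (grad f p) := by
    rw [real_inner_comm, inner_grad_inner_grad hf2 hf2]
    ring
  have hff : inner ℝ (grad (k := k) f p) (grad f p) = g ^ 2 := real_inner_self_eq_norm_sq _
  simp only [Fin.sum_univ_six, reillyLeft, reillyRight, Matrix.cons_val]
  rw [hq, hff, ← hw, hHs]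
  set X := inner ℝ (grad (k := k) χ p) (grad f p)
  set Y := inner ℝ (grad (k := k) χ p) (grad h p)
  set Z := inner ℝ (grad (k := k) f p) (grad h p)
  set T := hess (k := k) f p (grad χ p) (grad f p)
  have ha0 : 0 ≤ a := norm_nonneg _
  have hg0 : 0 ≤ g := norm_nonneg _
  have hb0 : 0 ≤ b := norm_nonneg _
  have hH0 : 0 ≤ H := Real.sqrt_nonneg _
  have e1 : |h p * w * X| ≤ |h p| * |w| * (a * g) := by
    rw [abs_mul, abs_mul]
    gcongr
  have e2 : |-1 / 2 * h p * (2 * T)| ≤ |h p| * (H * (a * g)) := by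
    rw [show -1 / 2 * h p * (2 * T) = -(h p * T) by ring, abs_neg, abs_mul]
    gcongr
  have e3 : |-1 * Z * X| ≤ g * b * (a * g) := by
    rw [neg_one_mul, abs_mul, abs_neg]
    gcongr
  have e4 : |g ^ 2 * Y| ≤ g ^ 2 * (a * b) := by
    rw [abs_mul, abs_of_nonneg (sq_nonneg g)]
    gcongr
  have e5 : |2 * (h p * f p) * X| ≤ 2 * (|h p| * |f p|) * (a * g) := by
    rw [abs_mul, abs_mul, abs_mul, abs_two]
    gcongr
  have e6 : |-1 * (f p * f p) * Y| ≤ f p ^ 2 * (a * b) := by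
    rw [neg_one_mul, abs_mul, abs_neg, abs_mul_self, ← pow_two]
    gcongr
  have hsum : |h p * w * X + -1 / 2 * h p * (2 * T) + -1 * Z * X + g ^ 2 * Y
      + 2 * (h p * f p) * X + -1 * (f p * f p) * Y|
      ≤ |h p * w * X| + |-1 / 2 * h p * (2 * T)| + |-1 * Z * X| + |g ^ 2 * Y|
      + |2 * (h p * f p) * X| + |-1 * (f p * f p) * Y| := by
    refine (abs_add_le _ _).trans (add_le_add_left ?_ _)
    refine (abs_add_le _ _).trans (add_le_add_left ?_ _)
    refine (abs_add_le _ _).trans (add_le_add_left ?_ _)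
    refine (abs_add_le _ _).trans (add_le_add_left ?_ _)
    exact abs_add_le _ _
  have i1 : |w| * g ≤ (w ^ 2 + g ^ 2) / 2 := by
    rw [← sq_abs w]
    linarith [two_mul_le_add_sq |w| g]
  have i2 : H * g ≤ (H ^ 2 + g ^ 2) / 2 := by linarith [two_mul_le_add_sq H g]
  have i3 : 2 * (|f p| * g) ≤ f p ^ 2 + g ^ 2 := by
    rw [← sq_abs (f p)]
    linarith [two_mul_le_add_sq |f p| g]
  calc _ ≤ _ := hsum
    _ ≤ a * (|h p| * (|w| * g + H * g + 2 * (|f p| * g)) + b * (2 * g ^ 2 + f p ^ 2)) := by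
      linarith
    _ ≤ a * (|h p| * (2 * (f p ^ 2 + g ^ 2 + H ^ 2 + w ^ 2)) + b * (2 * (f p ^ 2 + g ^ 2))) := by
      gcongr
      · linarith [sq_nonneg (f p), sq_nonneg H, sq_nonneg w]
      · linarith [sq_nonneg (f p)]
    _ = _ := by ring

end Integrands

/-! ### Boundary terms of the Reilly formula -/

section BoundaryIntegrands

variable {m : ℕ}
  {M : Type*} [TopologicalSpace M] [ChartedSpace (EuclideanSpace ℝ (Fin (m + 1))) M]
  [IsManifold (𝓡 (m + 1)) ∞ M]
  [RiemannianBundle (fun x : M ↦ TangentSpace (𝓡 (m + 1)) x)]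
  [IsContMDiffRiemannianBundle (𝓡 (m + 1)) ∞ (EuclideanSpace ℝ (Fin (m + 1)))
    (fun x : M ↦ TangentSpace (𝓡 (m + 1)) x)]
  {S : Type*} [TopologicalSpace S] [ChartedSpace (EuclideanSpace ℝ (Fin m)) S]
  [IsManifold (𝓡 m) ∞ S]
  [RiemannianBundle (fun s : S ↦ TangentSpace (𝓡 m) s)]
  [IsContMDiffRiemannianBundle (𝓡 m) ∞ (EuclideanSpace ℝ (Fin m))
    (fun s : S ↦ TangentSpace (𝓡 m) s)]
  {Ω : Set M} {ι : S → M} {ν : ∀ s : S, TangentSpace (𝓡 (m + 1)) (ι s)} {s : S}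
  {φ h f χ : M → ℝ}

theorem contMDiffAt_comp_embedding (hΩ : IsDomainWithBoundary (m := m) Ω ι) {n : ℕ∞ω}
    (hn : n ≤ (∞ : ℕ∞ω)) {u : M → ℝ} (hu : ContMDiffAt (𝓡 (m + 1)) 𝓘(ℝ, ℝ) n u (ι s)) :
    ContMDiffAt (𝓡 m) 𝓘(ℝ, ℝ) n (u ∘ ι) s :=
  ContMDiffAt.comp s hu ((hΩ.embedding.contMDiff s).of_le hn)

/-- By Pythagoras a restriction has the smaller gradient, so ambient cutoffs also serve on the
boundary. -/
theorem norm_grad_comp_le (hΩ : IsDomainWithBoundary (m := m) Ω ι)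
    (hν : IsOutwardUnitNormal (m := m) Ω ι ν)
    (hχ : MDifferentiableAt (𝓡 (m + 1)) 𝓘(ℝ, ℝ) χ (ι s)) :
    ‖grad (k := m) (χ ∘ ι) s‖ ≤ ‖grad (k := m + 1) χ (ι s)‖ := by
  have h := inner_grad_eq_add_normal hΩ hν hχ hχ
  rw [real_inner_self_eq_norm_sq, real_inner_self_eq_norm_sq] at h
  exact abs_le_of_sq_le_sq' (by nlinarith [mul_self_nonneg (normalDeriv ι ν χ s)])
    (norm_nonneg _) |>.2

/-- The sum contains h f_ν Δ_{Σ,φ} f once, together with −h⟨D f_ν, Df⟩ and −f_ν⟨Dh, Df⟩. Subtracting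
the divergence of h f_ν Df on the boundary absorbs the last two terms, and this accounts for the
factor 2 in the formula. The terms with ∇²f(ν,ν) cancel. -/
theorem sum_mul_normalDeriv_reilly (hΩ : IsDomainWithBoundary (m := m) Ω ι)
    (hν : IsOutwardUnitNormal (m := m) Ω ι ν)
    (hφ : ContMDiffAt (𝓡 (m + 1)) 𝓘(ℝ, ℝ) ∞ φ (ι s))
    (hh : ContMDiffAt (𝓡 (m + 1)) 𝓘(ℝ, ℝ) ∞ h (ι s))
    (hf : ContMDiffAt (𝓡 (m + 1)) 𝓘(ℝ, ℝ) ∞ f (ι s)) :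
    ∑ i, reillyLeft (m + 1) φ h f i (ι s) * normalDeriv ι ν (reillyRight (m + 1) h f i) s
      = h (ι s) * (2 * normalDeriv ι ν f s * weightedLaplacian (k := m) (φ ∘ ι) (f ∘ ι) s
          + weightedMeanCurvature ι ν φ s * normalDeriv ι ν f s ^ 2
          + secondFundamentalForm ι ν s (grad (f ∘ ι) s) (grad (f ∘ ι) s)
          + 2 * normalDeriv ι ν f s * f (ι s))
        + normalDeriv ι ν h s * (‖grad (k := m) (f ∘ ι) s‖ ^ 2 - f (ι s) ^ 2)
        - greenIntegrand (k := m) (φ ∘ ι) (fun t ↦ h (ι t) * normalDeriv ι ν f t) (f ∘ ι) s := by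
  have hf2 : ContMDiffAt (𝓡 (m + 1)) 𝓘(ℝ, ℝ) 2 f (ι s) := hf.of_le two_le_infty
  have hhd : MDifferentiableAt (𝓡 (m + 1)) 𝓘(ℝ, ℝ) h (ι s) := hh.mdifferentiableAt (by simp)
  have hfd : MDifferentiableAt (𝓡 (m + 1)) 𝓘(ℝ, ℝ) f (ι s) := hf.mdifferentiableAt (by simp)
  have hhι : MDifferentiableAt (𝓡 m) 𝓘(ℝ, ℝ) (h ∘ ι) s :=
    (contMDiffAt_comp_embedding hΩ le_rfl hh).mdifferentiableAt (by simp)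
  have hfν : MDifferentiableAt (𝓡 m) 𝓘(ℝ, ℝ) (normalDeriv ι ν f) s :=
    (contMDiffAt_normalDeriv (n := 1) hΩ hν hf2).mdifferentiableAt (by simp)
  have hL := weightedLaplacian_eq_add hΩ hν (hφ.mdifferentiableAt (by simp)) hf2
  have hq : normalDeriv ι ν (fun x ↦ inner ℝ (grad (k := m + 1) f x) (grad f x)) s
      = 2 * (hess f (ι s) (mfderiv (𝓡 m) (𝓡 (m + 1)) ι s (grad (f ∘ ι) s)) (ν s)
        + normalDeriv ι ν f s * hess f (ι s) (ν s) (ν s)) := by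
    rw [normalDeriv, inner_grad_inner_grad hf2 hf2, hess_symm hf2, ← hess_smul_left hf2,
      ← hess_add_left hf2 (mfderiv (𝓡 m) (𝓡 (m + 1)) ι s (grad (f ∘ ι) s)),
      ← grad_eq_add_normal hΩ hν hfd]
    ring
  have hD := mvfderiv_normalDeriv hΩ hν hf2 (grad (f ∘ ι) s)
  have hG : greenIntegrand (k := m) (φ ∘ ι) (fun t ↦ h (ι t) * normalDeriv ι ν f t) (f ∘ ι) s
      = h (ι s) * normalDeriv ι ν f s * weightedLaplacian (k := m) (φ ∘ ι) (f ∘ ι) s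
        + (h (ι s) * mvfderiv (𝓡 m) (normalDeriv ι ν f) s (grad (f ∘ ι) s)
          + normalDeriv ι ν f s * inner ℝ (grad (k := m) (f ∘ ι) s) (grad (h ∘ ι) s)) := by
    have hmul := grad_mul (k := m) hhι hfν
    simp only [Function.comp] at hmul
    rw [greenIntegrand, hmul, inner_add_left, real_inner_smul_left, real_inner_smul_left,
      inner_grad_left (normalDeriv ι ν f), real_inner_comm]
  rw [hG, hD]
  simp only [Fin.sum_univ_six, reillyLeft, reillyRight, Matrix.cons_val]
  rw [hq, hL, inner_grad_eq_add_normal hΩ hν hfd hhd, inner_grad_eq_add_normal hΩ hν hfd hfd,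
    real_inner_self_eq_norm_sq]
  ring

end BoundaryIntegrands

/-! ### Passing to the limit -/

/-- Dominated convergence with majorant 2|Q| + |c b|. Measurability is required only of the sum of
main term and error. -/
theorem tendsto_integral_cutoff {X : Type*} [MeasurableSpace X] {μ : Measure X} {Q b : X → ℝ}
    {χ E : ℕ → X → ℝ} {c : ℝ} (hQ : Integrable Q μ) (hb : Integrable b μ)
    (hχ2 : ∀ j x, |χ j x| ≤ 2) (hχ : ∀ x, Tendsto (fun j ↦ χ j x) atTop (𝓝 1))
    (hE : ∀ᵐ x ∂μ, ∀ j : ℕ, |E j x| ≤ c / (j + 1) * b x)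
    (hm : ∀ j, AEStronglyMeasurable (fun x ↦ χ j x * Q x + E j x) μ) :
    Tendsto (fun j ↦ ∫ x, (χ j x * Q x + E j x) ∂μ) atTop (𝓝 (∫ x, Q x ∂μ)) := by
  refine tendsto_integral_of_dominated_convergence (fun x ↦ 2 * |Q x| + |c * b x|) hm
    ((hQ.abs.const_mul 2).add (hb.const_mul c).abs) (fun j ↦ ?_) ?_
  · filter_upwards [hE] with x hx
    have h1 : (0 : ℝ) < 1 / (j + 1) := by positivity
    have h2 : (1 / (j + 1) : ℝ) ≤ 1 := by
      rw [div_le_one (by positivity)]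
      linarith [(Nat.cast_nonneg j : (0 : ℝ) ≤ j)]
    have h3 : |E j x| ≤ |c * b x| := by
      calc |E j x| ≤ c / (j + 1) * b x := hx j
        _ = 1 / (j + 1) * (c * b x) := by ring
        _ ≤ 1 / (j + 1) * |c * b x| := by
          gcongr
          exact le_abs_self _
        _ ≤ 1 * |c * b x| := by gcongr
        _ = |c * b x| := one_mul _
    have h4 : |χ j x * Q x| ≤ 2 * |Q x| := by
      rw [abs_mul]
      gcongr
      exact hχ2 j x
    rw [Real.norm_eq_abs]
    exact (abs_add_le _ _).trans (add_le_add h4 h3)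
  · filter_upwards [hE] with x hx
    have h1 : Tendsto (fun j : ℕ ↦ c / ((j : ℝ) + 1) * b x) atTop (𝓝 0) := by
      have := (tendsto_one_div_add_atTop_nhds_zero_nat (𝕜 := ℝ)).const_mul (c * b x)
      rw [mul_zero] at this
      refine this.congr fun j ↦ ?_
      ring
    have h2 : Tendsto (fun j ↦ E j x) atTop (𝓝 0) := squeeze_zero_norm (fun j ↦ hx j) h1
    simpa using ((hχ x).mul_const (Q x)).add h2

section Limit

/-- The boundary needs dimension at least 1 for the coordinate divergence theorem to apply; this is
where dim M ≥ 2 enters. -/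
theorem integral_greenIntegrand_eq_zero_of_pos {m : ℕ} (hm : 1 ≤ m) {S : Type*}
    [TopologicalSpace S] [T2Space S] [ChartedSpace (EuclideanSpace ℝ (Fin m)) S]
    [IsManifold (𝓡 m) ∞ S] [RiemannianBundle (fun s : S ↦ TangentSpace (𝓡 m) s)]
    [IsContMDiffRiemannianBundle (𝓡 m) ∞ (EuclideanSpace ℝ (Fin m))
      (fun s : S ↦ TangentSpace (𝓡 m) s)]
    [MeasurableSpace S] [BorelSpace S] [SecondCountableTopology S] {ψ u v : S → ℝ}
    (hψ : ContMDiff (𝓡 m) 𝓘(ℝ, ℝ) ∞ ψ) {K : Set S}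
    (hK : IsCompact K) (huK : ∀ x ∉ K, u x = 0)
    (hu : ∀ x, ContMDiffAt (𝓡 m) 𝓘(ℝ, ℝ) 1 u x)
    (hv : ∀ x, ContMDiffAt (𝓡 m) 𝓘(ℝ, ℝ) 2 v x) :
    Integrable (greenIntegrand (k := m) ψ u v) (weightedVolume (k := m) ψ) ∧
      ∫ x, greenIntegrand (k := m) ψ u v x ∂(weightedVolume (k := m) ψ) = 0 := by
  obtain ⟨n, rfl⟩ := Nat.exists_eq_add_of_le' hm
  refine ⟨?_, integral_greenIntegrand_eq_zero hψ hK huK hu hv⟩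
  rw [← integrableOn_univ]
  exact integrableOn_greenIntegrand hψ MeasurableSet.univ hK huK (fun x _ ↦ hu x) fun x _ ↦ hv x

variable {m : ℕ}
  {M : Type*} [TopologicalSpace M] [T2Space M] [SecondCountableTopology M]
  [MeasurableSpace M] [BorelSpace M]
  [ChartedSpace (EuclideanSpace ℝ (Fin (m + 1))) M] [IsManifold (𝓡 (m + 1)) ∞ M]
  [RiemannianBundle (fun x : M ↦ TangentSpace (𝓡 (m + 1)) x)]
  [IsContMDiffRiemannianBundle (𝓡 (m + 1)) ∞ (EuclideanSpace ℝ (Fin (m + 1)))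
    (fun x : M ↦ TangentSpace (𝓡 (m + 1)) x)]
  {S : Type*} [TopologicalSpace S] [T2Space S] [SecondCountableTopology S]
  [MeasurableSpace S] [BorelSpace S]
  [ChartedSpace (EuclideanSpace ℝ (Fin m)) S] [IsManifold (𝓡 m) ∞ S]
  [RiemannianBundle (fun s : S ↦ TangentSpace (𝓡 m) s)]
  [IsContMDiffRiemannianBundle (𝓡 m) ∞ (EuclideanSpace ℝ (Fin m))
    (fun s : S ↦ TangentSpace (𝓡 m) s)]
  {φ : M → ℝ} {Ω : Set M} {ι : S → M} {ν : ∀ s : S, TangentSpace (𝓡 (m + 1)) (ι s)}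
  {h f χ : M → ℝ}

/-- Green's formula for the pairs (χUᵢ, Vᵢ), summed; the product rule separates the main term from
the error with ∇χ. -/
theorem integral_sum_greenIntegrand_eq (hφ : ContMDiff (𝓡 (m + 1)) 𝓘(ℝ, ℝ) ∞ φ)
    (hΩ : IsDomainWithBoundary (m := m) Ω ι) (hν : IsOutwardUnitNormal (m := m) Ω ι ν)
    {J : Type*} [Fintype J] {U V : J → M → ℝ}
    (hU : ∀ i, ∀ x ∈ closure Ω, ContMDiffAt (𝓡 (m + 1)) 𝓘(ℝ, ℝ) 1 (U i) x)
    (hV : ∀ i, ∀ x ∈ closure Ω, ContMDiffAt (𝓡 (m + 1)) 𝓘(ℝ, ℝ) 2 (V i) x)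
    (hχ : ContMDiff (𝓡 (m + 1)) 𝓘(ℝ, ℝ) ∞ χ) {K : Set M} (hK : IsCompact K)
    (hχK : ∀ x ∉ K, χ x = 0) :
    IntegrableOn (fun x ↦ χ x * ∑ i, greenIntegrand (k := m + 1) φ (U i) (V i) x
      + ∑ i, U i x * inner ℝ (grad (k := m + 1) χ x) (grad (V i) x)) Ω
      (weightedVolume (k := m + 1) φ) ∧
    Integrable (fun s ↦ χ (ι s) * ∑ i, U i (ι s) * normalDeriv ι ν (V i) s)
      (weightedVolume (k := m) (φ ∘ ι)) ∧
    ∫ x in Ω, (χ x * ∑ i, greenIntegrand (k := m + 1) φ (U i) (V i) x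
      + ∑ i, U i x * inner ℝ (grad (k := m + 1) χ x) (grad (V i) x))
      ∂(weightedVolume (k := m + 1) φ)
    = ∫ s, χ (ι s) * ∑ i, U i (ι s) * normalDeriv ι ν (V i) s
      ∂(weightedVolume (k := m) (φ ∘ ι)) := by
  have hχ1 : ∀ x, ContMDiffAt (𝓡 (m + 1)) 𝓘(ℝ, ℝ) 1 χ x := fun x ↦ hχ.contMDiffAt.of_le (by simp)
  have hχU : ∀ i, ∀ x ∈ closure Ω,
      ContMDiffAt (𝓡 (m + 1)) 𝓘(ℝ, ℝ) 1 (fun x ↦ χ x * U i x) x :=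
    fun i x hx ↦ (hχ1 x).mul (hU i x hx)
  have h0 : ∀ i, ∀ x ∉ K, χ x * U i x = 0 := fun i x hx ↦ by rw [hχK x hx, zero_mul]
  have hV1 : ∀ i, ∀ x ∈ closure Ω, ContMDiffAt (𝓡 (m + 1)) 𝓘(ℝ, ℝ) 1 (V i) x := fun i x hx ↦
    (hV i x hx).of_le (by norm_num)
  have hbulk : EqOn (fun x ↦ χ x * ∑ i, greenIntegrand (k := m + 1) φ (U i) (V i) x
      + ∑ i, U i x * inner ℝ (grad (k := m + 1) χ x) (grad (V i) x))
      (fun x ↦ ∑ i, greenIntegrand (k := m + 1) φ (fun x ↦ χ x * U i x) (V i) x) Ω := by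
    intro x hx
    simp only
    rw [Finset.mul_sum, ← Finset.sum_add_distrib]
    exact Finset.sum_congr rfl fun i _ ↦ (greenIntegrand_mul ((hχ1 x).mdifferentiableAt (by simp))
      ((hU i x (subset_closure hx)).mdifferentiableAt (by simp))).symm
  have hbd : (fun s ↦ χ (ι s) * ∑ i, U i (ι s) * normalDeriv ι ν (V i) s)
      = fun s ↦ ∑ i, (fun x ↦ χ x * U i x) (ι s) * normalDeriv ι ν (V i) s := by
    ext s
    rw [Finset.mul_sum]
    exact Finset.sum_congr rfl fun i _ ↦ (mul_assoc _ _ _).symm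
  have hint : ∀ i, IntegrableOn (greenIntegrand (k := m + 1) φ (fun x ↦ χ x * U i x) (V i)) Ω
      (weightedVolume (k := m + 1) φ) := fun i ↦
    integrableOn_greenIntegrand (ψ := φ) (u := fun x ↦ χ x * U i x) (v := V i) hφ
      hΩ.isOpen.measurableSet hK (h0 i) (hχU i) (hV i)
  have hintS : ∀ i, Integrable (fun s ↦ (fun x ↦ χ x * U i x) (ι s) * normalDeriv ι ν (V i) s)
      (weightedVolume (k := m) (φ ∘ ι)) := fun i ↦
    integrable_mul_normalDeriv (ψ := φ) (u := fun x ↦ χ x * U i x) (v := V i) hφ hΩ hν hK (h0 i) (fun x hx ↦ (hχU i x hx).continuousAt)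
      fun x hx _ ↦ hV1 i x hx
  have hint' := integrable_finsetSum Finset.univ fun i _ ↦ hint i
  have hintS' := integrable_finsetSum Finset.univ fun i _ ↦ hintS i
  have hsum := integral_finsetSum Finset.univ fun i _ ↦ hint i
  have hsumS := integral_finsetSum Finset.univ fun i _ ↦ hintS i
  refine ⟨(integrableOn_congr_fun hbulk hΩ.isOpen.measurableSet).2 hint', hbd ▸ hintS', ?_⟩
  rw [setIntegral_congr_fun hΩ.isOpen.measurableSet hbulk, hbd, hsum, hsumS]
  exact Finset.sum_congr rfl fun i _ ↦
    integral_greenIntegrand_eq (ψ := φ) (u := fun x ↦ χ x * U i x) (v := V i) hφ hΩ hν hK (h0 i)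
      (hχU i) (hV i)

theorem continuousOn_sum_greenIntegrand_reilly (hφ : ContMDiff (𝓡 (m + 1)) 𝓘(ℝ, ℝ) ∞ φ)
    (hh : SmoothOnClosed (m := m) (closure Ω) h) (hf : SmoothOnClosed (m := m) (closure Ω) f) :
    ContinuousOn (fun x ↦ ∑ i, greenIntegrand (k := m + 1) φ (reillyLeft (m + 1) φ h f i)
      (reillyRight (m + 1) h f i) x) (closure Ω) :=
  continuousOn_finsetSum _ fun i _ x hx ↦ (continuousAt_greenIntegrand hφ
    (contMDiffAt_reillyLeft hφ.contMDiffAt (hh x hx) (hf x hx) i)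
    (contMDiffAt_reillyRight (hh x hx) (hf x hx) i)).continuousWithinAt

theorem continuousOn_reilly_left (hφ : ContMDiff (𝓡 (m + 1)) 𝓘(ℝ, ℝ) ∞ φ)
    (hh : SmoothOnClosed (m := m) (closure Ω) h) (hf : SmoothOnClosed (m := m) (closure Ω) f) :
    ContinuousOn (fun x ↦ h x * ((weightedLaplacian (k := m + 1) φ f x + f x) ^ 2
      - bilinNormSq (hess (k := m + 1) f x))) (closure Ω) := fun x hx ↦
  ((hh x hx).continuousAt.mul ((((contMDiffAt_weightedLaplacian (n := 0)
    (hφ.contMDiffAt.of_le (natCast_le_infty _))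
    ((hf x hx).of_le (natCast_le_infty _))).continuousAt.add (hf x hx).continuousAt).pow 2).sub
    (contMDiffAt_bilinNormSq_hess (n := 0)
      ((hf x hx).of_le (natCast_le_infty _))).continuousAt)).continuousWithinAt

/-- The Sobolev density controls the left integrand, since (Δ_φ f + f)² ≤ 2((Δ_φ f)² + f²). -/
theorem integrableOn_reilly_left (hφ : ContMDiff (𝓡 (m + 1)) 𝓘(ℝ, ℝ) ∞ φ)
    (hΩ : IsDomainWithBoundary (m := m) Ω ι)
    (hh : SmoothOnClosed (m := m) (closure Ω) h) (hf : SmoothOnClosed (m := m) (closure Ω) f)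
    (hs : IsSuitablePair (m := m) φ Ω ι ν h f) :
    IntegrableOn (fun x ↦ h x * ((weightedLaplacian (k := m + 1) φ f x + f x) ^ 2
      - bilinNormSq (hess (k := m + 1) f x))) Ω (weightedVolume (k := m + 1) φ) := by
  refine (hs.sobolev.const_mul 2).mono' (((continuousOn_reilly_left hφ hh hf).mono
    subset_closure).aestronglyMeasurable hΩ.isOpen.measurableSet) (Eventually.of_forall fun x ↦ ?_)
  set w := weightedLaplacian (k := m + 1) φ f x
  set H := bilinNormSq (hess (k := m + 1) f x)
  have hH : 0 ≤ H := bilinNormSq_nonneg _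
  rw [Real.norm_eq_abs, abs_mul, mul_left_comm]
  refine mul_le_mul_of_nonneg_left (abs_le.2 ⟨?_, ?_⟩) (abs_nonneg _)
  · nlinarith [sq_nonneg (w + f x), sq_nonneg (f x), sq_nonneg w,
      sq_nonneg ‖grad (k := m + 1) f x‖]
  · nlinarith [sq_nonneg (w - f x), sq_nonneg ‖grad (k := m + 1) f x‖]

/-- The Reilly formula, up to a splitting of the integrals. -/
theorem integral_reilly_eq (hm : 1 ≤ m) (hφ : ContMDiff (𝓡 (m + 1)) 𝓘(ℝ, ℝ) ∞ φ)
    (hΩ : IsDomainWithBoundary (m := m) Ω ι) (hν : IsOutwardUnitNormal (m := m) Ω ι ν)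
    (hh : SmoothOnClosed (m := m) (closure Ω) h) (hf : SmoothOnClosed (m := m) (closure Ω) f)
    {χ : ℕ → M → ℝ} (hχ : ∀ j, ContMDiff (𝓡 (m + 1)) 𝓘(ℝ, ℝ) ∞ (χ j))
    (hχK : ∀ j, ∃ K, IsCompact K ∧ ∀ x ∉ K, χ j x = 0) (hχ2 : ∀ j x, |χ j x| ≤ 2) {c : ℝ}
    (hχg : ∀ j x, ‖grad (k := m + 1) (χ j) x‖ ≤ c / (j + 1))
    (hχ1 : ∀ x, Tendsto (fun j ↦ χ j x) atTop (𝓝 1))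
    (hs : IsSuitablePair (m := m) φ Ω ι ν h f) {Q : M → ℝ} {R : S → ℝ}
    (hQ : ∀ x ∈ Ω, Q x = ∑ i, greenIntegrand (k := m + 1) φ (reillyLeft (m + 1) φ h f i)
      (reillyRight (m + 1) h f i) x) (hQi : IntegrableOn Q Ω (weightedVolume (k := m + 1) φ))
    (hR : ∀ s, ∑ i, reillyLeft (m + 1) φ h f i (ι s) * normalDeriv ι ν (reillyRight (m + 1) h f i) s
      = R s - greenIntegrand (k := m) (φ ∘ ι) (fun t ↦ h (ι t) * normalDeriv ι ν f t) (f ∘ ι) s)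
    (hRi : Integrable R (weightedVolume (k := m) (φ ∘ ι))) :
    ∫ x in Ω, Q x ∂(weightedVolume (k := m + 1) φ)
      = ∫ s, R s ∂(weightedVolume (k := m) (φ ∘ ι)) := by
  have hι := isClosedEmbedding_of_isDomainWithBoundary hΩ
  have hcl := mem_closure_of_isDomainWithBoundary hΩ
  choose K hK hχK using hχK
  set U := reillyLeft (m + 1) φ h f with hU
  set V := reillyRight (m + 1) h f with hV
  set E : ℕ → M → ℝ := fun j x ↦
    ∑ i, U i x * inner ℝ (grad (k := m + 1) (χ j) x) (grad (V i) x) with hE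
  set e : ℕ → S → ℝ := fun j s ↦ h (ι s) * normalDeriv ι ν f s
    * inner ℝ (grad (k := m) (χ j ∘ ι) s) (grad (f ∘ ι) s) with he
  set g : S → ℝ := greenIntegrand (k := m) (φ ∘ ι) (fun t ↦ h (ι t) * normalDeriv ι ν f t) (f ∘ ι)
  have hgreen := fun j ↦ integral_sum_greenIntegrand_eq hφ hΩ hν
    (fun i x hx ↦ contMDiffAt_reillyLeft hφ.contMDiffAt (hh x hx) (hf x hx) i)
    (fun i x hx ↦ contMDiffAt_reillyRight (hh x hx) (hf x hx) i) (hχ j) (hK j) (hχK j)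
  have hQE : ∀ j, EqOn (fun x ↦ χ j x * Q x + E j x)
      (fun x ↦ χ j x * ∑ i, greenIntegrand (k := m + 1) φ (U i) (V i) x + E j x) Ω :=
    fun j x hx ↦ by
      simp only
      rw [hQ x hx]
  have hχι : ∀ j s, ContMDiffAt (𝓡 m) 𝓘(ℝ, ℝ) 1 (χ j ∘ ι) s := fun j s ↦
    contMDiffAt_comp_embedding hΩ (by simp) ((hχ j).contMDiffAt.of_le (by simp))
  have hu : ∀ s, ContMDiffAt (𝓡 m) 𝓘(ℝ, ℝ) 1 (fun t ↦ h (ι t) * normalDeriv ι ν f t) s := fun s ↦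
    (contMDiffAt_comp_embedding hΩ (by simp) ((hh _ (hcl s)).of_le (by simp))).mul
      (contMDiffAt_normalDeriv (n := 1) hΩ hν ((hf _ (hcl s)).of_le (natCast_le_infty _)))
  have hS := fun j ↦ integral_greenIntegrand_eq_zero_of_pos hm
    (ψ := φ ∘ ι) (fun s ↦ contMDiffAt_comp_embedding hΩ le_rfl hφ.contMDiffAt)
    (u := fun s ↦ (χ j ∘ ι) s * (h (ι s) * normalDeriv ι ν f s)) (v := f ∘ ι)
    (hι.isCompact_preimage (hK j))
    (fun s hs ↦ by rw [Function.comp, hχK j _ hs, zero_mul]) (fun s ↦ (hχι j s).mul (hu s))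
    fun s ↦ contMDiffAt_comp_embedding hΩ two_le_infty ((hf _ (hcl s)).of_le two_le_infty)
  have hge : ∀ j, greenIntegrand (k := m) (φ ∘ ι)
      (fun s ↦ (χ j ∘ ι) s * (h (ι s) * normalDeriv ι ν f s)) (f ∘ ι)
        = fun s ↦ χ j (ι s) * g s + e j s := fun j ↦ by
    ext s
    exact greenIntegrand_mul ((hχι j s).mdifferentiableAt (by simp))
      ((hu s).mdifferentiableAt (by simp))
  -- The divergence `g` is not known to be integrable. Its cut-off version χg + e is, with integral
  -- zero, so it is added to the boundary sum before the limit; this leaves `R` and the error `e`.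
  have hRe : ∀ j, (fun s ↦ χ j (ι s) * R s + e j s)
      = fun s ↦ χ j (ι s) * ∑ i, U i (ι s) * normalDeriv ι ν (V i) s
        + (χ j (ι s) * g s + e j s) := fun j ↦ by
    ext s
    rw [hR s]
    ring
  have hSi : ∀ j, Integrable (fun s ↦ χ j (ι s) * g s + e j s) (weightedVolume (k := m) (φ ∘ ι)) :=
    fun j ↦ hge j ▸ (hS j).1
  have heq : ∀ j, ∫ x in Ω, (χ j x * Q x + E j x) ∂(weightedVolume (k := m + 1) φ)
      = ∫ s, (χ j (ι s) * R s + e j s) ∂(weightedVolume (k := m) (φ ∘ ι)) := by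
    intro j
    have h1 := (hS j).2
    rw [hge j] at h1
    rw [setIntegral_congr_fun hΩ.isOpen.measurableSet (hQE j), (hgreen j).2.2, hRe j,
      integral_add (hgreen j).2.1 (hSi j), h1, add_zero]
  have hlim1 : Tendsto (fun j ↦ ∫ x in Ω, (χ j x * Q x + E j x) ∂(weightedVolume (k := m + 1) φ))
      atTop (𝓝 (∫ x in Ω, Q x ∂(weightedVolume (k := m + 1) φ))) := by
    refine tendsto_integral_cutoff (c := c) hQi
      ((hs.sobolev.const_mul 2).add (hs.sobolev_grad.const_mul 2)) hχ2 hχ1 ?_ fun j ↦ ?_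
    · refine (ae_restrict_mem hΩ.isOpen.measurableSet).mono fun x hx j ↦ ?_
      refine (abs_sum_mul_inner_grad_reilly_le (hf x (subset_closure hx))).trans ?_
      refine mul_le_mul_of_nonneg_right (hχg j x) ?_
      have := bilinNormSq_nonneg (hess (k := m + 1) f x)
      positivity
    · exact ((integrableOn_congr_fun (hQE j) hΩ.isOpen.measurableSet).2
        (hgreen j).1).aestronglyMeasurable
  have hlim2 : Tendsto (fun j ↦ ∫ s, (χ j (ι s) * R s + e j s) ∂(weightedVolume (k := m) (φ ∘ ι)))
      atTop (𝓝 (∫ s, R s ∂(weightedVolume (k := m) (φ ∘ ι)))) := by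
    refine tendsto_integral_cutoff (c := c) (χ := fun j s ↦ χ j (ι s)) hRi hs.boundary_grad
      (fun j s ↦ hχ2 j _) (fun s ↦ hχ1 _) (Eventually.of_forall fun s j ↦ ?_) fun j ↦ ?_
    · have h1 : ‖grad (k := m) (χ j ∘ ι) s‖ ≤ c / (j + 1) :=
        (norm_grad_comp_le hΩ hν ((hχ j).contMDiffAt.mdifferentiableAt (by simp))).trans (hχg j _)
      rw [abs_mul, abs_mul]
      calc |h (ι s)| * |normalDeriv ι ν f s|
            * |inner ℝ (grad (k := m) (χ j ∘ ι) s) (grad (f ∘ ι) s)|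
          ≤ |h (ι s)| * |normalDeriv ι ν f s| * (c / (j + 1) * ‖grad (k := m) (f ∘ ι) s‖) := by
            gcongr
            exact (abs_real_inner_le_norm _ _).trans (by gcongr)
        _ = _ := by ring
    · rw [hRe j]
      exact ((hgreen j).2.1.add (hSi j)).aestronglyMeasurable
  simp only [heq] at hlim1
  exact tendsto_nhds_unique hlim1 hlim2

/-! ### Suitable pairs on compact domains -/

/-- Every integrand is continuous on a compact set. For the integrands with Ric_φ and A, continuity
is read off from the pointwise identities: these express them through Green integrands and other
terms already known to be continuous. -/
theorem isSuitablePair_of_isCompact (hφ : ContMDiff (𝓡 (m + 1)) 𝓘(ℝ, ℝ) ∞ φ)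
    (hΩ : IsDomainWithBoundary (m := m) Ω ι) (hν : IsOutwardUnitNormal (m := m) Ω ι ν)
    (hh : SmoothOnClosed (m := m) (closure Ω) h) (hf : SmoothOnClosed (m := m) (closure Ω) f)
    (hc : IsCompact (closure Ω)) : IsSuitablePair (m := m) φ Ω ι ν h f := by
  have hι := isClosedEmbedding_of_isDomainWithBoundary hΩ
  have hcl := mem_closure_of_isDomainWithBoundary hΩ
  have hlf := isLocallyFiniteMeasure_weightedVolume (k := m + 1) hφ.continuous
  have hlf' := isLocallyFiniteMeasure_weightedVolume (k := m) (hφ.continuous.comp hι.continuous)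
  have hM : ∀ F : M → ℝ, ContinuousOn F (closure Ω) →
      IntegrableOn F Ω (weightedVolume (k := m + 1) φ) := fun F hF ↦
    (hF.integrableOn_compact hc).mono_set subset_closure
  have hSc : CompactSpace S := ⟨by
    have := hι.isCompact_preimage hc
    rwa [eq_univ_of_forall (s := ι ⁻¹' closure Ω) hcl] at this⟩
  have hS : ∀ F : S → ℝ, (∀ s, ContinuousAt F s) →
      Integrable F (weightedVolume (k := m) (φ ∘ ι)) := fun F hF ↦ by
    rw [← integrableOn_univ]
    exact (continuous_iff_continuousAt.2 hF).continuousOn.integrableOn_compact isCompact_univ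
  have hfc : ContinuousOn f (closure Ω) := fun x hx ↦ (hf x hx).continuousAt.continuousWithinAt
  have hhc : ContinuousOn h (closure Ω) := fun x hx ↦ (hh x hx).continuousAt.continuousWithinAt
  have hgf : ContinuousOn (fun x ↦ ‖grad (k := m + 1) f x‖) (closure Ω) := fun x hx ↦
    (continuousAt_norm_grad ((hf x hx).of_le (by simp))).continuousWithinAt
  have hgh : ContinuousOn (fun x ↦ ‖grad (k := m + 1) h x‖) (closure Ω) := fun x hx ↦
    (continuousAt_norm_grad ((hh x hx).of_le (by simp))).continuousWithinAt
  have hH : ContinuousOn (fun x ↦ bilinNormSq (hess (k := m + 1) f x)) (closure Ω) := fun x hx ↦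
    (contMDiffAt_bilinNormSq_hess (n := 0)
      ((hf x hx).of_le (natCast_le_infty _))).continuousAt.continuousWithinAt
  have hL : ∀ {u : M → ℝ}, SmoothOnClosed (m := m) (closure Ω) u →
      ContinuousOn (fun x ↦ weightedLaplacian (k := m + 1) φ u x) (closure Ω) := fun hu x hx ↦
    (contMDiffAt_weightedLaplacian (n := 0) (hφ.contMDiffAt.of_le (natCast_le_infty _))
      ((hu x hx).of_le (natCast_le_infty _))).continuousAt.continuousWithinAt
  have hbulk : ContinuousOn
      (fun x ↦ (weightedLaplacian (k := m + 1) φ h x + h x) * f x ^ 2) (closure Ω) :=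
    ((hL hh).add hhc).mul (hfc.pow 2)
  have hfS : ∀ s, ContinuousAt (fun s ↦ f (ι s)) s := fun s ↦
    (hf _ (hcl s)).continuousAt.comp hι.continuous.continuousAt
  have hhS : ∀ s, ContinuousAt (fun s ↦ h (ι s)) s := fun s ↦
    (hh _ (hcl s)).continuousAt.comp hι.continuous.continuousAt
  have hnS : ∀ {u : M → ℝ}, SmoothOnClosed (m := m) (closure Ω) u →
      ∀ s, ContMDiffAt (𝓡 m) 𝓘(ℝ, ℝ) 1 (normalDeriv ι ν u) s := fun hu s ↦
    contMDiffAt_normalDeriv (n := 1) hΩ hν ((hu _ (hcl s)).of_le (natCast_le_infty _))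
  have hgS : ∀ s, ContinuousAt (fun s ↦ ‖grad (k := m) (f ∘ ι) s‖) s := fun s ↦
    continuousAt_norm_grad (contMDiffAt_comp_embedding hΩ (by simp)
      ((hf _ (hcl s)).of_le (by simp)))
  have hnormal : ∀ s, ContinuousAt (fun s ↦ normalDeriv ι ν h s
      * (‖grad (k := m) (f ∘ ι) s‖ ^ 2 - f (ι s) ^ 2)) s := fun s ↦
    (hnS hh s).continuousAt.mul (((hgS s).pow 2).sub ((hfS s).pow 2))
  refine ⟨hM _ (hhc.abs.mul ((((hfc.pow 2).add (hgf.pow 2)).add hH).add ((hL hf).pow 2))),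
    hM _ (hgh.mul ((hfc.pow 2).add (hgf.pow 2))), hM _ ?_, hM _ hbulk, hS _ fun s ↦ ?_,
    hS _ hnormal, hS _ fun s ↦ ((hhS s).abs.mul (hnS hf s).continuousAt.abs).mul (hgS s)⟩
  -- The divergence identity is solved for the bulk integrand that contains the Ricci tensor.
  · refine (((continuousOn_reilly_left hφ hh hf).sub hbulk).sub
      (continuousOn_sum_greenIntegrand_reilly hφ hh hf)).congr fun x hx ↦ ?_
    rw [Pi.sub_apply, Pi.sub_apply, sum_greenIntegrand_reilly hφ.contMDiffAt (hh x hx) (hf x hx)]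
    ring
  · have h1 : ∀ i, ContinuousAt (fun s ↦ reillyLeft (m + 1) φ h f i (ι s)
        * normalDeriv ι ν (reillyRight (m + 1) h f i) s) s := fun i ↦
      ((contMDiffAt_reillyLeft hφ.contMDiffAt (hh _ (hcl s)) (hf _ (hcl s)) i).continuousAt.comp
        hι.continuous.continuousAt).mul (contMDiffAt_normalDeriv (n := 1) hΩ hν
          (contMDiffAt_reillyRight (hh _ (hcl s)) (hf _ (hcl s)) i)).continuousAt
    have h2 : ContinuousAt (fun s ↦ ∑ i, reillyLeft (m + 1) φ h f i (ι s)
        * normalDeriv ι ν (reillyRight (m + 1) h f i) s) s := tendsto_finsetSum _ fun i _ ↦ h1 i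
    have h3 : ContinuousAt (greenIntegrand (k := m) (φ ∘ ι)
        (fun t ↦ h (ι t) * normalDeriv ι ν f t) (f ∘ ι)) s :=
      continuousAt_greenIntegrand
        (fun s ↦ contMDiffAt_comp_embedding hΩ le_rfl hφ.contMDiffAt)
        ((contMDiffAt_comp_embedding hΩ (by simp) ((hh _ (hcl s)).of_le (by simp))).mul
          (hnS hf s))
        (contMDiffAt_comp_embedding hΩ two_le_infty ((hf _ (hcl s)).of_le two_le_infty))
    -- The boundary identity is solved for the integrand that contains the second fundamental form
    -- and the mean curvature.
    refine ((h2.add h3).sub (hnormal s)).congr (Eventually.of_forall fun t ↦ ?_)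
    simp only [Pi.add_apply, Pi.sub_apply]
    rw [sum_mul_normalDeriv_reilly hΩ hν hφ.contMDiffAt (hh _ (hcl t)) (hf _ (hcl t))]
    ring

end Limit
end

/-! ### Assembly of the formula -/

theorem mainTheorem9 {m : ℕ} (hm : 2 ≤ m + 1)
    {M : Type*} [MetricSpace M] [CompleteSpace M] [MeasurableSpace M] [BorelSpace M]
    [ChartedSpace (EuclideanSpace ℝ (Fin (m + 1))) M] [IsManifold (𝓡 (m + 1)) ∞ M]
    [RiemannianBundle (fun x : M ↦ TangentSpace (𝓡 (m + 1)) x)]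
    [IsContMDiffRiemannianBundle (𝓡 (m + 1)) ∞ (EuclideanSpace ℝ (Fin (m + 1)))
      (fun x : M ↦ TangentSpace (𝓡 (m + 1)) x)]
    [IsRiemannianManifold (𝓡 (m + 1)) M]
    {S : Type*} [TopologicalSpace S] [MeasurableSpace S] [BorelSpace S]
    [ChartedSpace (EuclideanSpace ℝ (Fin m)) S] [IsManifold (𝓡 m) ∞ S]
    [RiemannianBundle (fun s : S ↦ TangentSpace (𝓡 m) s)]
    [IsContMDiffRiemannianBundle (𝓡 m) ∞ (EuclideanSpace ℝ (Fin m))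
      (fun s : S ↦ TangentSpace (𝓡 m) s)]
    (φ : M → ℝ) (hφ : ContMDiff (𝓡 (m + 1)) 𝓘(ℝ, ℝ) ∞ φ)
    (Ω : Set M) (ι : S → M) (hΩ : IsDomainWithBoundary (m := m) Ω ι)
    (ν : ∀ s : S, TangentSpace (𝓡 (m + 1)) (ι s)) (hν : IsOutwardUnitNormal (m := m) Ω ι ν)
    (h f : M → ℝ) (hh : SmoothOnClosed (m := m) (closure Ω) h) (hf : SmoothOnClosed (m := m) (closure Ω) f) :
    (IsCompact (closure Ω) → IsSuitablePair (m := m) φ Ω ι ν h f) ∧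
    (IsSuitablePair (m := m) φ Ω ι ν h f →
      ∫ x in Ω, h x * ((weightedLaplacian (k := m + 1) φ f x + f x) ^ 2
          - bilinNormSq (hess (k := m + 1) f x)) ∂(weightedVolume (k := m + 1) φ)
      = (∫ s, h (ι s)
            * (2 * normalDeriv ι ν f s * weightedLaplacian (k := m) (φ ∘ ι) (f ∘ ι) s
              + weightedMeanCurvature ι ν φ s * normalDeriv ι ν f s ^ 2
              + secondFundamentalForm ι ν s (grad (f ∘ ι) s) (grad (f ∘ ι) s)
              + 2 * normalDeriv ι ν f s * f (ι s)) ∂(weightedVolume (k := m) (φ ∘ ι)))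
        + (∫ s, normalDeriv ι ν h s * (‖grad (k := m) (f ∘ ι) s‖ ^ 2 - f (ι s) ^ 2)
            ∂(weightedVolume (k := m) (φ ∘ ι)))
        + (∫ x in Ω, (hess (k := m + 1) h x (grad f x) (grad f x)
            - weightedLaplacian (k := m + 1) φ h x * ‖grad (k := m + 1) f x‖ ^ 2
            - 2 * h x * ‖grad (k := m + 1) f x‖ ^ 2
            + h x * weightedRicci (k := m + 1) φ x (grad f x) (grad f x))
            ∂(weightedVolume (k := m + 1) φ))
        + ∫ x in Ω, (weightedLaplacian (k := m + 1) φ h x + h x) * f x ^ 2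
            ∂(weightedVolume (k := m + 1) φ)) := by

  have hne : Nonempty M := ⟨hΩ.isConnected.nonempty.some⟩
  -- Completeness gives properness and hence a countable base, which gluing the volume requires; `S`
  -- inherits a countable base and the Hausdorff property through the embedding.
  have := properSpace_of_completeSpace (m + 1) M
  have : SecondCountableTopology M := secondCountable_of_proper
  have hemb := hΩ.embedding.isEmbedding
  have : T2Space S := hemb.t2Space
  have : SecondCountableTopology S := hemb.secondCountableTopology
  refine ⟨isSuitablePair_of_isCompact hφ hΩ hν hh hf, fun hs ↦ ?_⟩
  obtain ⟨χ, hχ, hχK, hχ2, hχg, hχ1⟩ := exists_cutoff (m + 1) M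
  have hcl := mem_closure_of_isDomainWithBoundary hΩ
  have hleft := integrableOn_reilly_left hφ hΩ hh hf hs
  -- Here `Q` is the left integrand minus the two bulk integrands, and `R` is the sum of the two
  -- boundary integrands. All pieces are integrable, so the integrals can be split afterwards.
  have hkey := integral_reilly_eq (by omega) hφ hΩ hν hh hf hχ hχK hχ2 hχg hχ1 hs
    (fun x hx ↦ (sum_greenIntegrand_reilly hφ.contMDiffAt (hh x (subset_closure hx))
      (hf x (subset_closure hx))).symm) ((hleft.sub hs.bulk_grad).sub hs.bulk)
    (fun s ↦ sum_mul_normalDeriv_reilly hΩ hν hφ.contMDiffAt (hh _ (hcl s)) (hf _ (hcl s)))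
    (hs.boundary.add hs.boundary_normal)
  have h1 := integral_sub (hleft.sub hs.bulk_grad) hs.bulk
  simp only [Pi.sub_apply] at h1
  rw [h1, integral_sub hleft hs.bulk_grad, integral_add hs.boundary hs.boundary_normal] at hkey
  linarith
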